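/- Let $D$ be a densely ordered set without least or greatest element containing the rationals (e.g. $\mathbb{Q}$ or $\mathbb{R}$). A \emph{conjunctive query with arithmetic comparisons} (CQAC) $Q=Q_0+\beta$ has a head (a tuple of variables and constants), a finite set $Q_0$ of relational atoms over variables and constants (its relational subgoals), and a finite conjunction $\beta$ of arithmetic comparisons (ACs) $X\,\theta\,Y$, where $X$ is a variable, $Y$ is a variable or a constant and $\theta\in\{<,\le,>,\ge,=,\ne\}$; constants are rational. All variables of the head and of $\beta$ occur in $Q_0$, and $\beta$ is satisfiable in $D$. For a finite database $I$ with values in $D$, $Q(I)$ is the set of head tuples obtained from the assignments of values in $D$ to the variables that make all atoms of $Q_0$ facts of $I$ and make $\beta$ true; $Q_2\sqsubseteq Q_1$ means $Q_2(I)\subseteq Q_1(I)$ for all $I$. With $X$ a variable and $c$ a constant, a \emph{left semi-interval} (LSI) comparison is $X<c$ (open) or $X\le c$ (closed); a \emph{right semi-interval} (RSI) comparison is $X>c$ (open) or $X\ge c$ (closed); both are called semi-interval (SI) comparisons. Fix one of the four choices in which $\lhd$ is one of $\le,<$ and $\rhd$ is one of $\ge,>$. Consider pairs $(Q_2,Q_1)$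 of CQACs such that $Q_2=Q_{20}+\beta_2$ is arbitrary, every AC of $Q_1=Q_{10}+\beta_1$ has one of the forms $X\lhd c$, $X\rhd c$, $X=Y$, $X=c$, with at most one AC of the form $X\rhd c$, and (a) the constant of an RSI of $Q_1$ is different from each constant of an LSI of $Q_1$; (b) no constant $c$ of an open SI of $Q_1$ appears in a closed SI of $Q_2$, where the ACs of $Q_2$ are read up to implication: there is no variable $X$ such that $\beta_2$ implies $X\le c$ but neither $X<c$ nor $X=c$, and none such that $\beta_2$ implies $X\ge c$ but neither $X>c$ nor $X=c$. Then: 1. The problem of deciding, given such a pair $(Q_2,Q_1)$, whether $Q_2\sqsubseteq Q_1$ is in NP: the set of all pairs that satisfy these conditions and $Q_2\sqsubseteq Q_1$ belongs to NP, where queries are encoded with all numbers in binary. 2. Normalization is not needed: for $i=1,2$ let $Q_i'=Q_{i0}'+\beta_i'$ arise from $Q_i$ by replacing all variables that $\beta_i$ forces to be equal by a single one of them, or by the constant $c$ if $\beta_i$ forces them to equal $c$. Then, for every such pair, $Q_2\sqsubseteq Q_1$ if and only if $$\beta_2'\;\Rightarrow\;\bigvee_{\mu}\mu(\beta_1')$$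 holds for all assignments in $D$, where $\mu$ ranges over the containment mappings from $Q_1'$ to $Q_2'$ (maps of variables to variables or constants, fixing constants, that send each relational subgoal of $Q_1'$ to a relational subgoal of $Q_2'$ and the head of $Q_1'$ to the head of $Q_2'$). -/

import Mathlib

/-! ### Conjunctive queries with arithmetic comparisons: syntax -/

/-- The comparison symbols `<, ≤, >, ≥, =, ≠`. -/
inductive CompOp
  | lt | le | gt | ge | eq | ne
  deriving DecidableEq

/-- A term is a variable (variables are named by natural numbers) or a rational constant. -/
inductive QTerm
  | var (x : ℕ)
  | const (c : ℚ)
  deriving DecidableEq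

/-- A relational atom `r(t₁, …, tₖ)`. Relation names are natural numbers. -/
structure QAtom where
  rel : ℕ
  args : List QTerm

/-- An arithmetic comparison `lhs op rhs`. In a query, `lhs` is required to be a variable
(see `CQAC.WellFormed`). -/
structure Comparison where
  lhs : QTerm
  op : CompOp
  rhs : QTerm

/-- A conjunctive query with arithmetic comparisons: the tuple of head terms, the relational
subgoals and the comparison subgoals. -/
structure CQAC where
  head : List QTerm
  body : List QAtom
  acs : List Comparison

/-! ### Semantics over a dense linear order `D`, in which the rational constants are interpreted by
an order embedding `ι` -/

/-- The interpretation of a comparison symbol in a linear order. -/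
def CompOp.Rel {D : Type*} [LinearOrder D] : CompOp → D → D → Prop
  | .lt, x, y => x < y
  | .le, x, y => x ≤ y
  | .gt, x, y => x > y
  | .ge, x, y => x ≥ y
  | .eq, x, y => x = y
  | .ne, x, y => x ≠ y

/-- The value of a term under an assignment `v` of the variables. -/
def QTerm.val {D : Type*} [LinearOrder D] (ι : ℚ ↪o D) (v : ℕ → D) : QTerm → D
  | .var x => v x
  | .const c => ι c

/-- The comparison is true under the assignment `v`. -/
def Comparison.Holds {D : Type*} [LinearOrder D] (ι : ℚ ↪o D) (v : ℕ → D) (a : Comparison) :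
    Prop :=
  a.op.Rel (a.lhs.val ι v) (a.rhs.val ι v)

/-- All comparisons in the list are true under the assignment `v`. -/
def AllHold {D : Type*} [LinearOrder D] (ι : ℚ ↪o D) (v : ℕ → D) (β : List Comparison) : Prop :=
  ∀ a ∈ β, a.Holds ι v

/-- The conjunction `β` of comparisons implies the comparison `a`, i.e. `a` is in the closure
of `β`. -/
def Implied {D : Type*} [LinearOrder D] (ι : ℚ ↪o D) (β : List Comparison) (a : Comparison) :
    Prop :=
  ∀ v : ℕ → D, AllHold ι v β → a.Holds ι v

/-- A fact: a relation name with a tuple of values. -/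
abbrev DBFact (D : Type*) := ℕ × List D

/-- The fact obtained from an atom by an assignment. -/
def QAtom.toFact {D : Type*} [LinearOrder D] (ι : ℚ ↪o D) (v : ℕ → D) (a : QAtom) : DBFact D :=
  (a.rel, a.args.map (QTerm.val ι v))

/-- The answer `Q(I)` of a query on a database instance `I` (a set of facts). -/
def CQAC.answer {D : Type*} [LinearOrder D] (ι : ℚ ↪o D) (Q : CQAC) (I : Set (DBFact D)) :
    Set (List D) :=
  {t | ∃ v : ℕ → D, (∀ a ∈ Q.body, a.toFact ι v ∈ I) ∧ AllHold ι v Q.acs ∧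
    t = Q.head.map (QTerm.val ι v)}

/-- Query containment `Q₂ ⊑ Q₁`: on every (finite) database, every answer of `Q₂` is an answer
of `Q₁`. -/
def Contained {D : Type*} [LinearOrder D] (ι : ℚ ↪o D) (Q₂ Q₁ : CQAC) : Prop :=
  ∀ I : Set (DBFact D), I.Finite → Q₂.answer ι I ⊆ Q₁.answer ι I

/-- The variable `x` occurs in some relational subgoal of `Q`. -/
def CQAC.InBody (Q : CQAC) (x : ℕ) : Prop :=
  ∃ a ∈ Q.body, QTerm.var x ∈ a.args

/-- The standing conventions on queries: heads are safe, every comparison relates a variable to a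
variable or a constant, comparisons are safe, and the comparisons are consistent. -/
structure CQAC.WellFormed {D : Type*} [LinearOrder D] (ι : ℚ ↪o D) (Q : CQAC) : Prop where
  head_safe : ∀ x, QTerm.var x ∈ Q.head → Q.InBody x
  lhs_var : ∀ a ∈ Q.acs, ∃ x, a.lhs = .var x
  acs_safe : ∀ a ∈ Q.acs, ∀ x, (a.lhs = .var x ∨ a.rhs = .var x) → Q.InBody x
  consistent : ∃ v : ℕ → D, AllHold ι v Q.acs

/-! ### The classes of queries -/

/-- The comparison is a semi-interval comparison `X op c` with a variable `X`, for the given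
comparison symbol `op` and constant `c`. -/
def Comparison.IsSI (a : Comparison) (op : CompOp) (c : ℚ) : Prop :=
  ∃ x, a = ⟨.var x, op, .const c⟩

/-- A left semi-interval comparison (`X < c` or `X ≤ c`) with constant `c`. -/
def Comparison.IsLSI (a : Comparison) (c : ℚ) : Prop :=
  a.IsSI .lt c ∨ a.IsSI .le c

/-- A right semi-interval comparison (`X > c` or `X ≥ c`) with constant `c`. -/
def Comparison.IsRSI (a : Comparison) (c : ℚ) : Prop :=
  a.IsSI .gt c ∨ a.IsSI .ge c

/-- An open semi-interval comparison (`X < c` or `X > c`) with constant `c`. -/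
def Comparison.IsOpenSI (a : Comparison) (c : ℚ) : Prop :=
  a.IsSI .lt c ∨ a.IsSI .gt c

open Classical in
/-- The class of queries using only comparisons of types `var lsi const`, `var rsi const`,
`var = var` and `var = const`, at most one of them an RSI. (Normalizing a query only adds
comparisons of the last two types, so a query is in the class if and only if its normalized version
is.) -/
def InClassRSI1 (lsi rsi : CompOp) (Q : CQAC) : Prop :=
  (∀ a ∈ Q.acs, (∃ c, a.IsSI lsi c) ∨ (∃ c, a.IsSI rsi c) ∨ a.op = .eq) ∧
  Q.acs.countP (fun a => decide (∃ c, a.IsRSI c)) ≤ 1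

/-- The constant `c` appears in a closed semi-interval comparison of `β`, where `β` is read up to
the comparisons it implies: for some variable `X`, `X ≤ c` follows from `β` but neither `X < c` nor
`X = c` does, or the same with `≥` and `>`. -/
def InClosedSI {D : Type*} [LinearOrder D] (ι : ℚ ↪o D) (β : List Comparison) (c : ℚ) : Prop :=
  ∃ x : ℕ, ¬ Implied ι β ⟨.var x, .eq, .const c⟩ ∧
    ((Implied ι β ⟨.var x, .le, .const c⟩ ∧ ¬ Implied ι β ⟨.var x, .lt, .const c⟩) ∨
     (Implied ι β ⟨.var x, .ge, .const c⟩ ∧ ¬ Implied ι β ⟨.var x, .gt, .const c⟩))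

/-- The instances of the containment problem: an arbitrary query `Q₂` and a query `Q₁` of the class
above, such that RSI constants of `Q₁` differ from LSI constants of `Q₁`, and constants of open SIs
of `Q₁` do not appear in closed SIs of `Q₂`. -/
structure IsInstance {D : Type*} [LinearOrder D] (ι : ℚ ↪o D) (lsi rsi : CompOp)
    (Q₂ Q₁ : CQAC) : Prop where
  wf₂ : Q₂.WellFormed ι
  wf₁ : Q₁.WellFormed ι
  inClass : InClassRSI1 lsi rsi Q₁
  rsi_ne_lsi : ∀ a ∈ Q₁.acs, ∀ b ∈ Q₁.acs, ∀ c d, a.IsRSI c → b.IsLSI d → c ≠ d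
  open_closed : ∀ a ∈ Q₁.acs, ∀ c, a.IsOpenSI c → ¬ InClosedSI ι Q₂.acs c

/-! ### The containment test without normalization -/

/-- Apply a substitution of the variables to a term; constants are fixed. -/
def QTerm.subst (σ : ℕ → QTerm) : QTerm → QTerm
  | .var x => σ x
  | .const c => .const c

/-- Apply a substitution to an atom. -/
def QAtom.subst (σ : ℕ → QTerm) (a : QAtom) : QAtom :=
  ⟨a.rel, a.args.map (QTerm.subst σ)⟩

/-- Apply a substitution to a comparison. -/
def Comparison.subst (σ : ℕ → QTerm) (a : Comparison) : Comparison :=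
  ⟨a.lhs.subst σ, a.op, a.rhs.subst σ⟩

/-- Apply a substitution to a query. -/
def CQAC.subst (σ : ℕ → QTerm) (Q : CQAC) : CQAC :=
  ⟨Q.head.map (QTerm.subst σ), Q.body.map (QAtom.subst σ), Q.acs.map (Comparison.subst σ)⟩

open Classical in
/-- The representative of the variable `x` modulo the equations implied by `β`: the constant that
`x` is forced to equal if there is one, and otherwise the least variable that `x` is forced to
equal. -/
noncomputable def eqRepr {D : Type*} [LinearOrder D] (ι : ℚ ↪o D) (β : List Comparison) (x : ℕ) :
    QTerm :=
  if h : ∃ c : ℚ, Implied ι β ⟨.var x, .eq, .const c⟩ then .const h.choose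
  else .var (sInf {y : ℕ | Implied ι β ⟨.var x, .eq, .var y⟩})

/-- The non-normalized form of `Q`: all variables shown equal by the comparisons of `Q` are
replaced by a single variable or constant. (Equations of `Q` become trivial equations `t = t`.) -/
noncomputable def CQAC.collapse {D : Type*} [LinearOrder D] (ι : ℚ ↪o D) (Q : CQAC) : CQAC :=
  Q.subst (eqRepr ι Q.acs)

/-- `μ` is a containment mapping from `Q₁` to `Q₂`: it maps every relational subgoal of `Q₁` to a
relational subgoal of `Q₂`, and the head of `Q₁` to the head of `Q₂`. -/
def IsContainmentMapping (μ : ℕ → QTerm) (Q₁ Q₂ : CQAC) : Prop :=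
  (∀ a ∈ Q₁.body, a.subst μ ∈ Q₂.body) ∧ Q₁.head.map (QTerm.subst μ) = Q₂.head

/-- The containment entailment `β₂ ⇒ μ₁(β₁) ∨ ⋯ ∨ μₖ(β₁)`, where `μ₁, …, μₖ` are all containment
mappings from `Q₁` to `Q₂`. -/
def ContainmentEntailment {D : Type*} [LinearOrder D] (ι : ℚ ↪o D) (Q₂ Q₁ : CQAC) : Prop :=
  ∀ v : ℕ → D, AllHold ι v Q₂.acs →
    ∃ μ : ℕ → QTerm, IsContainmentMapping μ Q₁ Q₂ ∧ AllHold ι v (Q₁.acs.map (Comparison.subst μ))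

/-! ### Polynomial time and NP

The machine model consists of WHILE programs whose variables hold binary trees. Evaluating an
expression is charged with the sizes of all the values that are read or built, so that running time
is polynomially related to the running time of Turing machines. -/

/-- Binary trees, the data of the machine model. -/
inductive BTree
  | nil
  | cons (l r : BTree)
  deriving DecidableEq

/-- The number of nodes, leaves included. -/
def BTree.size : BTree → ℕ
  | .nil => 1
  | .cons l r => l.size + r.size + 1

/-- The left subtree (`nil` for `nil`). -/
def BTree.left : BTree → BTree
  | .nil => .nil
  | .cons l _ => l

/-- The right subtree (`nil` for `nil`). -/
def BTree.right : BTree → BTree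
  | .nil => .nil
  | .cons _ r => r

/-- Truth values as trees: `nil` is false. -/
def BTree.ofBool : Bool → BTree
  | false => .nil
  | true => .cons .nil .nil

/-- The contents of the program variables. -/
abbrev Store := ℕ → BTree

/-- Expressions of the programming language. -/
inductive WExpr
  | var (i : ℕ)
  | nil
  | cons (e f : WExpr)
  | left (e : WExpr)
  | right (e : WExpr)
  | equal (e f : WExpr)

/-- The value of an expression. -/
def WExpr.eval (s : Store) : WExpr → BTree
  | .var i => s i
  | .nil => .nil
  | .cons e f => .cons (e.eval s) (f.eval s)
  | .left e => (e.eval s).left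
  | .right e => (e.eval s).right
  | .equal e f => .ofBool (decide (e.eval s = f.eval s))

/-- The cost of evaluating an expression: the total size of the values of its subexpressions. -/
def WExpr.cost (s : Store) : WExpr → ℕ
  | .var i => (s i).size
  | .nil => 1
  | .cons e f => e.cost s + f.cost s + (WExpr.eval s (.cons e f)).size
  | .left e => e.cost s + (WExpr.eval s (.left e)).size
  | .right e => e.cost s + (WExpr.eval s (.right e)).size
  | .equal e f => e.cost s + f.cost s + (WExpr.eval s (.equal e f)).size

/-- Programs. -/
inductive WProg
  | assign (i : ℕ) (e : WExpr)
  | seq (p q : WProg)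
  | cond (e : WExpr) (p q : WProg)
  | loop (e : WExpr) (p : WProg)

/-- `WProg.Run p s s' t`: started in the store `s`, the program `p` halts in the store `s'` after
`t` steps. Tests succeed on all trees except `nil`. -/
inductive WProg.Run : WProg → Store → Store → ℕ → Prop
  | assign (i : ℕ) (e : WExpr) (s : Store) :
      WProg.Run (.assign i e) s (Function.update s i (e.eval s)) (e.cost s + 1)
  | seq {p q : WProg} {s s' s'' : Store} {t t' : ℕ} :
      WProg.Run p s s' t → WProg.Run q s' s'' t' → WProg.Run (.seq p q) s s'' (t + t')
  | cond_true {e : WExpr} {p q : WProg} {s s' : Store} {t : ℕ} :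
      e.eval s ≠ .nil → WProg.Run p s s' t → WProg.Run (.cond e p q) s s' (e.cost s + 1 + t)
  | cond_false {e : WExpr} {p q : WProg} {s s' : Store} {t : ℕ} :
      e.eval s = .nil → WProg.Run q s s' t → WProg.Run (.cond e p q) s s' (e.cost s + 1 + t)
  | loop_done {e : WExpr} {p : WProg} {s : Store} :
      e.eval s = .nil → WProg.Run (.loop e p) s s (e.cost s + 1)
  | loop_step {e : WExpr} {p : WProg} {s s' s'' : Store} {t t' : ℕ} :
      e.eval s ≠ .nil → WProg.Run p s s' t → WProg.Run (.loop e p) s' s'' t' →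
      WProg.Run (.loop e p) s s'' (e.cost s + 1 + t + t')

/-- The initial store: the input in variable `0`, all other variables empty. -/
def inputStore (x : BTree) : Store := fun i => if i = 0 then x else .nil

/-- The program halts on input `x` within `n` steps. -/
def WProg.HaltsWithin (p : WProg) (x : BTree) (n : ℕ) : Prop :=
  ∃ s t, p.Run (inputStore x) s t ∧ t ≤ n

/-- The program halts on input `x` with a non-empty tree in variable `0`. -/
def WProg.Accepts (p : WProg) (x : BTree) : Prop :=
  ∃ s t, p.Run (inputStore x) s t ∧ s 0 ≠ .nil

/-- The set `L` of objects of type `α`, presented to the machine by the encoding `enc`, is in NP: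
there is a polynomial-time verifier, and the members of `L` are the objects for which it accepts
some certificate of polynomial size. -/
def InNP {α : Type*} (enc : α → BTree) (L : Set α) : Prop :=
  ∃ (V : WProg) (p : Polynomial ℕ),
    (∀ a w, V.HaltsWithin (.cons (enc a) w) (p.eval (BTree.cons (enc a) w).size)) ∧
    ∀ a, a ∈ L ↔ ∃ w : BTree, w.size ≤ p.eval (enc a).size ∧ V.Accepts (.cons (enc a) w)

/-! ### Encoding of queries; all numbers are written in binary -/

/-- Encoding of a list, given an encoding of its members. -/
def encList {α : Type*} (enc : α → BTree) : List α → BTree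
  | [] => .nil
  | a :: l => .cons (enc a) (encList enc l)

/-- A natural number as the list of its binary digits, least significant digit first. -/
def encNat (n : ℕ) : BTree := encList BTree.ofBool n.bits

/-- A rational number as sign, numerator and denominator. -/
def encRat (q : ℚ) : BTree :=
  .cons (.ofBool (decide (q < 0))) (.cons (encNat q.num.natAbs) (encNat q.den))

/-- Encoding of terms. -/
def encTerm : QTerm → BTree
  | .var x => .cons (.ofBool false) (encNat x)
  | .const c => .cons (.ofBool true) (encRat c)

/-- Encoding of atoms. -/
def encAtom (a : QAtom) : BTree := .cons (encNat a.rel) (encList encTerm a.args)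

/-- Encoding of comparison symbols. -/
def encOp : CompOp → BTree
  | .lt => encNat 0
  | .le => encNat 1
  | .gt => encNat 2
  | .ge => encNat 3
  | .eq => encNat 4
  | .ne => encNat 5

/-- Encoding of comparisons. -/
def encComparison (a : Comparison) : BTree :=
  .cons (encTerm a.lhs) (.cons (encOp a.op) (encTerm a.rhs))

/-- Encoding of queries. -/
def encQuery (Q : CQAC) : BTree :=
  .cons (encList encTerm Q.head) (.cons (encList encAtom Q.body) (encList encComparison Q.acs))

/-- Encoding of pairs of queries. -/
def encQueryPair (P : CQAC × CQAC) : BTree := .cons (encQuery P.1) (encQuery P.2)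

/-!
A database satisfies the body of `Q₂` exactly when it contains the facts of `Q₂` under a model `v`
of `β₂`, so `Q₂ ⊑ Q₁` says that for every model `v` of `β₂` some assignment `u` satisfies `β₁` and
maps the subgoals of `Q₁` to subgoals of `Q₂` evaluated under `v`. If `v` gives equal values only
to terms that `β₂` forces to be equal, then `u` comes from a containment mapping `μ` of the
collapsed queries. An arbitrary model `v` can be perturbed to such a generic one, keeping the
strict order of the values. The perturbation could destroy the truth of `μ(β₁')` on the way back
to `v` only at an open semi-interval whose constant is a value of `v`. These values are moved off
the constant beforehand, towards the side on which the open comparison fails: no closed comparison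
of `β₂` stands in the way, by (b), and no constant is asked to move in both directions, by (a).

For membership in NP, the generic models of `β₂`, with the values on the violating side of the
constants, show that the disjunction over `μ` reduces to mappings for which all comparisons of
`β₁` but the single one `X ▷ c` are implied. A certificate is a list of mappings `μ₁, …, μₖ` such
that `β₂` together with `¬ (μⱼ(X) ▷ c)` for `j < i` implies the other comparisons of `μᵢ(β₁)`, and
such that `β₂` together with all `¬ (μⱼ(X) ▷ c)` is unsatisfiable. Each new mapping has a new term
`μⱼ(X)`, so polynomially many mappings suffice. A conjunction of comparisons is satisfiable unless
its transitive closure forces two terms to be equal that it also requires to be different, and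
this is decided in polynomial time.
-/

namespace WProg

/-- The program halts within `T` steps when started in the store `s`, and its final store satisfies
`R`: a total correctness assertion with a time bound. -/
def Ensures (P : WProg) (s : Store) (T : ℕ) (R : Store → Prop) : Prop :=
  ∃ s' t, P.Run s s' t ∧ t ≤ T ∧ R s'

variable {P Q : WProg} {e : WExpr} {s : Store} {T T' c : ℕ} {R R' : Store → Prop}

theorem Ensures.mono (h : P.Ensures s T R) (hT : T ≤ T') (hR : ∀ s', R s' → R' s') :
    P.Ensures s T' R' := by
  obtain ⟨s', t, run, ht, hs'⟩ := h
  exact ⟨s', t, run, ht.trans hT, hR s' hs'⟩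

theorem Ensures.assign {i : ℕ} (hc : e.cost s + 1 ≤ T) (h : R (Function.update s i (e.eval s))) :
    (assign i e).Ensures s T R :=
  ⟨_, _, .assign i e s, hc, h⟩

theorem Ensures.seq (hP : P.Ensures s T R) (hQ : ∀ s', R s' → Q.Ensures s' T' R') :
    (P.seq Q).Ensures s (T + T') R' := by
  obtain ⟨s', t, run, ht, hs'⟩ := hP
  obtain ⟨s'', t', run', ht', hs''⟩ := hQ s' hs'
  exact ⟨s'', _, .seq run run', add_le_add ht ht', hs''⟩

theorem Ensures.assign_seq {i : ℕ} (hc : e.cost s + 1 ≤ c)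
    (h : P.Ensures (Function.update s i (e.eval s)) T R) :
    ((WProg.assign i e).seq P).Ensures s (c + T) R :=
  .seq (R := (· = Function.update s i (e.eval s))) (.assign hc rfl) fun _ hs => hs ▸ h

theorem Ensures.loop {J : ℕ → Store → Prop}
    (hdone : ∀ s, J 0 s → e.eval s = .nil ∧ e.cost s + 1 ≤ c)
    (hstep : ∀ n s, J (n + 1) s → e.eval s ≠ .nil ∧ e.cost s + 1 ≤ c ∧ P.Ensures s T (J n))
    (n : ℕ) (h : J n s) : (WProg.loop e P).Ensures s (n * (c + T) + c) (J 0) := by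
  induction n generalizing s with
  | zero =>
    obtain ⟨he, hc⟩ := hdone s h
    exact ⟨s, _, .loop_done he, by simpa using hc, h⟩
  | succ n ih =>
    obtain ⟨he, hc, s', t, run, ht, hs'⟩ := hstep n s h
    obtain ⟨s'', t', run', ht', hs''⟩ := ih hs'
    exact ⟨s'', _, .loop_step he run run', by rw [add_one_mul]; omega, hs''⟩

theorem size_eval_le_cost (s : Store) (e : WExpr) : (e.eval s).size ≤ e.cost s := by
  cases e <;> simp [WExpr.cost, WExpr.eval, BTree.size]

theorem Run.size_le {s' : Store} {t : ℕ} (h : P.Run s s' t) (i : ℕ) :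
    (s' i).size ≤ (s i).size + t := by
  induction h with
  | assign j e s =>
    obtain rfl | hij := eq_or_ne i j
    · have := size_eval_le_cost s e
      rw [Function.update_self]
      omega
    · rw [Function.update_of_ne hij]
      exact Nat.le_add_right _ _
  | seq _ _ ih₁ ih₂ => omega
  | cond_true _ _ ih => omega
  | cond_false _ _ ih => omega
  | loop_done _ => omega
  | loop_step _ _ _ ih₁ ih₂ => omega

theorem Run.store_unique {s₁ s₂ : Store} {t₁ t₂ : ℕ} (h₁ : P.Run s s₁ t₁) (h₂ : P.Run s s₂ t₂) :
    s₁ = s₂ := by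
  induction h₁ generalizing s₂ t₂ with
  | assign => cases h₂; rfl
  | seq _ _ ih₁ ih₂ =>
    obtain _ | @⟨_, _, _, _, _, _, _, hP, hQ⟩ := h₂
    exact ih₂ (ih₁ hP ▸ hQ)
  | cond_true he _ ih =>
    cases h₂ with
    | cond_true _ h => exact ih h
    | cond_false he' _ => exact absurd he' he
  | cond_false he _ ih =>
    cases h₂ with
    | cond_true he' _ => exact absurd he he'
    | cond_false _ h => exact ih h
  | loop_done he =>
    cases h₂ with
    | loop_done => rfl
    | loop_step he' _ _ => exact absurd he he'
  | loop_step he _ _ ih₁ ih₂ =>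
    cases h₂ with
    | loop_done he' => exact absurd he' he
    | loop_step _ hP hloop => exact ih₂ (ih₁ hP ▸ hloop)

end WProg

/-- Types whose elements are presented to the machine as binary trees. -/
class TreeCode (α : Type*) where
  code : α → BTree
  code_injective : Function.Injective code

open TreeCode (code code_injective)

/-- The size of the code of an object. -/
def codeSize {α : Type*} [TreeCode α] (a : α) : ℕ := (code a).size

theorem encList_injective {α : Type*} {enc : α → BTree} (h : Function.Injective enc) :
    Function.Injective (encList enc) := by
  intro l
  induction l with
  | nil =>
    rintro (_ | _) hm
    · rfl
    · exact BTree.noConfusion hm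
  | cons a l ih =>
    rintro (_ | ⟨b, m⟩) hm
    · exact BTree.noConfusion hm
    · obtain ⟨hab, hlm⟩ := BTree.cons.inj hm
      rw [h hab, ih hlm]

section TreeCode

variable {α β : Type*} [TreeCode α] [TreeCode β]

instance : TreeCode BTree := ⟨id, Function.injective_id⟩

instance : TreeCode Bool := ⟨BTree.ofBool, by unfold Function.Injective; decide⟩

instance : TreeCode (α × β) :=
  ⟨fun x => .cons (code x.1) (code x.2), fun _ _ h =>
    Prod.ext (code_injective (BTree.cons.inj h).1) (code_injective (BTree.cons.inj h).2)⟩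

instance : TreeCode (List α) := ⟨encList code, encList_injective code_injective⟩

theorem code_pair (a : α) (b : β) : code (a, b) = .cons (code a) (code b) := rfl

theorem code_nil : code ([] : List α) = .nil := rfl

theorem code_cons (a : α) (l : List α) : code (a :: l) = .cons (code a) (code l) := rfl

theorem codeSize_pair (a : α) (b : β) : codeSize (a, b) = codeSize a + codeSize b + 1 := rfl

theorem codeSize_nil : codeSize ([] : List α) = 1 := rfl

theorem codeSize_cons (a : α) (l : List α) :
    codeSize (a :: l) = codeSize a + codeSize l + 1 := rfl

theorem codeSize_bool_le (b : Bool) : codeSize b ≤ 3 := by cases b <;> decide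

theorem codeSize_append (l m : List α) : codeSize (l ++ m) + 1 = codeSize l + codeSize m := by
  induction l with
  | nil => rw [List.nil_append, codeSize_nil, add_comm]
  | cons a l ih => simp only [List.cons_append, codeSize_cons]; omega

theorem length_lt_codeSize (l : List α) : l.length < codeSize l := by
  induction l with
  | nil => exact one_pos
  | cons a l ih => rw [codeSize_cons, List.length_cons]; omega

theorem codeSize_le_of_sublist {l m : List α} (h : l.Sublist m) : codeSize l ≤ codeSize m := by
  induction h with
  | slnil => rfl
  | cons a _ ih => rw [codeSize_cons]; omega
  | cons_cons a _ ih => simpa only [codeSize_cons, add_le_add_iff_right, add_le_add_iff_left]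

theorem codeSize_le_of_mem {a : α} {l : List α} (h : a ∈ l) : codeSize a ≤ codeSize l := by
  have := codeSize_le_of_sublist (List.singleton_sublist.2 h)
  rw [codeSize_cons] at this
  omega

end TreeCode

theorem monotone_eval_nat (p : Polynomial ℕ) : Monotone fun n => p.eval n := by
  intro m n h
  simp only [Polynomial.eval_eq_sum, Polynomial.sum]
  gcongr

/-- A quantity depending on an encoded object is bounded by a polynomial in the size of its code. -/
def PolyBounded {α : Type*} [TreeCode α] (T : α → ℕ) : Prop :=
  ∃ p : Polynomial ℕ, ∀ a, T a ≤ p.eval (codeSize a)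

namespace PolyBounded

variable {α β : Type*} [TreeCode α] [TreeCode β] {S T : α → ℕ}

protected theorem const (n : ℕ) : PolyBounded fun _ : α => n :=
  ⟨Polynomial.C n, fun _ => by rw [Polynomial.eval_C]⟩

protected theorem codeSize : PolyBounded (codeSize : α → ℕ) :=
  ⟨Polynomial.X, fun _ => by rw [Polynomial.eval_X]⟩

theorem mono (hT : PolyBounded T) (h : ∀ a, S a ≤ T a) : PolyBounded S :=
  let ⟨p, hp⟩ := hT
  ⟨p, fun a => (h a).trans (hp a)⟩

theorem add (hS : PolyBounded S) (hT : PolyBounded T) : PolyBounded fun a => S a + T a :=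
  let ⟨p, hp⟩ := hS
  let ⟨q, hq⟩ := hT
  ⟨p + q, fun a => by rw [Polynomial.eval_add]; exact add_le_add (hp a) (hq a)⟩

theorem mul (hS : PolyBounded S) (hT : PolyBounded T) : PolyBounded fun a => S a * T a :=
  let ⟨p, hp⟩ := hS
  let ⟨q, hq⟩ := hT
  ⟨p * q, fun a => by rw [Polynomial.eval_mul]; exact Nat.mul_le_mul (hp a) (hq a)⟩

theorem const_mul (n : ℕ) (hT : PolyBounded T) : PolyBounded fun a => n * T a :=
  .mul (.const n) hT

theorem exists_uniform_bound {U : β → ℕ} (hU : PolyBounded U) (hS : PolyBounded S) :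
    ∃ T : α → ℕ, PolyBounded T ∧ ∀ a b, codeSize b ≤ S a → U b ≤ T a := by
  obtain ⟨p, hp⟩ := hU
  obtain ⟨q, hq⟩ := hS
  refine ⟨fun a => p.eval (q.eval (codeSize a)), ⟨p.comp q, fun a => ?_⟩, fun a b hb => ?_⟩
  · rw [Polynomial.eval_comp]
  · exact (hp b).trans (monotone_eval_nat p (hb.trans (hq a)))

theorem comp {U : β → ℕ} {f : α → β} (hU : PolyBounded U)
    (hf : PolyBounded fun a => codeSize (f a)) : PolyBounded fun a => U (f a) :=
  let ⟨_, hT, hle⟩ := hU.exists_uniform_bound hf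
  hT.mono fun a => hle a (f a) le_rfl

end PolyBounded

/-- The function `f` is computed on codes, from variable `0` to variable `0`, by a program that runs
in polynomial time and leaves all but finitely many variables unchanged. The latter makes room for
the local variables of programs that call it. -/
def PolyTime {α β : Type*} [TreeCode α] [TreeCode β] (f : α → β) : Prop :=
  ∃ (P : WProg) (k : ℕ) (T : α → ℕ), PolyBounded T ∧ ∀ a (s : Store), s 0 = code a →
    P.Ensures s (T a) fun s' => s' 0 = code (f a) ∧ ∀ i, k < i → s' i = s i

namespace PolyTime

variable {α β γ δ σ : Type*} [TreeCode α] [TreeCode β] [TreeCode γ] [TreeCode δ] [TreeCode σ]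

theorem polyBounded {f : α → β} (hf : PolyTime f) : PolyBounded fun a => codeSize (f a) := by
  obtain ⟨P, k, T, hT, hP⟩ := hf
  refine (PolyBounded.codeSize.add hT).mono fun a => ?_
  obtain ⟨s', t, run, ht, h0, -⟩ := hP a (fun _ => code a) rfl
  have hsize := run.size_le 0
  rw [h0] at hsize
  exact hsize.trans (Nat.add_le_add_left ht _)

theorem recode {f : α → β} {g : α → γ} (hg : PolyTime g) (h : ∀ a, code (f a) = code (g a)) :
    PolyTime f := by
  obtain ⟨P, k, T, hT, hP⟩ := hg
  refine ⟨P, k, T, hT, fun a s hs => ?_⟩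
  rw [h]
  exact hP a s hs

theorem of_eq {f g : α → β} (hg : PolyTime g) (h : ∀ a, f a = g a) : PolyTime f :=
  hg.recode fun a => congrArg code (h a)

theorem comp {g : β → γ} {f : α → β} (hg : PolyTime g) (hf : PolyTime f) :
    PolyTime fun a => g (f a) := by
  have hsize := hf.polyBounded
  obtain ⟨P, k, T, hT, hP⟩ := hf
  obtain ⟨Q, l, U, hU, hQ⟩ := hg
  refine ⟨.seq P Q, max k l, _, hT.add (hU.comp hsize), fun a s hs => ?_⟩
  refine .seq (hP a s hs) fun s₁ ⟨h₁, f₁⟩ => (hQ (f a) s₁ h₁).mono le_rfl fun s₂ ⟨h₂, f₂⟩ => ?_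
  exact ⟨h₂, fun i hi => (f₂ i (by omega)).trans (f₁ i (by omega))⟩

theorem of_expr {f : α → β} {T : α → ℕ} (e : WExpr) (hT : PolyBounded T)
    (h : ∀ a (s : Store), s 0 = code a → e.eval s = code (f a) ∧ e.cost s ≤ T a) :
    PolyTime f := by
  refine ⟨.assign 0 e, 0, _, hT.add (.const 1), fun a s hs => ?_⟩
  obtain ⟨heval, hcost⟩ := h a s hs
  refine .assign (Nat.add_le_add_right hcost 1) ⟨?_, fun i hi => ?_⟩
  · rw [Function.update_self, heval]
  · rw [Function.update_of_ne hi.ne']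

protected theorem id : PolyTime fun a : α => a :=
  of_expr (.var 0) .codeSize fun _ _ hs => ⟨hs, (congrArg BTree.size hs).le⟩

theorem exists_expr_eval (x : BTree) :
    ∃ (e : WExpr) (c : ℕ), ∀ s, e.eval s = x ∧ e.cost s = c := by
  induction x with
  | nil => exact ⟨.nil, 1, fun _ => ⟨rfl, rfl⟩⟩
  | cons l r ihl ihr =>
    obtain ⟨e, c, he⟩ := ihl
    obtain ⟨e', c', he'⟩ := ihr
    exact ⟨.cons e e', c + c' + (BTree.cons l r).size, fun s => by
      simp only [WExpr.eval, WExpr.cost, he, he', and_self]⟩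

protected theorem const (b : β) : PolyTime fun _ : α => b :=
  let ⟨e, c, he⟩ := exists_expr_eval (code b)
  of_expr e (.const c) fun _ s _ => ⟨(he s).1, (he s).2.le⟩

theorem encode {f : α → β} (hf : PolyTime f) : PolyTime fun a => code (f a) :=
  hf.recode fun _ => rfl

theorem left {f : α → β} {g : α → γ} (hg : PolyTime g)
    (h : ∀ a, code (f a) = (code (g a)).left) : PolyTime f := by
  have key : PolyTime BTree.left := of_expr (.left (.var 0)) (.add .codeSize .codeSize)
    fun x s (hs : s 0 = x) => by
      have : x.left.size ≤ x.size := by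
        cases x <;> simp only [BTree.left, BTree.size] <;> omega
      simpa only [WExpr.eval, WExpr.cost, hs, codeSize, code, id_eq, true_and,
        add_le_add_iff_left] using this
  exact (key.comp hg.encode).recode h

theorem right {f : α → β} {g : α → γ} (hg : PolyTime g)
    (h : ∀ a, code (f a) = (code (g a)).right) : PolyTime f := by
  have key : PolyTime BTree.right := of_expr (.right (.var 0)) (.add .codeSize .codeSize)
    fun x s (hs : s 0 = x) => by
      have : x.right.size ≤ x.size := by
        cases x <;> simp only [BTree.right, BTree.size] <;> omega
      simpa only [WExpr.eval, WExpr.cost, hs, codeSize, code, id_eq, true_and,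
        add_le_add_iff_left] using this
  exact (key.comp hg.encode).recode h

theorem fst {f : α → β × γ} (hf : PolyTime f) : PolyTime fun a => (f a).1 := hf.left fun _ => rfl

theorem snd {f : α → β × γ} (hf : PolyTime f) : PolyTime fun a => (f a).2 := hf.right fun _ => rfl

theorem pair {f : α → β} {g : α → γ} (hf : PolyTime f) (hg : PolyTime g) :
    PolyTime fun a => (f a, g a) := by
  have hf' := hf.polyBounded
  have hg' := hg.polyBounded
  obtain ⟨P, k, T, hT, hP⟩ := hf
  obtain ⟨Q, l, U, hU, hQ⟩ := hg
  let m := max k l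
  refine ⟨.seq (.assign (m + 1) (.var 0)) (.seq P (.seq (.assign (m + 2) (.var 0))
      (.seq (.assign 0 (.var (m + 1))) (.seq Q (.assign 0 (.cons (.var (m + 2)) (.var 0))))))),
    m + 2, _, (PolyBounded.codeSize.add (.const 1)).add (hT.add ((hf'.add (.const 1)).add
      ((PolyBounded.codeSize.add (.const 1)).add (hU.add
        ((hf'.add hg').add ((hf'.add hg').add (.const 2))))))), fun a s hs => ?_⟩
  refine .assign_seq (by simp only [WExpr.cost, hs, codeSize, le_refl]) (.seq (hP a _ ?_)
    fun s₁ ⟨h₁, f₁⟩ => ?_)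
  · rw [Function.update_of_ne (by omega), hs]
  have ctx₁ : s₁ (m + 1) = code a := by
    rw [f₁ _ (by omega), Function.update_self, WExpr.eval, hs]
  refine .assign_seq (by simp only [WExpr.cost, h₁, codeSize, le_refl]) (.assign_seq ?_
    (.seq (hQ a _ ?_) fun s₂ ⟨h₂, f₂⟩ => ?_))
  · rw [WExpr.cost, Function.update_of_ne (by omega), ctx₁, codeSize]
  · rw [Function.update_self, WExpr.eval, Function.update_of_ne (by omega), ctx₁]
  have out₁ : s₂ (m + 2) = code (f a) := by
    rw [f₂ _ (by omega), Function.update_of_ne (by omega), Function.update_self, WExpr.eval, h₁]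
  refine .assign ?_ ⟨?_, fun i hi => ?_⟩
  · simp only [WExpr.cost, WExpr.eval, BTree.size, out₁, h₂, codeSize]
    omega
  · simp only [WExpr.eval, Function.update_self, out₁, h₂, code_pair]
  · rw [Function.update_of_ne (by omega), f₂ i (by omega), Function.update_of_ne (by omega),
      Function.update_of_ne (by omega), f₁ i (by omega), Function.update_of_ne (by omega)]

theorem decide_eq [DecidableEq β] {f g : α → β} (hf : PolyTime f) (hg : PolyTime g) :
    PolyTime fun a => decide (f a = g a) := by
  have key : PolyTime fun x : BTree × BTree => decide (x.1 = x.2) := by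
    refine of_expr (.equal (.left (.var 0)) (.right (.var 0)))
      ((PolyBounded.codeSize.const_mul 5).add (.const 3))
      fun x s (hs : s 0 = .cons x.1 x.2) => ⟨?_, ?_⟩
    · simp only [WExpr.eval, hs, BTree.left, BTree.right, code]
    · have := codeSize_bool_le (decide (x.1 = x.2))
      simp only [codeSize, code, id_eq, WExpr.cost, WExpr.eval, hs, BTree.left, BTree.right,
        BTree.size] at this ⊢
      omega
  exact (key.comp (hf.encode.pair hg.encode)).of_eq fun a =>
    decide_eq_decide.2 code_injective.eq_iff.symm

/-- The loop body that folds the function computed by `P` over the list in variable `m + 3`, with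
the accumulator in variable `m + 2` and the fixed first argument in variable `m + 1`. -/
def foldBody (P : WProg) (m : ℕ) : WProg :=
  .seq (.assign 0 (.cons (.var (m + 1)) (.cons (.var (m + 2)) (.left (.var (m + 3))))))
    (.seq P (.seq (.assign (m + 2) (.var 0)) (.assign (m + 3) (.right (.var (m + 3))))))

/-- The program that folds the function computed by `P`, started on the code of the triple of the
fixed first argument, the initial accumulator and the list. -/
def foldProg (P : WProg) (m : ℕ) : WProg :=
  .seq (.assign (m + 1) (.left (.var 0))) (.seq (.assign (m + 2) (.left (.right (.var 0))))
    (.seq (.assign (m + 3) (.right (.right (.var 0))))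
      (.seq (.loop (.var (m + 3)) (foldBody P m)) (.assign 0 (.var (m + 2))))))

/-- The loop of `foldProg P m`, entered in the store `s₀` on the list `l` with the accumulator `z`,
still has to process `n` elements. -/
def FoldInvariant (f : σ → γ → σ) (m : ℕ) (a : α) (z : σ) (l : List γ) (s₀ : Store) (n : ℕ)
    (s : Store) : Prop :=
  s (m + 1) = code a ∧ (∀ i, m + 3 < i → s i = s₀ i) ∧ ∃ l₁ l₂ : List γ, l₁ ++ l₂ = l ∧
    l₂.length = n ∧ s (m + 2) = code (l₁.foldl f z) ∧ s (m + 3) = code l₂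

section Fold

variable {f : α → σ → γ → σ} {P : WProg} {k m S V : ℕ} {T : α × σ × γ → ℕ} {a : α} {z : σ}
  {l : List γ} {s s₀ : Store} (hkm : k ≤ m) (hP : ∀ x (s : Store), s 0 = code x →
    P.Ensures s (T x) fun s' => s' 0 = code (f x.1 x.2.1 x.2.2) ∧ ∀ i, k < i → s' i = s i)
  (ha : codeSize a ≤ S) (hl : codeSize l ≤ S)
  (hacc : ∀ l', l' <+: l → codeSize (l'.foldl (f a) z) ≤ S)
  (hV : ∀ x, codeSize x ≤ 3 * S + 2 → T x ≤ V)
include hkm hP ha hl hacc hV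

theorem foldBody_ensures {n : ℕ} (h : FoldInvariant (f a) m a z l s₀ (n + 1) s) :
    (foldBody P m).Ensures s (15 * S + V + 10) (FoldInvariant (f a) m a z l s₀ n) := by
  obtain ⟨h₁, frame, l₁, _ | ⟨e, l₂⟩, rfl, hlen, h₂, h₃⟩ := h
  · simp at hlen
  have hS := hacc l₁ (List.prefix_append _ _)
  have hS' := hacc (l₁ ++ [e]) ⟨l₂, by rw [List.append_assoc, List.singleton_append]⟩
  have hsize := (codeSize_le_of_sublist (List.sublist_append_right l₁ (e :: l₂))).trans hl
  rw [codeSize_cons] at hsize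
  rw [List.foldl_append, List.foldl_cons, List.foldl_nil] at hS'
  set acc := l₁.foldl (f a) z
  have hT := hV (a, acc, e) (by simp only [codeSize_pair]; omega)
  refine WProg.Ensures.mono (.assign_seq le_rfl (.seq (hP (a, acc, e) _ ?_)
    fun s₁ ⟨out, f₁⟩ => .assign_seq (c := S + 1) ?_ (.assign (T := 2 * S + 2) ?_
      (R := FoldInvariant (f a) m a z (l₁ ++ e :: l₂) s₀ n)
      ⟨?_, fun i hi => ?_, l₁ ++ [e], l₂, ?_, ?_, ?_, ?_⟩))) ?_ fun _ => id
  · simp only [WExpr.eval, Function.update_self, h₁, h₂, h₃, code_cons, BTree.left, code_pair]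
  · rw [WExpr.cost, out]
    exact Nat.add_le_add_right hS' 1
  · simp only [WExpr.cost, WExpr.eval]
    rw [Function.update_of_ne (by omega), f₁ _ (by omega), Function.update_of_ne (by omega), h₃]
    simp only [code_cons, BTree.size, BTree.right, codeSize] at hsize ⊢
    omega
  · rw [Function.update_of_ne (by omega), Function.update_of_ne (by omega), f₁ _ (by omega),
      Function.update_of_ne (by omega), h₁]
  · rw [Function.update_of_ne (by omega), Function.update_of_ne (by omega), f₁ _ (by omega),
      Function.update_of_ne (by omega), frame i hi]
  · rw [List.append_assoc, List.singleton_append]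
  · exact Nat.succ.inj hlen
  · rw [Function.update_of_ne (by omega), Function.update_self, WExpr.eval, out,
      List.foldl_append, List.foldl_cons, List.foldl_nil]
  · simp only [Function.update_self, WExpr.eval]
    rw [Function.update_of_ne (by omega), f₁ _ (by omega), Function.update_of_ne (by omega), h₃,
      code_cons, BTree.right]
  · simp only [WExpr.cost, WExpr.eval, h₁, h₂, h₃, code_cons, BTree.left, BTree.size, codeSize]
      at ha hS hsize ⊢
    omega

theorem loop_foldBody_ensures (h₁ : s (m + 1) = code a) (h₂ : s (m + 2) = code z)
    (h₃ : s (m + 3) = code l) :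
    (WProg.loop (.var (m + 3)) (foldBody P m)).Ensures s
      (S * (S + 1 + (15 * S + V + 10)) + (S + 1)) fun s' =>
        s' (m + 2) = code (l.foldl (f a) z) ∧ ∀ i, m + 3 < i → s' i = s i := by
  have hcost : ∀ n s', FoldInvariant (f a) m a z l s n s' →
      (WExpr.var (m + 3)).cost s' + 1 ≤ S + 1 := by
    rintro n s' ⟨-, -, l₁, l₂, rfl, -, -, h₃⟩
    rw [WExpr.cost, h₃]
    exact Nat.add_le_add_right
      ((codeSize_le_of_sublist (List.sublist_append_right l₁ l₂)).trans hl) 1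
  refine (WProg.Ensures.loop (J := FoldInvariant (f a) m a z l s)
    (fun s' hJ => ⟨?_, hcost 0 s' hJ⟩) (fun n s' hJ => ⟨?_, hcost _ s' hJ,
      foldBody_ensures hkm hP ha hl hacc hV hJ⟩) l.length
    ⟨h₁, fun _ _ => rfl, [], l, rfl, rfl, h₂, h₃⟩).mono ?_ ?_
  · obtain ⟨-, -, l₁, l₂, -, hlen, -, h₃⟩ := hJ
    rw [WExpr.eval, h₃, List.length_eq_zero_iff.1 hlen, code_nil]
  · obtain ⟨-, -, l₁, _ | ⟨e, l₂⟩, -, hlen, -, h₃⟩ := hJ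
    · simp at hlen
    · rw [WExpr.eval, h₃, code_cons]
      exact BTree.noConfusion
  · exact Nat.add_le_add_right (Nat.mul_le_mul_right _ ((length_lt_codeSize l).le.trans hl)) _
  · rintro s' ⟨-, frame, l₁, l₂, rfl, hlen, h₂, -⟩
    rw [List.length_eq_zero_iff.1 hlen, List.append_nil]
    exact ⟨h₂, frame⟩

theorem foldProg_ensures (h : s 0 = code (a, z, l)) :
    (foldProg P m).Ensures s
      (3 * (6 * S + 6) + (S * (S + 1 + (15 * S + V + 10)) + (S + 1)) + (S + 1))
      fun s' => s' 0 = code (l.foldl (f a) z) ∧ ∀ i, m + 3 < i → s' i = s i := by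
  have hz : codeSize z ≤ S := hacc [] List.nil_prefix
  simp only [code_pair] at h
  refine WProg.Ensures.mono (.assign_seq (c := 6 * S + 6) ?_ (.assign_seq (c := 6 * S + 6) ?_
    (.assign_seq (c := 6 * S + 6) ?_ (.seq (loop_foldBody_ensures hkm hP ha hl hacc hV ?_ ?_ ?_)
      fun s₁ ⟨h₂, f₁⟩ => .assign (T := S + 1) ?_ ⟨?_, fun i hi => ?_⟩)))) (by omega) fun _ => id
  · simp only [WExpr.cost, WExpr.eval, h, BTree.left, BTree.size, codeSize] at ha hl hz ⊢
    omega
  · simp only [WExpr.cost, WExpr.eval, h, BTree.left, BTree.right, BTree.size, codeSize,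
      Function.update_of_ne (Nat.succ_ne_zero _).symm] at ha hl hz ⊢
    omega
  · simp only [WExpr.cost, WExpr.eval, h, BTree.left, BTree.right, BTree.size, codeSize,
      Function.update_of_ne (Nat.succ_ne_zero _).symm] at ha hl hz ⊢
    omega
  · rw [Function.update_of_ne (by omega), Function.update_of_ne (by omega), Function.update_self]
    simp only [WExpr.eval, h, BTree.left]
  · rw [Function.update_of_ne (by omega), Function.update_self]
    simp only [WExpr.eval, h, BTree.left, BTree.right,
      Function.update_of_ne (Nat.succ_ne_zero _).symm]
  · rw [Function.update_self]
    simp only [WExpr.eval, h, BTree.right, Function.update_of_ne (Nat.succ_ne_zero _).symm]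
  · rw [WExpr.cost, h₂]
    exact Nat.add_le_add_right (hacc _ (List.prefix_refl _)) 1
  · rw [Function.update_self, WExpr.eval, h₂]
  · rw [Function.update_of_ne (by omega), f₁ i hi, Function.update_of_ne (by omega),
      Function.update_of_ne (by omega), Function.update_of_ne (by omega)]

end Fold

theorem foldl {l : α → List γ} {init : α → σ} {f : α → σ → γ → σ} (hl : PolyTime l)
    (hinit : PolyTime init) (hf : PolyTime fun x : α × σ × γ => f x.1 x.2.1 x.2.2) {B : α → ℕ}
    (hBdd : PolyBounded B)
    (hB : ∀ a l', l' <+: l a → codeSize (l'.foldl (f a) (init a)) ≤ B a) :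
    PolyTime fun a => (l a).foldl (f a) (init a) := by
  have hS := PolyBounded.codeSize.add (hl.polyBounded.add hBdd)
  obtain ⟨P, k, T, hT, hP⟩ := hf
  obtain ⟨Q, k', U, hU, hQ⟩ := PolyTime.id.pair (hinit.pair hl)
  obtain ⟨V, hV, hTV⟩ := hT.exists_uniform_bound ((hS.const_mul 3).add (.const 2))
  refine ⟨.seq Q (foldProg P (max k k')), max k k' + 3, _, hU.add <|
    ((((hS.const_mul 6).add (.const 6)).const_mul 3).add
      ((hS.mul ((hS.add (.const 1)).add (((hS.const_mul 15).add hV).add (.const 10)))).add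
        (hS.add (.const 1)))).add (hS.add (.const 1)), fun a s hs => ?_⟩
  refine .seq (hQ a s hs) fun s₁ ⟨h₁, f₁⟩ => (foldProg_ensures (le_max_left _ _) hP
    (Nat.le_add_right _ _) (by omega) (fun l' hl' => (hB a l' hl').trans (by omega)) (hTV a)
    h₁).mono le_rfl fun s₂ ⟨h₂, f₂⟩ => ⟨h₂, fun i hi => ?_⟩
  rw [f₂ i hi, f₁ i (by omega)]

theorem cond {f : α → Bool} {g h : α → β} (hf : PolyTime f) (hg : PolyTime g) (hh : PolyTime h) :
    PolyTime fun a => bif f a then g a else h a := by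
  -- The code of a truth value is also the code of a list, of length one for `true`.
  have hl : PolyTime fun a => bif f a then [BTree.nil] else [] :=
    hf.recode fun a => by cases f a <;> rfl
  refine (foldl (f := fun a _ _ => g a) hl hh (hg.comp (fst .id))
    (hg.polyBounded.add hh.polyBounded) fun a l' _ => ?_).of_eq fun a => by cases f a <;> rfl
  cases l' using List.reverseRecOn with
  | nil => exact Nat.le_add_left _ _
  | append_singleton l' e => rw [List.foldl_concat]; exact Nat.le_add_right _ _

end PolyTime

theorem codeSize_foldl_le {γ σ : Type*} [TreeCode σ] {f : σ → γ → σ} {R : ℕ} {l : List γ} (z : σ)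
    (h : ∀ acc, ∀ e ∈ l, codeSize (f acc e) ≤ codeSize acc + R) :
    codeSize (l.foldl f z) ≤ codeSize z + l.length * R := by
  induction l generalizing z with
  | nil => exact Nat.le_add_right _ _
  | cons e l ih =>
    have hstep := h z e List.mem_cons_self
    have hrest := ih (f z e) fun acc e he => h acc e (List.mem_cons_of_mem _ he)
    rw [List.foldl_cons, List.length_cons, add_one_mul]
    omega

namespace PolyTime

variable {α β γ δ σ : Type*} [TreeCode α] [TreeCode β] [TreeCode γ] [TreeCode δ] [TreeCode σ]

theorem foldl_of_additive {l : α → List γ} {init : α → σ} {f : α → σ → γ → σ} (hl : PolyTime l)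
    (hinit : PolyTime init) (hf : PolyTime fun x : α × σ × γ => f x.1 x.2.1 x.2.2)
    {r : α × γ → ℕ} (hr : PolyBounded r)
    (hstep : ∀ a acc e, codeSize (f a acc e) ≤ codeSize acc + r (a, e)) :
    PolyTime fun a => (l a).foldl (f a) (init a) := by
  obtain ⟨R, hR, hrR⟩ := hr.exists_uniform_bound
    ((PolyBounded.codeSize.add hl.polyBounded).add (.const 1))
  refine foldl hl hinit hf (hinit.polyBounded.add (hl.polyBounded.mul hR)) fun a l' hl' => ?_
  refine (codeSize_foldl_le (init a) fun acc e he => (hstep a acc e).trans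
    (Nat.add_le_add_left (hrR a (a, e) ?_) _)).trans ?_
  · have := codeSize_le_of_mem (hl'.subset he)
    rw [codeSize_pair]
    omega
  · gcongr
    exact hl'.length_le.trans (length_lt_codeSize (l a)).le

theorem not {f : α → Bool} (hf : PolyTime f) : PolyTime fun a => !f a :=
  (hf.cond (.const false) (.const true)).of_eq fun a => by cases f a <;> rfl

theorem and {f g : α → Bool} (hf : PolyTime f) (hg : PolyTime g) : PolyTime fun a => f a && g a :=
  (hf.cond hg (.const false)).of_eq fun a => by cases f a <;> rfl

theorem or {f g : α → Bool} (hf : PolyTime f) (hg : PolyTime g) : PolyTime fun a => f a || g a :=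
  (hf.cond (.const true) hg).of_eq fun a => by cases f a <;> rfl

theorem cons {f : α → β} {l : α → List β} (hf : PolyTime f) (hl : PolyTime l) :
    PolyTime fun a => f a :: l a :=
  (hf.pair hl).recode fun _ => rfl

theorem tail {l : α → List β} (hl : PolyTime l) : PolyTime fun a => (l a).tail :=
  hl.right fun a => by cases l a <;> rfl

theorem reverse {l : α → List β} (hl : PolyTime l) : PolyTime fun a => (l a).reverse :=
  (foldl_of_additive (f := fun _ acc e => e :: acc) hl (.const [])
    ((snd (snd .id)).cons (fst (snd .id))) (PolyBounded.codeSize.add (.const 1)) fun a acc e => by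
      rw [codeSize_cons, codeSize_pair]; omega).of_eq fun a => by
        rw [List.foldl_flip_cons_eq_append', List.append_nil]

theorem foldr {l : α → List γ} {init : α → σ} {f : α → γ → σ → σ} (hl : PolyTime l)
    (hinit : PolyTime init) (hf : PolyTime fun x : α × σ × γ => f x.1 x.2.2 x.2.1) {B : α → ℕ}
    (hBdd : PolyBounded B)
    (hB : ∀ a l', l' <:+ l a → codeSize (l'.foldr (f a) (init a)) ≤ B a) :
    PolyTime fun a => (l a).foldr (f a) (init a) := by
  refine (foldl (f := fun a acc e => f a e acc) hl.reverse hinit hf hBdd fun a l' hl' => ?_).of_eq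
    fun a => List.foldl_reverse.symm
  rw [← List.foldr_reverse]
  exact hB a _ (by rwa [← List.reverse_prefix, List.reverse_reverse])

theorem foldr_of_additive {l : α → List γ} {init : α → σ} {f : α → γ → σ → σ} (hl : PolyTime l)
    (hinit : PolyTime init) (hf : PolyTime fun x : α × σ × γ => f x.1 x.2.2 x.2.1)
    {r : α × γ → ℕ} (hr : PolyBounded r)
    (hstep : ∀ a acc e, codeSize (f a e acc) ≤ codeSize acc + r (a, e)) :
    PolyTime fun a => (l a).foldr (f a) (init a) :=
  (foldl_of_additive (f := fun a acc e => f a e acc) hl.reverse hinit hf hr hstep).of_eq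
    fun _ => List.foldl_reverse.symm

theorem append {l m : α → List β} (hl : PolyTime l) (hm : PolyTime m) :
    PolyTime fun a => l a ++ m a :=
  (foldr_of_additive (f := fun _ e acc => e :: acc) hl hm ((snd (snd .id)).cons (fst (snd .id)))
    (PolyBounded.codeSize.add (.const 1)) fun a acc e => by
      rw [codeSize_cons, codeSize_pair]; omega).of_eq fun _ => List.foldr_cons_eq_append'.symm

theorem flatMap {l : α → List γ} {f : α → γ → List δ} (hl : PolyTime l)
    (hf : PolyTime fun x : α × γ => f x.1 x.2) : PolyTime fun a => (l a).flatMap (f a) := by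
  refine (foldr_of_additive (f := fun a e acc => f a e ++ acc) hl (.const [])
    (.append (hf.comp ((fst .id).pair (snd (snd .id)))) (fst (snd .id))) hf.polyBounded
    fun a acc e => ?_).of_eq fun a => ?_
  · rw [add_comm (codeSize acc), ← codeSize_append]
    exact Nat.le_succ _
  · induction l a with
    | nil => rfl
    | cons e l ih => rw [List.flatMap_cons, ih, List.foldr_cons]

theorem map {l : α → List γ} {f : α → γ → δ} (hl : PolyTime l)
    (hf : PolyTime fun x : α × γ => f x.1 x.2) : PolyTime fun a => (l a).map (f a) :=
  (hl.flatMap (f := fun a e => [f a e]) (hf.cons (.const []))).of_eq fun _ => List.map_eq_flatMap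

theorem filter {l : α → List γ} {p : α → γ → Bool} (hl : PolyTime l)
    (hp : PolyTime fun x : α × γ => p x.1 x.2) : PolyTime fun a => (l a).filter (p a) := by
  refine (hl.flatMap (f := fun a e => bif p a e then [e] else [])
    (hp.cond ((snd .id).cons (.const [])) (.const []))).of_eq fun a => ?_
  induction l a with
  | nil => rfl
  | cons e l ih => cases h : p a e <;> simp [h, ih]

theorem any {l : α → List γ} {p : α → γ → Bool} (hl : PolyTime l)
    (hp : PolyTime fun x : α × γ => p x.1 x.2) : PolyTime fun a => (l a).any (p a) := by
  refine (foldr_of_additive (f := fun a e acc => p a e || acc) hl (.const false)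
    (.or (hp.comp ((fst .id).pair (snd (snd .id)))) (fst (snd .id))) (.const 3)
    fun a acc e => (codeSize_bool_le _).trans (Nat.le_add_left _ _)).of_eq fun a => ?_
  induction l a with
  | nil => rfl
  | cons e l ih => rw [List.any_cons, ih, List.foldr_cons]

theorem all {l : α → List γ} {p : α → γ → Bool} (hl : PolyTime l)
    (hp : PolyTime fun x : α × γ => p x.1 x.2) : PolyTime fun a => (l a).all (p a) :=
  (hl.any hp.not).not.of_eq fun _ => List.all_eq_not_any_not

theorem decide_mem {l : α → List β} {f : α → β} [∀ a, Decidable (f a ∈ l a)] (hl : PolyTime l)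
    (hf : PolyTime f) : PolyTime fun a => decide (f a ∈ l a) :=
  have : DecidableEq β := code_injective.decidableEq
  (hl.any (p := fun a b => decide (f a = b)) ((hf.comp (fst .id)).decide_eq (snd .id))).of_eq
    fun a => by rw [Bool.eq_iff_iff, decide_eq_true_iff, List.any_eq_true]; simp

end PolyTime

/-! ### Arithmetic on binary numbers in polynomial time -/

theorem foldr_bit_bits (n : ℕ) : n.bits.foldr Nat.bit 0 = n := by
  induction n using Nat.binaryRec' with
  | zero => rw [Nat.zero_bits, List.foldr_nil]
  | bit b n hn ih => rw [Nat.bits_append_bit n b hn, List.foldr_cons, ih]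

theorem bits_injective : Function.Injective Nat.bits :=
  Function.LeftInverse.injective foldr_bit_bits

instance : TreeCode ℕ := ⟨encNat, (code_injective (α := List Bool)).comp bits_injective⟩

theorem code_nat (n : ℕ) : code n = code n.bits := rfl

theorem code_bodd (n : ℕ) : code n.bodd = (code n).left := by
  rw [code_nat, Nat.bodd_eq_bits_head]
  cases n.bits <;> rfl

theorem code_div2 (n : ℕ) : code n.div2 = (code n).right := by
  rw [code_nat, code_nat, Nat.div2_bits_eq_tail]
  cases n.bits <;> rfl

theorem codeSize_div2_le (n : ℕ) : codeSize n.div2 ≤ codeSize n := by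
  simp only [codeSize, code_nat, Nat.div2_bits_eq_tail]
  exact codeSize_le_of_sublist (List.tail_sublist _)

theorem codeSize_bit_le (b : Bool) (n : ℕ) : codeSize (Nat.bit b n) ≤ codeSize n + 4 := by
  by_cases h : n = 0 → b = true
  · have hcode : codeSize (Nat.bit b n) = codeSize b + codeSize n + 1 := by
      rw [codeSize, code_nat, Nat.bits_append_bit n b h]
      rfl
    have := codeSize_bool_le b
    omega
  · obtain ⟨rfl, hb⟩ := Classical.not_imp.1 h
    rw [Bool.eq_false_of_not_eq_true hb]
    decide

theorem size_le_codeSize (n : ℕ) : n.size ≤ codeSize n := by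
  rw [← Nat.size_eq_bits_len]
  exact (length_lt_codeSize n.bits).le

theorem codeSize_list_bool_le (l : List Bool) : codeSize l ≤ 4 * l.length + 1 := by
  induction l with
  | nil => rfl
  | cons b l ih =>
    have := codeSize_bool_le b
    rw [codeSize_cons, List.length_cons]
    omega

theorem codeSize_nat_le (n : ℕ) : codeSize n ≤ 4 * n.size + 1 := by
  rw [← Nat.size_eq_bits_len]
  exact codeSize_list_bool_le n.bits

theorem div2_lt_two_pow {n k : ℕ} (h : n < 2 ^ (k + 1)) : n.div2 < 2 ^ k := by
  rwa [Nat.div2_val, Nat.div_lt_iff_lt_mul two_pos, ← pow_succ]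

theorem lt_two_pow_length_bits_append_left (m n : ℕ) : m < 2 ^ (m.bits ++ n.bits).length := by
  rw [List.length_append, Nat.size_eq_bits_len, Nat.size_eq_bits_len]
  exact (Nat.lt_size_self m).trans_le (Nat.pow_le_pow_right two_pos (Nat.le_add_right _ _))

theorem lt_two_pow_length_bits_append_right (m n : ℕ) : n < 2 ^ (m.bits ++ n.bits).length := by
  rw [List.length_append, Nat.size_eq_bits_len, Nat.size_eq_bits_len]
  exact (Nat.lt_size_self n).trans_le (Nat.pow_le_pow_right two_pos (Nat.le_add_left _ _))

/-- One step of the comparison of binary numbers, from the least significant digit on: the triple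
`(m, n, r)` stands for the truth value of `m < n ∨ m = n ∧ r`. -/
def natLeStep (s : ℕ × ℕ × Bool) : ℕ × ℕ × Bool :=
  (s.1.div2, s.2.1.div2, bif decide (s.1.bodd = s.2.1.bodd) then s.2.2 else s.2.1.bodd)

theorem natLeStep_spec (s : ℕ × ℕ × Bool) :
    ((natLeStep s).1 < (natLeStep s).2.1 ∨
      (natLeStep s).1 = (natLeStep s).2.1 ∧ (natLeStep s).2.2 = true) ↔
    (s.1 < s.2.1 ∨ s.1 = s.2.1 ∧ s.2.2 = true) := by
  obtain ⟨m, n, r⟩ := s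
  have hm := Nat.bodd_add_div2 m
  have hn := Nat.bodd_add_div2 n
  simp only [natLeStep]
  cases h₁ : m.bodd <;> cases h₂ : n.bodd <;> cases r <;>
    simp only [h₁, h₂, Bool.toNat_false, Bool.toNat_true, decide_true, cond_true, cond_false,
      reduceCtorEq, decide_false, and_true, and_false, or_false] at hm hn ⊢ <;> omega

theorem natLeStep_iterate {k : ℕ} (s : ℕ × ℕ × Bool) (h₁ : s.1 < 2 ^ k) (h₂ : s.2.1 < 2 ^ k) :
    (natLeStep^[k] s).2.2 = true ↔ (s.1 < s.2.1 ∨ s.1 = s.2.1 ∧ s.2.2 = true) := by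
  induction k generalizing s with
  | zero => simp_all
  | succ k ih =>
    rw [Function.iterate_succ_apply, ih _ (div2_lt_two_pow h₁) (div2_lt_two_pow h₂),
      natLeStep_spec]

/-- One step of the addition of binary numbers: the state consists of the carry, the remaining
digits of both summands, and the digits of the sum that are already known, in reverse order. -/
def natAddStep (s : Bool × ℕ × ℕ × List Bool) : Bool × ℕ × ℕ × List Bool :=
  (bif s.1 then s.2.1.bodd || s.2.2.1.bodd else s.2.1.bodd && s.2.2.1.bodd,
    s.2.1.div2, s.2.2.1.div2, decide (s.1 = decide (s.2.1.bodd = s.2.2.1.bodd)) :: s.2.2.2)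

theorem natAddStep_spec (s : Bool × ℕ × ℕ × List Bool) :
    (natAddStep s).2.2.2.foldl (fun n b => Nat.bit b n)
      ((natAddStep s).1.toNat + (natAddStep s).2.1 + (natAddStep s).2.2.1) =
    s.2.2.2.foldl (fun n b => Nat.bit b n) (s.1.toNat + s.2.1 + s.2.2.1) := by
  obtain ⟨c, m, n, o⟩ := s
  have hm := Nat.bodd_add_div2 m
  have hn := Nat.bodd_add_div2 n
  simp only [natAddStep, List.foldl_cons]
  congr 1
  rw [Nat.bit_val]
  cases h₁ : m.bodd <;> cases h₂ : n.bodd <;> cases c <;>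
    simp only [h₁, h₂, Bool.toNat_false, Bool.toNat_true, decide_true, cond_true, cond_false,
      reduceCtorEq, decide_false, Bool.or_self, Bool.or_true, Bool.or_false, Bool.and_self,
      Bool.and_true, Bool.and_false] at hm hn ⊢ <;> omega

theorem natAddStep_iterate {k : ℕ} (s : Bool × ℕ × ℕ × List Bool)
    (h₁ : s.2.1 < 2 ^ k) (h₂ : s.2.2.1 < 2 ^ k) :
    (natAddStep^[k] s).2.2.2.foldl (fun n b => Nat.bit b n) (natAddStep^[k] s).1.toNat =
    s.2.2.2.foldl (fun n b => Nat.bit b n) (s.1.toNat + s.2.1 + s.2.2.1) := by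
  induction k generalizing s with
  | zero =>
    rw [pow_zero, Nat.lt_one_iff] at h₁ h₂
    rw [Function.iterate_zero, id_eq, h₁, h₂, add_zero, add_zero]
  | succ k ih =>
    rw [Function.iterate_succ_apply, ih _ (div2_lt_two_pow h₁) (div2_lt_two_pow h₂),
      natAddStep_spec]

theorem foldr_double_add_lt (y : ℕ) (l : List Bool) :
    l.foldr (fun b acc => 2 * acc + bif b then y else 0) 0 < 2 ^ (l.length + y.size) := by
  have key : l.foldr (fun b acc => 2 * acc + bif b then y else 0) 0 + y ≤ 2 ^ l.length * y := by
    induction l with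
    | nil => simp
    | cons b l ih =>
      rw [List.foldr_cons, List.length_cons, pow_succ, mul_right_comm]
      cases b <;> simp only [cond_true, cond_false] <;> omega
  calc
    _ ≤ 2 ^ l.length * y := (Nat.le_add_right _ _).trans key
    _ < 2 ^ l.length * 2 ^ y.size := by gcongr; exact Nat.lt_size_self y
    _ = _ := (pow_add _ _ _).symm

theorem foldr_double_add_bits (x y : ℕ) :
    x.bits.foldr (fun b acc => 2 * acc + bif b then y else 0) 0 = x * y := by
  induction x using Nat.binaryRec' with
  | zero => rw [Nat.zero_bits, List.foldr_nil, zero_mul]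
  | bit b n hn ih =>
    rw [Nat.bits_append_bit n b hn, List.foldr_cons, ih, Nat.bit_val]
    cases b <;> simp only [cond_true, cond_false, Bool.toNat_true, Bool.toNat_false] <;> ring

namespace PolyTime

variable {α σ : Type*} [TreeCode α] [TreeCode σ]

theorem bits {f : α → ℕ} (hf : PolyTime f) : PolyTime fun a => (f a).bits :=
  hf.recode fun _ => rfl

theorem bodd {f : α → ℕ} (hf : PolyTime f) : PolyTime fun a => (f a).bodd :=
  hf.left fun a => code_bodd (f a)

theorem div2 {f : α → ℕ} (hf : PolyTime f) : PolyTime fun a => (f a).div2 :=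
  hf.right fun a => code_div2 (f a)

theorem bit {b : α → Bool} {f : α → ℕ} (hb : PolyTime b) (hf : PolyTime f) :
    PolyTime fun a => Nat.bit (b a) (f a) := by
  refine (((hf.decide_eq (.const 0)).and hb.not).cond (.const []) (hb.cons hf.bits)).recode
    fun a => ?_
  by_cases h : f a = 0 → b a = true
  · have : (decide (f a = 0) && !b a) = false := by
      by_cases h0 : f a = 0 <;> simp [h0, h]
    rw [this, cond_false, code_nat, Nat.bits_append_bit _ _ h]
  · obtain ⟨hf0, hb0⟩ := Classical.not_imp.1 h
    rw [hf0, Bool.eq_false_of_not_eq_true hb0]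
    rfl

theorem iterate {γ : Type*} [TreeCode γ] {l : α → List γ} {init : α → σ} {f : σ → σ}
    (hl : PolyTime l) (hinit : PolyTime init) (hf : PolyTime f) {c : ℕ}
    (hstep : ∀ s, codeSize (f s) ≤ codeSize s + c) :
    PolyTime fun a => f^[(l a).length] (init a) :=
  (foldl_of_additive (f := fun _ s _ => f s) hl hinit (hf.comp (fst (snd .id))) (.const c)
    fun _ s _ => hstep s).of_eq fun _ => (List.foldl_const _ _ _).symm

theorem natLe {f g : α → ℕ} (hf : PolyTime f) (hg : PolyTime g) :
    PolyTime fun a => decide (f a ≤ g a) := by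
  have hstep : PolyTime natLeStep :=
    .pair (.div2 (.fst .id)) (.pair (.div2 (.fst (.snd .id))) (.cond
      (.decide_eq (.bodd (.fst .id)) (.bodd (.fst (.snd .id)))) (.snd (.snd .id))
      (.bodd (.fst (.snd .id)))))
  refine (iterate (hf.bits.append hg.bits) (hf.pair (hg.pair (.const true))) hstep (c := 3)
    fun s => ?_).snd.snd.of_eq fun a => ?_
  · have h₁ := codeSize_div2_le s.1
    have h₂ := codeSize_div2_le s.2.1
    have h₃ := codeSize_bool_le (natLeStep s).2.2
    obtain ⟨m, n, r⟩ := s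
    simp only [natLeStep, codeSize_pair] at *
    omega
  · rw [Bool.eq_iff_iff, decide_eq_true_iff, natLeStep_iterate (f a, g a, true)
      (lt_two_pow_length_bits_append_left _ _) (lt_two_pow_length_bits_append_right _ _)]
    simp only [and_true, le_iff_lt_or_eq]

protected theorem natAddStep : PolyTime natAddStep := by
  have hx : PolyTime fun s : Bool × ℕ × ℕ × List Bool => s.2.1.bodd := .bodd (.fst (.snd .id))
  have hy : PolyTime fun s : Bool × ℕ × ℕ × List Bool => s.2.2.1.bodd :=
    .bodd (.fst (.snd (.snd .id)))
  exact .pair (.cond (.fst .id) (.or hx hy) (.and hx hy)) (.pair (.div2 (.fst (.snd .id)))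
    (.pair (.div2 (.fst (.snd (.snd .id)))) (.cons (.decide_eq (.fst .id) (.decide_eq hx hy))
      (.snd (.snd (.snd .id))))))

theorem natAdd {f g : α → ℕ} (hf : PolyTime f) (hg : PolyTime g) :
    PolyTime fun a => f a + g a := by
  have key := iterate (hf.bits.append hg.bits)
    (.pair (.const false) (hf.pair (hg.pair (.const [])))) .natAddStep (c := 10) fun s => by
      have h₁ := codeSize_div2_le s.2.1
      have h₂ := codeSize_div2_le s.2.2.1
      have h₃ := codeSize_bool_le (natAddStep s).1
      have h₄ := codeSize_bool_le (decide (s.1 = decide (s.2.1.bodd = s.2.2.1.bodd)))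
      obtain ⟨c, m, n, o⟩ := s
      simp only [natAddStep, codeSize_pair, codeSize_cons] at *
      omega
  refine (foldl_of_additive (f := fun _ n b => Nat.bit b n) key.snd.snd.snd
    (key.fst.cond (.const 1) (.const 0)) (.bit (snd (snd .id)) (fst (snd .id))) (.const 4)
    fun _ n b => codeSize_bit_le b n).of_eq fun a => ?_
  rw [← Bool.toNat, natAddStep_iterate (false, f a, g a, [])
    (lt_two_pow_length_bits_append_left _ _) (lt_two_pow_length_bits_append_right _ _)]
  simp only [Bool.toNat_false, zero_add, List.foldl_nil]

theorem natMul {f g : α → ℕ} (hf : PolyTime f) (hg : PolyTime g) :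
    PolyTime fun a => f a * g a := by
  have hdouble : PolyTime fun x : α × ℕ × Bool => 2 * x.2.1 :=
    (bit (.const false) (fst (snd .id))).of_eq fun x => by
      rw [Nat.bit_val, Bool.toNat_false, add_zero]
  refine (foldr (f := fun a b acc => 2 * acc + bif b then g a else 0) hf.bits (.const 0)
    (natAdd hdouble (.cond (snd (snd .id)) (hg.comp (fst .id)) (.const 0)))
    (((hf.polyBounded.add hg.polyBounded).const_mul 4).add (.const 1)) fun a l' hl' => ?_).of_eq
    fun a => (foldr_double_add_bits _ _).symm
  have hsize := Nat.size_le.2 (foldr_double_add_lt (g a) l')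
  have hlen := hl'.length_le
  rw [Nat.size_eq_bits_len] at hlen
  refine (codeSize_nat_le _).trans ?_
  have := size_le_codeSize (f a)
  have := size_le_codeSize (g a)
  omega

end PolyTime

/-! ### Queries as inputs -/

instance : TreeCode ℚ := ⟨encRat, fun q r h => by
  simp only [encRat, BTree.cons.injEq] at h
  have hsign := code_injective (α := Bool) h.1
  have hnum := code_injective (α := ℕ) h.2.1
  rw [decide_eq_decide, ← Rat.num_neg, ← Rat.num_neg] at hsign
  exact Rat.ext (by omega) (code_injective (α := ℕ) h.2.2)⟩

instance : TreeCode QTerm := ⟨encTerm, fun s t h => by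
  cases s <;> cases t <;> simp only [encTerm, BTree.cons.injEq] at h
  · rw [code_injective (α := ℕ) h.2]
  · cases h.1
  · cases h.1
  · rw [code_injective (α := ℚ) h.2]⟩

instance : TreeCode QAtom := ⟨encAtom, fun a b h => by
  cases a
  cases b
  simp only [encAtom, BTree.cons.injEq] at h
  rw [code_injective (α := ℕ) h.1, code_injective (α := List QTerm) h.2]⟩

instance : TreeCode CompOp := ⟨encOp, fun o o' h => by
  cases o <;> cases o' <;> first | rfl | exact absurd h (by decide)⟩

instance : TreeCode Comparison := ⟨encComparison, fun a b h => by
  cases a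
  cases b
  simp only [encComparison, BTree.cons.injEq] at h
  rw [code_injective (α := QTerm) h.1, code_injective (α := CompOp) h.2.1,
    code_injective (α := QTerm) h.2.2]⟩

instance : TreeCode CQAC := ⟨encQuery, fun a b h => by
  cases a
  cases b
  simp only [encQuery, BTree.cons.injEq] at h
  rw [code_injective (α := List QTerm) h.1, code_injective (α := List QAtom) h.2.1,
    code_injective (α := List Comparison) h.2.2]⟩

theorem decide_rat_le (q r : ℚ) : decide (q ≤ r) =
    bif decide (q < 0) then
      bif decide (r < 0) then decide (r.num.natAbs * q.den ≤ q.num.natAbs * r.den) else true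
    else
      bif decide (r < 0) then false else decide (q.num.natAbs * r.den ≤ r.num.natAbs * q.den) := by
  by_cases hq : q < 0 <;> by_cases hr : r < 0 <;>
    simp only [hq, hr, decide_true, decide_false, cond_true, cond_false, decide_eq_decide,
      decide_eq_true_iff, decide_eq_false_iff_not]
  · rw [← Rat.num_neg] at hq hr
    rw [Rat.le_iff]
    zify
    rw [abs_of_neg hq, abs_of_neg hr, neg_mul, neg_mul, neg_le_neg_iff]
  · exact hq.le.trans (not_lt.1 hr)
  · exact not_le.2 (hr.trans_le (not_lt.1 hq))
  · rw [not_lt, ← Rat.num_nonneg] at hq hr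
    rw [Rat.le_iff]
    zify
    rw [abs_of_nonneg hq, abs_of_nonneg hr]

/-- Whether a term is a constant. -/
def QTerm.isConst : QTerm → Bool
  | .var _ => false
  | .const _ => true

/-- The value of a constant, and `0` for a variable. -/
def QTerm.constVal : QTerm → ℚ
  | .var _ => 0
  | .const c => c

/-- The test whether both terms are constants, the first one at most the second. -/
def QTerm.constLE (s t : QTerm) : Bool :=
  s.isConst && t.isConst && decide (s.constVal ≤ t.constVal)

/-- The complementary comparison symbol. -/
def CompOp.neg : CompOp → CompOp
  | .lt => .ge
  | .le => .gt
  | .gt => .le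
  | .ge => .lt
  | .eq => .ne
  | .ne => .eq

/-- The negation of a comparison. -/
def Comparison.neg (a : Comparison) : Comparison := ⟨a.lhs, a.op.neg, a.rhs⟩

namespace PolyTime

variable {α β : Type*} [TreeCode α] [TreeCode β]

theorem ratLe {f g : α → ℚ} (hf : PolyTime f) (hg : PolyTime g) :
    PolyTime fun a => decide (f a ≤ g a) := by
  have hneg : PolyTime fun q : ℚ => decide (q < 0) := left .id fun _ => rfl
  have habs : PolyTime fun q : ℚ => (q.num.natAbs, q.den) := right .id fun _ => rfl
  have hx : PolyTime fun x : ℚ × ℚ => x.1.num.natAbs * x.2.den :=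
    natMul (fst (habs.comp (fst .id))) (snd (habs.comp (snd .id)))
  have hy : PolyTime fun x : ℚ × ℚ => x.2.num.natAbs * x.1.den :=
    natMul (fst (habs.comp (snd .id))) (snd (habs.comp (fst .id)))
  have key : PolyTime fun x : ℚ × ℚ => decide (x.1 ≤ x.2) :=
    ((hneg.comp (fst .id)).cond ((hneg.comp (snd .id)).cond (natLe hy hx) (.const true))
      ((hneg.comp (snd .id)).cond (.const false) (natLe hx hy))).of_eq
      fun x => decide_rat_le x.1 x.2
  exact key.comp (hf.pair hg)

theorem isConst {f : α → QTerm} (hf : PolyTime f) : PolyTime fun a => (f a).isConst :=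
  hf.left fun a => by cases f a <;> rfl

theorem constVal {f : α → QTerm} (hf : PolyTime f) : PolyTime fun a => (f a).constVal := by
  refine (hf.isConst.cond (hf.right (f := fun a => (code (f a)).right) fun _ => rfl)
    (.const (code (0 : ℚ)))).recode fun a => ?_
  cases f a <;> rfl

theorem constLE {f g : α → QTerm} (hf : PolyTime f) (hg : PolyTime g) :
    PolyTime fun a => (f a).constLE (g a) :=
  (hf.isConst.and hg.isConst).and (hf.constVal.ratLe hg.constVal)

theorem lhs {f : α → Comparison} (hf : PolyTime f) : PolyTime fun a => (f a).lhs :=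
  hf.left fun _ => rfl

theorem op {f : α → Comparison} (hf : PolyTime f) : PolyTime fun a => (f a).op :=
  (hf.right (f := fun a => ((f a).op, (f a).rhs)) fun _ => rfl).fst

theorem rhs {f : α → Comparison} (hf : PolyTime f) : PolyTime fun a => (f a).rhs :=
  (hf.right (f := fun a => ((f a).op, (f a).rhs)) fun _ => rfl).snd

theorem comparison {s t : α → QTerm} {o : α → CompOp} (hs : PolyTime s) (ho : PolyTime o)
    (ht : PolyTime t) : PolyTime fun a => (⟨s a, o a, t a⟩ : Comparison) :=
  (hs.pair (ho.pair ht)).recode fun _ => rfl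

theorem rel {f : α → QAtom} (hf : PolyTime f) : PolyTime fun a => (f a).rel :=
  hf.left fun _ => rfl

theorem args {f : α → QAtom} (hf : PolyTime f) : PolyTime fun a => (f a).args :=
  hf.right fun _ => rfl

theorem head {f : α → CQAC} (hf : PolyTime f) : PolyTime fun a => (f a).head :=
  hf.left fun _ => rfl

theorem body {f : α → CQAC} (hf : PolyTime f) : PolyTime fun a => (f a).body :=
  (hf.right (f := fun a => ((f a).body, (f a).acs)) fun _ => rfl).fst

theorem acs {f : α → CQAC} (hf : PolyTime f) : PolyTime fun a => (f a).acs :=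
  (hf.right (f := fun a => ((f a).body, (f a).acs)) fun _ => rfl).snd

theorem compOp_cases {o : α → CompOp} {g : CompOp → α → β} (ho : PolyTime o)
    (hg : ∀ c, PolyTime (g c)) : PolyTime fun a => g (o a) a :=
  ((ho.decide_eq (.const .lt)).cond (hg .lt) ((ho.decide_eq (.const .le)).cond (hg .le)
    ((ho.decide_eq (.const .gt)).cond (hg .gt) ((ho.decide_eq (.const .ge)).cond (hg .ge)
    ((ho.decide_eq (.const .eq)).cond (hg .eq) (hg .ne)))))).of_eq fun a => by cases o a <;> rfl

theorem neg {f : α → Comparison} (hf : PolyTime f) : PolyTime fun a => (f a).neg :=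
  comparison hf.lhs (compOp_cases (g := fun o _ => o.neg) hf.op fun _ => .const _) hf.rhs

protected theorem product {l : α → List β} (hl : PolyTime l) : PolyTime fun a => l a ×ˢ l a :=
  hl.flatMap (f := fun a b => (l a).map fun c => (b, c)) <|
    (hl.comp (fst .id)).map (f := fun (x : α × β) c => (x.2, c))
      (.pair (.snd (.fst .id)) (.snd .id))

end PolyTime

/-! ### Deciding satisfiability of comparisons -/

/-- The inequalities `s ≤ t` that a comparison states. -/
def Comparison.edges (a : Comparison) : List (QTerm × QTerm) :=
  match a.op with
  | .lt => [(a.lhs, a.rhs)]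
  | .le => [(a.lhs, a.rhs)]
  | .gt => [(a.rhs, a.lhs)]
  | .ge => [(a.rhs, a.lhs)]
  | .eq => [(a.lhs, a.rhs), (a.rhs, a.lhs)]
  | .ne => []

/-- The disequalities `s ≠ t` that a comparison states. -/
def Comparison.disequalities (a : Comparison) : List (QTerm × QTerm) :=
  match a.op with
  | .lt => [(a.lhs, a.rhs)]
  | .le => []
  | .gt => [(a.lhs, a.rhs)]
  | .ge => []
  | .eq => []
  | .ne => [(a.lhs, a.rhs)]

/-- The terms that occur in a list of comparisons. -/
def acTerms (β : List Comparison) : List QTerm := β.flatMap fun a => [a.lhs, a.rhs]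

/-- Extension of a reachability relation `R` on the pairs in `P` by an edge `e`. -/
def addEdge (P R : List (QTerm × QTerm)) (e : QTerm × QTerm) : List (QTerm × QTerm) :=
  P.filter fun p => decide (p ∈ R) || decide ((p.1, e.1) ∈ R) && decide ((e.2, p.2) ∈ R)

/-- The pairs of terms of `β` for which `s ≤ t` follows from the inequalities stated by `β` and
those between the constants of `β`: the reflexive transitive closure of these, computed by adding
the inequalities of `β` one at a time. -/
def lePairs (β : List Comparison) : List (QTerm × QTerm) :=
  (β.flatMap Comparison.edges).foldl (addEdge (acTerms β ×ˢ acTerms β))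
    ((acTerms β ×ˢ acTerms β).filter fun p => decide (p.1 = p.2) || p.1.constLE p.2)

/-- The pairs of terms of `β` that have to be different. -/
def nePairs (β : List Comparison) : List (QTerm × QTerm) :=
  β.flatMap Comparison.disequalities ++
    (acTerms β ×ˢ acTerms β).filter fun p =>
      (p.1.isConst && p.2.isConst) && !decide (p.1 = p.2)

/-- The decision procedure for the satisfiability of a conjunction of comparisons: no two terms that
are forced to be equal have to be different. -/
def satTest (β : List Comparison) : Bool :=
  (nePairs β).all fun p => !(decide (p ∈ lePairs β) && decide ((p.2, p.1) ∈ lePairs β))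

/-- The decision procedure for the implication of a comparison. -/
def impTest (β : List Comparison) (a : Comparison) : Bool := !satTest (a.neg :: β)

namespace PolyTime

variable {α : Type*} [TreeCode α]

protected theorem edges : PolyTime Comparison.edges := by
  have hl : PolyTime fun a : Comparison => (a.lhs, a.rhs) := .pair (.lhs .id) (.rhs .id)
  have hr : PolyTime fun a : Comparison => (a.rhs, a.lhs) := .pair (.rhs .id) (.lhs .id)
  refine compOp_cases (o := Comparison.op) (g := fun o a => Comparison.edges ⟨a.lhs, o, a.rhs⟩)
    (.op .id) fun o => ?_
  cases o
  · exact hl.cons (.const [])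
  · exact hl.cons (.const [])
  · exact hr.cons (.const [])
  · exact hr.cons (.const [])
  · exact hl.cons (hr.cons (.const []))
  · exact .const []

protected theorem disequalities : PolyTime Comparison.disequalities := by
  have hl : PolyTime fun a : Comparison => (a.lhs, a.rhs) := .pair (.lhs .id) (.rhs .id)
  refine compOp_cases (o := Comparison.op)
    (g := fun o a => Comparison.disequalities ⟨a.lhs, o, a.rhs⟩) (.op .id) fun o => ?_
  cases o
  · exact hl.cons (.const [])
  · exact .const []
  · exact hl.cons (.const [])
  · exact .const []
  · exact .const []
  · exact hl.cons (.const [])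

protected theorem acTerms {f : α → List Comparison} (hf : PolyTime f) :
    PolyTime fun a => acTerms (f a) :=
  hf.flatMap (f := fun _ (c : Comparison) => [c.lhs, c.rhs])
    (.cons (lhs (.snd .id)) (.cons (rhs (.snd .id)) (.const [])))

protected theorem addEdge {P R : α → List (QTerm × QTerm)} {e : α → QTerm × QTerm}
    (hP : PolyTime P) (hR : PolyTime R) (he : PolyTime e) :
    PolyTime fun a => addEdge (P a) (R a) (e a) := by
  have hR' : PolyTime fun x : α × QTerm × QTerm => R x.1 := hR.comp (fst .id)
  have he' : PolyTime fun x : α × QTerm × QTerm => e x.1 := he.comp (fst .id)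
  exact hP.filter (.or (.decide_mem hR' (snd .id))
    (.and (.decide_mem hR' (.pair (.fst (.snd .id)) (.fst he')))
      (.decide_mem hR' (.pair (.snd he') (.snd (.snd .id))))))

protected theorem lePairs {f : α → List Comparison} (hf : PolyTime f) :
    PolyTime fun a => lePairs (f a) := by
  have hP := hf.acTerms.product
  refine foldl_of_additive (f := fun a => addEdge (acTerms (f a) ×ˢ acTerms (f a)))
    (hf.flatMap (f := fun _ => Comparison.edges) (.comp .edges (snd .id)))
    (hP.filter (p := fun _ p => decide (p.1 = p.2) || p.1.constLE p.2)
      (.or (.decide_eq (.fst (.snd .id)) (.snd (.snd .id)))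
        (.constLE (.fst (.snd .id)) (.snd (.snd .id)))))
    (.addEdge (hP.comp (fst .id)) (fst (snd .id)) (snd (snd .id)))
    (hP.comp (fst .id)).polyBounded fun a R e => ?_
  exact (codeSize_le_of_sublist List.filter_sublist).trans (Nat.le_add_left _ _)

protected theorem nePairs {f : α → List Comparison} (hf : PolyTime f) :
    PolyTime fun a => nePairs (f a) :=
  .append (hf.flatMap (f := fun _ => Comparison.disequalities) (.comp .disequalities (snd .id)))
    (hf.acTerms.product.filter (p := fun _ p => (p.1.isConst && p.2.isConst) && !decide (p.1 = p.2))
      (.and (.and (.isConst (.fst (.snd .id))) (.isConst (.snd (.snd .id))))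
        (.not (.decide_eq (.fst (.snd .id)) (.snd (.snd .id))))))

protected theorem satTest {f : α → List Comparison} (hf : PolyTime f) :
    PolyTime fun a => satTest (f a) := by
  have h : PolyTime fun x : α × QTerm × QTerm => lePairs (f x.1) := hf.lePairs.comp (fst .id)
  exact hf.nePairs.all (.not (.and (.decide_mem h (snd .id))
    (.decide_mem h (.pair (.snd (.snd .id)) (.fst (.snd .id))))))

protected theorem impTest {f : α → List Comparison} {c : α → Comparison} (hf : PolyTime f)
    (hc : PolyTime c) : PolyTime fun a => impTest (f a) (c a) :=
  .not (.satTest (.cons (.neg hc) hf))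

end PolyTime

/-! ### Assignments with a prescribed order of the values -/

/-- On the terms in `S`, the assignment `w` orders values as `p` does. -/
def Realizes {D α : Type*} [LinearOrder D] [LinearOrder α] (ι : ℚ ↪o D) (S : List QTerm)
    (w : ℕ → D) (p : QTerm → α) : Prop :=
  ∀ s ∈ S, ∀ t ∈ S, s.val ι w ≤ t.val ι w ↔ p s ≤ p t

namespace Realizes

variable {D α : Type*} [LinearOrder D] [LinearOrder α] {ι : ℚ ↪o D} {S T : List QTerm}
  {w : ℕ → D} {p : QTerm → α}

theorem mono (H : Realizes ι T w p) (hST : S ⊆ T) : Realizes ι S w p :=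
  fun s hs t ht => H s (hST hs) t (hST ht)

theorem lt_iff (H : Realizes ι S w p) {s t : QTerm} (hs : s ∈ S) (ht : t ∈ S) :
    s.val ι w < t.val ι w ↔ p s < p t := by
  rw [← not_le, H t ht s hs, not_le]

theorem eq_iff (H : Realizes ι S w p) {s t : QTerm} (hs : s ∈ S) (ht : t ∈ S) :
    s.val ι w = t.val ι w ↔ p s = p t := by
  rw [le_antisymm_iff, H s hs t ht, H t ht s hs, ← le_antisymm_iff]

theorem rel_iff (H : Realizes ι S w p) {s t : QTerm} (hs : s ∈ S) (ht : t ∈ S) (o : CompOp) :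
    o.Rel (s.val ι w) (t.val ι w) ↔ o.Rel (p s) (p t) := by
  cases o
  exacts [H.lt_iff hs ht, H s hs t ht, H.lt_iff ht hs, H t ht s hs, H.eq_iff hs ht,
    (H.eq_iff hs ht).not]

theorem cmp_eq_cmp (H : Realizes ι S w p) {s t : QTerm} (hs : s ∈ S) (ht : t ∈ S) :
    cmp (p s) (p t) = cmp (s.val ι w) (t.val ι w) := by
  rcases lt_trichotomy (p s) (p t) with h | h | h
  · rw [h.cmp_eq_lt, ((H.lt_iff hs ht).2 h).cmp_eq_lt]
  · rw [cmp_eq_eq_iff _ _ |>.2 h, cmp_eq_eq_iff _ _ |>.2 ((H.eq_iff hs ht).2 h)]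
  · rw [h.cmp_eq_gt, ((H.lt_iff ht hs).2 h).cmp_eq_gt]

theorem exists_update [DenselyOrdered D] [NoMinOrder D] [NoMaxOrder D] (H : Realizes ι T w p)
    {x : ℕ} (hx : QTerm.var x ∉ T) :
    ∃ b, Realizes ι (.var x :: T) (Function.update w x b) p := by
  classical
  have : Nonempty D := ⟨ι 0⟩
  obtain ⟨b, hb⟩ := Order.PartialIso.exists_across (α := α) (β := D)
    ⟨(T.map fun t => (p t, t.val ι w)).toFinset, by
      simp only [List.mem_toFinset, List.mem_map]
      rintro _ ⟨s, hs, rfl⟩ _ ⟨t, ht, rfl⟩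
      exact H.cmp_eq_cmp hs ht⟩ (p (.var x))
  have hb : ∀ t ∈ T, cmp (p t) (p (.var x)) = cmp (t.val ι w) b := fun t ht =>
    hb (p t, t.val ι w) (List.mem_toFinset.2 (List.mem_map_of_mem ht))
  have hval : ∀ t ∈ T, t.val ι (Function.update w x b) = t.val ι w := by
    rintro (y | c) ht
    · exact Function.update_of_ne (fun h : y = x => hx (h ▸ ht)) _ _
    · rfl
  have hvx : (QTerm.var x).val ι (Function.update w x b) = b := Function.update_self ..
  refine ⟨b, fun s hs t ht => ?_⟩
  rcases List.mem_cons.1 hs with rfl | hs <;> rcases List.mem_cons.1 ht with rfl | ht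
  · simp only [le_refl]
  · rw [hvx, hval t ht]
    exact le_iff_le_of_cmp_eq_cmp (cmp_eq_cmp_symm.1 (hb t ht).symm)
  · rw [hvx, hval s hs]
    exact le_iff_le_of_cmp_eq_cmp (hb s hs).symm
  · rw [hval s hs, hval t ht, H s hs t ht]

end Realizes

theorem exists_realizes {D α : Type*} [LinearOrder D] [DenselyOrdered D] [NoMinOrder D]
    [NoMaxOrder D] [LinearOrder α] (ι : ℚ ↪o D) {p : QTerm → α} {S : List QTerm}
    (hc : ∀ c d, QTerm.const c ∈ S → QTerm.const d ∈ S → (c ≤ d ↔ p (.const c) ≤ p (.const d))) :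
    ∃ w, Realizes ι S w p := by
  suffices key : ∀ T ⊆ S, ∃ w, Realizes ι (T ++ S.filter QTerm.isConst) w p by
    obtain ⟨w, hw⟩ := key S (List.Subset.refl S)
    exact ⟨w, hw.mono (List.subset_append_left _ _)⟩
  intro T
  induction T with
  | nil =>
    refine fun _ => ⟨fun _ => ι 0, fun s hs t ht => ?_⟩
    rw [List.nil_append, List.mem_filter] at hs ht
    rcases s with x | c
    · cases hs.2
    rcases t with y | d
    · cases ht.2
    exact ι.le_iff_le.trans (hc c d hs.1 ht.1)
  | cons t T ih =>
    intro hT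
    obtain ⟨htS, hT⟩ := List.cons_subset.1 hT
    obtain ⟨w, hw⟩ := ih hT
    by_cases ht : t ∈ T ++ S.filter QTerm.isConst
    · exact ⟨w, hw.mono (List.cons_subset.2 ⟨ht, List.Subset.refl _⟩)⟩
    · rcases t with x | c
      · obtain ⟨b, hb⟩ := hw.exists_update ht
        exact ⟨_, hb⟩
      · exact absurd (List.mem_append_right T (List.mem_filter.2 ⟨htS, rfl⟩)) ht

/-- On the terms in `S`, the assignment `w` orders values as `v` does, and breaks ties by `h`. -/
def Refines {D E : Type*} [LinearOrder D] [LinearOrder E] (ι : ℚ ↪o D) (S : List QTerm)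
    (w v : ℕ → D) (h : QTerm → E) : Prop :=
  Realizes ι S w fun t => toLex (t.val ι v, h t)

theorem exists_refines {D E : Type*} [LinearOrder D] [DenselyOrdered D] [NoMinOrder D]
    [NoMaxOrder D] [LinearOrder E] (ι : ℚ ↪o D) (S : List QTerm) (v : ℕ → D) (h : QTerm → E) :
    ∃ w, Refines ι S w v h := by
  refine exists_realizes ι fun c d _ _ => ?_
  simp only [Prod.Lex.toLex_le_toLex, QTerm.val, ι.lt_iff_lt, ι.eq_iff_eq]
  refine ⟨fun hcd => hcd.lt_or_eq.imp_right fun hcd => ⟨hcd, hcd ▸ le_rfl⟩, ?_⟩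
  rintro (hcd | hcd)
  exacts [hcd.le, hcd.1.le]

theorem CompOp.rel_toLex {D E : Type*} [LinearOrder D] [LinearOrder E] {o : CompOp} {a b : D}
    {x y : E} (hab : o.Rel a b) (hxy : a = b → o.Rel x y) :
    o.Rel (toLex (a, x)) (toLex (b, y)) := by
  cases o
  · exact Prod.Lex.toLex_lt_toLex.2 (.inl hab)
  · exact Prod.Lex.toLex_le_toLex.2 (hab.lt_or_eq.imp_right fun h => ⟨h, hxy h⟩)
  · exact Prod.Lex.toLex_lt_toLex.2 (.inl hab)
  · exact Prod.Lex.toLex_le_toLex.2 (hab.lt_or_eq.imp_right fun h => ⟨h, hxy h.symm⟩)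
  · exact congrArg toLex (Prod.ext hab (hxy hab))
  · exact fun h => hab (congrArg Prod.fst (toLex_inj.1 h))

namespace Refines

variable {D E : Type*} [LinearOrder D] [LinearOrder E] {ι : ℚ ↪o D} {S : List QTerm}
  {w v : ℕ → D} {h : QTerm → E}

theorem lt_iff (H : Refines ι S w v h) {s t : QTerm} (hs : s ∈ S) (ht : t ∈ S) :
    s.val ι w < t.val ι w ↔ s.val ι v < t.val ι v ∨ s.val ι v = t.val ι v ∧ h s < h t :=
  (Realizes.lt_iff H hs ht).trans Prod.Lex.toLex_lt_toLex

theorem eq_iff (H : Refines ι S w v h) {s t : QTerm} (hs : s ∈ S) (ht : t ∈ S) :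
    s.val ι w = t.val ι w ↔ s.val ι v = t.val ι v ∧ h s = h t :=
  (Realizes.eq_iff H hs ht).trans (toLex_inj.trans Prod.mk_inj)

theorem rel (H : Refines ι S w v h) {s t : QTerm} (hs : s ∈ S) (ht : t ∈ S) {o : CompOp}
    (h₁ : o.Rel (s.val ι v) (t.val ι v)) (h₂ : s.val ι v = t.val ι v → o.Rel (h s) (h t)) :
    o.Rel (s.val ι w) (t.val ι w) :=
  (Realizes.rel_iff H hs ht o).2 (CompOp.rel_toLex h₁ h₂)

end Refines

/-! ### Correctness of the satisfiability test -/

/-- The conjunction `β` has a model. -/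
def Satisfiable {D : Type*} [LinearOrder D] (ι : ℚ ↪o D) (β : List Comparison) : Prop :=
  ∃ v : ℕ → D, AllHold ι v β

theorem Comparison.neg_holds {D : Type*} [LinearOrder D] {ι : ℚ ↪o D} {v : ℕ → D}
    {a : Comparison} : a.neg.Holds ι v ↔ ¬ a.Holds ι v := by
  obtain ⟨l, o, r⟩ := a
  cases o
  exacts [not_lt.symm, not_le.symm, not_lt.symm, not_le.symm, Iff.rfl, not_ne_iff.symm]

theorem allHold_cons {D : Type*} [LinearOrder D] {ι : ℚ ↪o D} {v : ℕ → D} {a : Comparison}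
    {β : List Comparison} : AllHold ι v (a :: β) ↔ a.Holds ι v ∧ AllHold ι v β :=
  List.forall_mem_cons

theorem implied_iff_not_satisfiable {D : Type*} [LinearOrder D] {ι : ℚ ↪o D}
    {β : List Comparison} {a : Comparison} :
    Implied ι β a ↔ ¬ Satisfiable ι (a.neg :: β) := by
  simp only [Implied, Satisfiable, allHold_cons, Comparison.neg_holds, not_exists, not_and']
  exact forall₂_congr fun _ _ => not_not.symm

theorem Comparison.rel_iff {L : Type*} [LinearOrder L] (a : Comparison) (p : QTerm → L) :
    a.op.Rel (p a.lhs) (p a.rhs) ↔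
      (∀ e ∈ a.edges, p e.1 ≤ p e.2) ∧ ∀ e ∈ a.disequalities, p e.1 ≠ p e.2 := by
  obtain ⟨l, o, r⟩ := a
  cases o <;> simp only [CompOp.Rel, edges, disequalities, List.forall_mem_cons,
    List.not_mem_nil, false_imp_iff, implies_true, and_true, true_and, lt_iff_le_and_ne,
    le_antisymm_iff (a := p l), ge_iff_le, ne_comm (a := p r)]

open Relation in
theorem reflTransGen_insert {α : Type*} {r : α → α → Prop} {a b s t : α} :
    ReflTransGen (fun x y => r x y ∨ (x, y) = (a, b)) s t ↔
      ReflTransGen r s t ∨ ReflTransGen r s a ∧ ReflTransGen r b t := by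
  constructor
  · intro h
    induction h with
    | refl => exact .inl .refl
    | tail _ h ih =>
      rcases h with h | h
      · exact ih.imp (·.tail h) fun h' => ⟨h'.1, h'.2.tail h⟩
      · obtain ⟨rfl, rfl⟩ := Prod.mk_inj.1 h
        exact .inr ⟨ih.elim id (·.1), .refl⟩
  · have hm : ReflTransGen r ≤ ReflTransGen fun x y => r x y ∨ (x, y) = (a, b) :=
      ReflTransGen.mono fun _ _ => Or.inl
    rintro (h | ⟨h₁, h₂⟩)
    · exact hm _ _ h
    · exact ((hm _ _ h₁).tail (.inr rfl)).trans (hm _ _ h₂)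

open Relation in
theorem mem_foldl_addEdge {T : List QTerm} {E : List (QTerm × QTerm)} {r : QTerm → QTerm → Prop}
    {R : List (QTerm × QTerm)} (hE : ∀ e ∈ E, e.1 ∈ T ∧ e.2 ∈ T)
    (hR : ∀ s ∈ T, ∀ t ∈ T, (s, t) ∈ R ↔ ReflTransGen r s t) {s t : QTerm} (hs : s ∈ T)
    (ht : t ∈ T) : (s, t) ∈ E.foldl (addEdge (T ×ˢ T)) R ↔
      ReflTransGen (fun x y => r x y ∨ (x, y) ∈ E) s t := by
  induction E generalizing r R with
  | nil => simpa only [List.foldl_nil, List.not_mem_nil, or_false] using hR s hs t ht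
  | cons e E ih =>
    obtain ⟨he, hE⟩ := List.forall_mem_cons.1 hE
    rw [List.foldl_cons, ih (r := fun x y => r x y ∨ (x, y) = e) hE ?_]
    · simp only [List.mem_cons, or_assoc]
    · intro s hs t ht
      obtain ⟨a, b⟩ := e
      simp only [addEdge, List.mem_filter, List.mem_product, Bool.or_eq_true, Bool.and_eq_true,
        decide_eq_true_iff, hs, ht, hR s hs t ht, hR s hs a he.1, hR b he.2 t ht, and_self,
        true_and, reflTransGen_insert]

theorem QTerm.constLE_iff {s t : QTerm} :
    s.constLE t = true ↔ ∃ c d, s = .const c ∧ t = .const d ∧ c ≤ d := by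
  rcases s with x | c <;> rcases t with y | d
  · exact ⟨nofun, nofun⟩
  · exact ⟨nofun, nofun⟩
  · exact ⟨nofun, nofun⟩
  · refine (decide_eq_true_iff (p := c ≤ d)).trans ⟨fun h => ⟨c, d, rfl, rfl, h⟩, ?_⟩
    rintro ⟨_, _, ⟨⟩, ⟨⟩, h⟩
    exact h

theorem mem_acTerms {β : List Comparison} {t : QTerm} :
    t ∈ acTerms β ↔ ∃ a ∈ β, t = a.lhs ∨ t = a.rhs := by
  simp only [acTerms, List.mem_flatMap, List.mem_cons, List.not_mem_nil, or_false]

theorem lhs_mem_acTerms {β : List Comparison} {a : Comparison} (ha : a ∈ β) : a.lhs ∈ acTerms β :=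
  mem_acTerms.2 ⟨a, ha, .inl rfl⟩

theorem rhs_mem_acTerms {β : List Comparison} {a : Comparison} (ha : a ∈ β) : a.rhs ∈ acTerms β :=
  mem_acTerms.2 ⟨a, ha, .inr rfl⟩

theorem Comparison.eq_of_mem_edges_append_disequalities {a : Comparison} {e : QTerm × QTerm}
    (he : e ∈ a.edges ++ a.disequalities) : e = (a.lhs, a.rhs) ∨ e = (a.rhs, a.lhs) := by
  obtain ⟨l, o, r⟩ := a
  cases o <;>
    simp only [edges, disequalities, List.mem_append, List.mem_cons, List.not_mem_nil] at he <;>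
    tauto

theorem mem_acTerms_of_mem_edges_append_disequalities {β : List Comparison} {a : Comparison}
    (ha : a ∈ β) {e : QTerm × QTerm} (he : e ∈ a.edges ++ a.disequalities) :
    e.1 ∈ acTerms β ∧ e.2 ∈ acTerms β := by
  rcases a.eq_of_mem_edges_append_disequalities he with rfl | rfl
  exacts [⟨lhs_mem_acTerms ha, rhs_mem_acTerms ha⟩, ⟨rhs_mem_acTerms ha, lhs_mem_acTerms ha⟩]

/-- The inequalities that are stated by `β` or hold between the constants of `β`. -/
def EdgeRel (β : List Comparison) (s t : QTerm) : Prop :=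
  (s ∈ acTerms β ∧ t ∈ acTerms β ∧ s.constLE t = true) ∨ (s, t) ∈ β.flatMap Comparison.edges

open Relation in
theorem mem_lePairs {β : List Comparison} {s t : QTerm} (hs : s ∈ acTerms β) (ht : t ∈ acTerms β) :
    (s, t) ∈ lePairs β ↔ ReflTransGen (EdgeRel β) s t := by
  refine mem_foldl_addEdge (r := fun s t => s ∈ acTerms β ∧ t ∈ acTerms β ∧ s.constLE t = true)
    (fun e he => ?_) (fun s hs t ht => ?_) hs ht
  · obtain ⟨a, ha, he⟩ := List.mem_flatMap.1 he
    exact mem_acTerms_of_mem_edges_append_disequalities ha (List.mem_append_left _ he)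
  · have : IsTrans QTerm fun s t => s ∈ acTerms β ∧ t ∈ acTerms β ∧ s.constLE t = true := by
      refine ⟨fun s t r ⟨hs, _, hst⟩ ⟨_, hr, htr⟩ => ?_⟩
      obtain ⟨c, d, rfl, rfl, hcd⟩ := QTerm.constLE_iff.1 hst
      obtain ⟨_, e, ⟨⟩, rfl, hde⟩ := QTerm.constLE_iff.1 htr
      exact ⟨hs, hr, QTerm.constLE_iff.2 ⟨c, e, rfl, rfl, hcd.trans hde⟩⟩
    rw [reflTransGen_iff_eq_or_transGen, transGen_eq_self, eq_comm (a := t)]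
    simp only [List.mem_filter, List.mem_product, hs, ht, Bool.or_eq_true, decide_eq_true_iff,
      and_self, true_and]

open Relation in
theorem satTest_eq_true_iff {β : List Comparison} : satTest β = true ↔ ∀ e ∈ nePairs β,
    ¬ (ReflTransGen (EdgeRel β) e.1 e.2 ∧ ReflTransGen (EdgeRel β) e.2 e.1) := by
  simp only [satTest, List.all_eq_true, Bool.not_eq_true', ← Bool.not_eq_true, Bool.and_eq_true,
    decide_eq_true_iff]
  refine forall₂_congr fun e he => ?_
  have hmem : e.1 ∈ acTerms β ∧ e.2 ∈ acTerms β := by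
    rcases List.mem_append.1 he with he | he
    · obtain ⟨a, ha, he⟩ := List.mem_flatMap.1 he
      exact mem_acTerms_of_mem_edges_append_disequalities ha (List.mem_append_right _ he)
    · exact List.mem_product.1 (List.mem_of_mem_filter he)
  rw [mem_lePairs hmem.1 hmem.2, mem_lePairs hmem.2 hmem.1]

open Relation in
theorem exists_linearOrder_quotient.{u} {α : Type u} (r : α → α → Prop) :
    ∃ (L : Type u) (_ : LinearOrder L) (p : α → L), (∀ s t, r s t → p s ≤ p t) ∧
      ∀ s t, p s = p t → ReflTransGen r s t ∧ ReflTransGen r t s := by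
  let _ : Preorder α :=
    { le := ReflTransGen r, le_refl := fun _ => .refl, le_trans := fun _ _ _ => .trans }
  exact ⟨LinearExtension (Antisymmetrization α (· ≤ ·)), inferInstance,
    fun s => toLinearExtension (toAntisymmetrization (· ≤ ·) s),
    fun s t h => toLinearExtension.monotone (toAntisymmetrization_mono (ReflTransGen.single h)),
    fun s t h => (Quotient.exact h : AntisymmRel (· ≤ ·) s t)⟩

theorem const_mem_nePairs {β : List Comparison} {c d : ℚ} (hc : QTerm.const c ∈ acTerms β)
    (hd : QTerm.const d ∈ acTerms β) (hcd : c ≠ d) : (.const c, .const d) ∈ nePairs β := by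
  refine List.mem_append_right _ (List.mem_filter.2 ⟨List.mem_product.2 ⟨hc, hd⟩, ?_⟩)
  simpa only [QTerm.isConst, Bool.and_self, Bool.true_and, Bool.not_eq_true',
    decide_eq_false_iff_not, QTerm.const.injEq] using hcd

theorem satisfiable_of_satTest {D : Type*} [LinearOrder D] [DenselyOrdered D] [NoMinOrder D]
    [NoMaxOrder D] (ι : ℚ ↪o D) {β : List Comparison} (h : satTest β = true) :
    Satisfiable ι β := by
  obtain ⟨L, _, p, hle, hsep⟩ := exists_linearOrder_quotient (EdgeRel β)
  have hne : ∀ e ∈ nePairs β, p e.1 ≠ p e.2 := fun e he heq =>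
    satTest_eq_true_iff.1 h e he (hsep _ _ heq)
  have hconst : ∀ {c d}, QTerm.const c ∈ acTerms β → QTerm.const d ∈ acTerms β → c ≤ d →
      p (.const c) ≤ p (.const d) := fun hc hd hcd =>
    hle _ _ (.inl ⟨hc, hd, QTerm.constLE_iff.2 ⟨_, _, rfl, rfl, hcd⟩⟩)
  obtain ⟨w, hw⟩ := exists_realizes ι (p := p) (S := acTerms β) fun c d hc hd =>
    ⟨hconst hc hd, fun hcd => le_of_not_gt fun hdc =>
      hne _ (const_mem_nePairs hc hd hdc.ne') (hcd.antisymm (hconst hd hc hdc.le))⟩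
  refine ⟨w, fun a ha => ?_⟩
  rw [Comparison.Holds, hw.rel_iff (lhs_mem_acTerms ha) (rhs_mem_acTerms ha), a.rel_iff]
  exact ⟨fun e he => hle _ _ (.inr (List.mem_flatMap.2 ⟨a, ha, he⟩)),
    fun e he => hne e (List.mem_append_left _ (List.mem_flatMap.2 ⟨a, ha, he⟩))⟩

section Soundness

variable {D : Type*} [LinearOrder D] {ι : ℚ ↪o D} {v : ℕ → D} {β : List Comparison}

theorem AllHold.val_le_of_edgeRel (hv : AllHold ι v β) {s t : QTerm} (h : EdgeRel β s t) :
    s.val ι v ≤ t.val ι v := by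
  rcases h with ⟨-, -, h⟩ | h
  · obtain ⟨c, d, rfl, rfl, hcd⟩ := QTerm.constLE_iff.1 h
    exact ι.monotone hcd
  · obtain ⟨a, ha, he⟩ := List.mem_flatMap.1 h
    exact ((a.rel_iff (QTerm.val ι v)).1 (hv a ha)).1 _ he

theorem AllHold.val_ne_of_mem_nePairs (hv : AllHold ι v β) {e : QTerm × QTerm}
    (he : e ∈ nePairs β) : e.1.val ι v ≠ e.2.val ι v := by
  rcases List.mem_append.1 he with he | he
  · obtain ⟨a, ha, he⟩ := List.mem_flatMap.1 he
    exact ((a.rel_iff (QTerm.val ι v)).1 (hv a ha)).2 e he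
  · obtain ⟨x | c, y | d⟩ := e <;>
      simp only [List.mem_filter, QTerm.isConst, Bool.and_false, Bool.false_and, Bool.and_self,
        Bool.false_eq_true, and_false, Bool.true_and, Bool.not_eq_true', decide_eq_false_iff_not,
        QTerm.const.injEq] at he
    exact ι.injective.ne he.2

theorem satTest_of_allHold (hv : AllHold ι v β) : satTest β = true := by
  have hle : ∀ s t, Relation.ReflTransGen (EdgeRel β) s t → s.val ι v ≤ t.val ι v := by
    intro s t h
    induction h with
    | refl => exact le_rfl
    | tail _ h ih => exact ih.trans (hv.val_le_of_edgeRel h)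
  exact satTest_eq_true_iff.2 fun e he h =>
    hv.val_ne_of_mem_nePairs he ((hle _ _ h.1).antisymm (hle _ _ h.2))

end Soundness

theorem satTest_iff {D : Type*} [LinearOrder D] [DenselyOrdered D] [NoMinOrder D]
    [NoMaxOrder D] (ι : ℚ ↪o D) {β : List Comparison} : satTest β = true ↔ Satisfiable ι β :=
  ⟨satisfiable_of_satTest ι, fun ⟨_, hv⟩ => satTest_of_allHold hv⟩

theorem impTest_iff {D : Type*} [LinearOrder D] [DenselyOrdered D] [NoMinOrder D]
    [NoMaxOrder D] (ι : ℚ ↪o D) {β : List Comparison} {a : Comparison} :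
    impTest β a = true ↔ Implied ι β a := by
  rw [impTest, Bool.not_eq_true', ← Bool.not_eq_true, satTest_iff ι, implied_iff_not_satisfiable]

/-! ### Substitutions and canonical databases -/

section Semantics

variable {D : Type*} [LinearOrder D] {ι : ℚ ↪o D}

theorem QTerm.val_subst {v : ℕ → D} {σ : ℕ → QTerm} {t : QTerm} :
    (t.subst σ).val ι v = t.val ι fun x => (σ x).val ι v := by
  cases t <;> rfl

theorem Comparison.holds_subst {v : ℕ → D} {σ : ℕ → QTerm} {a : Comparison} :
    (a.subst σ).Holds ι v ↔ a.Holds ι fun x => (σ x).val ι v := by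
  simp only [Holds, subst, QTerm.val_subst]

theorem QAtom.toFact_subst {v : ℕ → D} {σ : ℕ → QTerm} {a : QAtom} :
    (a.subst σ).toFact ι v = a.toFact ι fun x => (σ x).val ι v := by
  simp only [QAtom.toFact, QAtom.subst, List.map_map, Function.comp_def, QTerm.val_subst]

theorem map_val_map_subst {v : ℕ → D} {σ : ℕ → QTerm} {l : List QTerm} :
    (l.map (QTerm.subst σ)).map (QTerm.val ι v) = l.map (QTerm.val ι fun x => (σ x).val ι v) := by
  simp only [List.map_map, Function.comp_def, QTerm.val_subst]

theorem allHold_map_subst {v : ℕ → D} {σ : ℕ → QTerm} {β : List Comparison} :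
    AllHold ι v (β.map (Comparison.subst σ)) ↔ AllHold ι (fun x => (σ x).val ι v) β := by
  simp only [AllHold, List.forall_mem_map, Comparison.holds_subst]

/-- The assignment `u` produces the head tuple of `Q₂` under `v` by evaluating the head and the
relational subgoals of `Q₁` on the canonical database of `Q₂`, whose facts are the subgoals of `Q₂`
under `v`. -/
def IsMatch (ι : ℚ ↪o D) (Q₁ : CQAC) (u : ℕ → D) (Q₂ : CQAC) (v : ℕ → D) : Prop :=
  (∀ a ∈ Q₁.body, ∃ b ∈ Q₂.body, a.toFact ι u = b.toFact ι v) ∧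
    Q₁.head.map (QTerm.val ι u) = Q₂.head.map (QTerm.val ι v)

theorem contained_iff {Q₂ Q₁ : CQAC} : Contained ι Q₂ Q₁ ↔
    ∀ v, AllHold ι v Q₂.acs → ∃ u, IsMatch ι Q₁ u Q₂ v ∧ AllHold ι u Q₁.acs := by
  constructor
  · intro h v hv
    have hfin : {f | ∃ b ∈ Q₂.body, f = b.toFact ι v}.Finite :=
      (List.finite_toSet (Q₂.body.map (QAtom.toFact ι v))).subset
        fun f ⟨b, hb, hf⟩ => List.mem_map.2 ⟨b, hb, hf.symm⟩
    obtain ⟨u, hbody, hacs, hhead⟩ := h _ hfin ⟨v, fun b hb => ⟨b, hb, rfl⟩, hv, rfl⟩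
    exact ⟨u, ⟨hbody, hhead.symm⟩, hacs⟩
  · rintro h I _ t ⟨v, hI, hv, rfl⟩
    obtain ⟨u, ⟨hbody, hhead⟩, hacs⟩ := h v hv
    refine ⟨u, fun a ha => ?_, hacs, hhead.symm⟩
    obtain ⟨b, hb, hab⟩ := hbody a ha
    exact hab ▸ hI b hb

/-! ### Representatives of terms modulo the implied equations -/

theorem implied_of_mem {β : List Comparison} {a : Comparison} (h : a ∈ β) : Implied ι β a :=
  fun _ hv => hv a h

theorem implied_eqRepr (ι : ℚ ↪o D) (β : List Comparison) (x : ℕ) :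
    Implied ι β ⟨.var x, .eq, eqRepr ι β x⟩ := by
  unfold eqRepr
  split_ifs with h
  · exact h.choose_spec
  · exact Nat.sInf_mem (s := {y : ℕ | Implied ι β ⟨.var x, .eq, .var y⟩}) ⟨x, fun _ _ => rfl⟩

theorem val_eqRepr {β : List Comparison} {v : ℕ → D} (hv : AllHold ι v β) :
    (fun x => (eqRepr ι β x).val ι v) = v :=
  funext fun x => (implied_eqRepr ι β x v hv).symm

theorem val_subst_eqRepr {β : List Comparison} {v : ℕ → D} (hv : AllHold ι v β) (t : QTerm) :
    (t.subst (eqRepr ι β)).val ι v = t.val ι v := by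
  rw [QTerm.val_subst, val_eqRepr hv]

theorem eqRepr_eq_const {β : List Comparison} (hβ : Satisfiable ι β) {x : ℕ} {c : ℚ}
    (hx : Implied ι β ⟨.var x, .eq, .const c⟩) : eqRepr ι β x = .const c := by
  have h : ∃ c : ℚ, Implied ι β ⟨.var x, .eq, .const c⟩ := ⟨c, hx⟩
  obtain ⟨v, hv⟩ := hβ
  rw [eqRepr, dif_pos h]
  exact congrArg _ (ι.injective ((h.choose_spec v hv).symm.trans (hx v hv)))

theorem eqRepr_eq_eqRepr {β : List Comparison} (hβ : Satisfiable ι β) {x y : ℕ}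
    (h : Implied ι β ⟨.var x, .eq, .var y⟩) : eqRepr ι β x = eqRepr ι β y := by
  have hiff : ∀ t, Implied ι β ⟨.var x, .eq, t⟩ ↔ Implied ι β ⟨.var y, .eq, t⟩ := fun t =>
    ⟨fun h' v hv => (h v hv).symm.trans (h' v hv), fun h' v hv => (h v hv).trans (h' v hv)⟩
  by_cases hx : ∃ c : ℚ, Implied ι β ⟨.var x, .eq, .const c⟩
  · obtain ⟨c, hc⟩ := hx
    rw [eqRepr_eq_const hβ hc, eqRepr_eq_const hβ ((hiff _).1 hc)]
  · have hy : ¬ ∃ c : ℚ, Implied ι β ⟨.var y, .eq, .const c⟩ := by simpa only [hiff] using hx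
    simp only [eqRepr, dif_neg hx, dif_neg hy, hiff]

theorem subst_eqRepr_eq {β : List Comparison} (hβ : Satisfiable ι β) {s t : QTerm}
    (h : Implied ι β ⟨s, .eq, t⟩) : s.subst (eqRepr ι β) = t.subst (eqRepr ι β) := by
  rcases s with x | c <;> rcases t with y | d
  · exact eqRepr_eq_eqRepr hβ h
  · exact eqRepr_eq_const hβ h
  · exact (eqRepr_eq_const hβ fun v hv => (h v hv).symm).symm
  · obtain ⟨v, hv⟩ := hβ
    exact congrArg QTerm.const (ι.injective (h v hv))

/-! ### Generic models -/

theorem Refines.allHold {E : Type*} [LinearOrder E] {S : List QTerm} {w v : ℕ → D} {h : QTerm → E}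
    (H : Refines ι S w v h) {β : List Comparison} (hS : acTerms β ⊆ S) (hv : AllHold ι v β)
    (hh : ∀ a ∈ β, a.lhs.val ι v = a.rhs.val ι v → a.op.Rel (h a.lhs) (h a.rhs)) :
    AllHold ι w β := fun a ha =>
  H.rel (hS (lhs_mem_acTerms ha)) (hS (rhs_mem_acTerms ha)) (hv a ha) (hh a ha)

theorem CompOp.rel_max {o : CompOp} {a b c d : D} (ho : o ≠ .ne) (hab : o.Rel a b)
    (hcd : o.Rel c d) : o.Rel (max a c) (max b d) := by
  cases o
  · exact max_lt_max hab hcd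
  · exact max_le_max hab hcd
  · exact max_lt_max (α := D) hab hcd
  · exact max_le_max (α := D) hab hcd
  · exact congrArg₂ max hab hcd
  · exact absurd rfl ho

theorem QTerm.val_max (v m : ℕ → D) (t : QTerm) :
    t.val ι (fun x => max (v x) (m x)) = max (t.val ι v) (t.val ι m) := by
  cases t
  exacts [rfl, (max_self _).symm]

/-- The comparison is an equation or an upper bound `t ≤ c`. -/
def Comparison.IsEqOrUpperBound (a : Comparison) : Prop :=
  a.op = .eq ∨ a.op = .le ∧ ∃ c, a.rhs = .const c

-- The maximum of `v` and `m` violates every upper bound that `v` or `m` violates; breaking its ties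
-- first by `v` and then by `m` separates the terms that `v` or `m` separates.
theorem exists_model_violating_either [DenselyOrdered D] [NoMinOrder D] [NoMaxOrder D]
    {β : List Comparison} {v m : ℕ → D} (hv : AllHold ι v β) (hm : AllHold ι m β)
    {G : List Comparison} (hG : ∀ a ∈ G, a.IsEqOrUpperBound) :
    ∃ w, AllHold ι w β ∧ ∀ a ∈ G, ¬ a.Holds ι v ∨ ¬ a.Holds ι m → ¬ a.Holds ι w := by
  set S := acTerms G ++ acTerms β
  obtain ⟨w₁, h₁⟩ := exists_refines ι S (fun x => max (v x) (m x)) (QTerm.val ι v)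
  obtain ⟨w₂, h₂⟩ := exists_refines ι S w₁ (QTerm.val ι m)
  refine ⟨w₂, h₂.allHold (List.subset_append_right _ _) (fun a ha => ?_) fun a ha _ => hm a ha,
    fun a ha hor => ?_⟩
  · have hl : a.lhs ∈ S := List.mem_append_right _ (lhs_mem_acTerms ha)
    have hr : a.rhs ∈ S := List.mem_append_right _ (rhs_mem_acTerms ha)
    by_cases ho : a.op = .ne
    · have hva := hv a ha
      rw [Comparison.Holds, ho] at hva ⊢
      exact fun h => hva ((h₁.eq_iff hl hr).1 h).2
    · refine h₁.rel hl hr ?_ fun _ => hv a ha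
      rw [QTerm.val_max, QTerm.val_max]
      exact CompOp.rel_max ho (hv a ha) (hm a ha)
  · have hl : a.lhs ∈ S := List.mem_append_left _ (lhs_mem_acTerms ha)
    have hr : a.rhs ∈ S := List.mem_append_left _ (rhs_mem_acTerms ha)
    simp only [Comparison.Holds] at hor ⊢
    rcases hG a ha with ho | ⟨ho, c, hc⟩
    · rw [ho] at hor ⊢
      intro h
      obtain ⟨h, hma⟩ := (h₂.eq_iff hl hr).1 h
      exact hor.elim (· ((h₁.eq_iff hl hr).1 h).2) (· hma)
    · rw [ho] at hor ⊢
      refine not_le.2 ((h₂.lt_iff hr hl).2 (.inl ((h₁.lt_iff hr hl).2 (.inl ?_))))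
      rw [hc] at hor ⊢
      rw [QTerm.val_max _ _ a.lhs]
      exact lt_max_iff.2 (hor.imp not_le.1 not_le.1)

theorem exists_generic_model [DenselyOrdered D] [NoMinOrder D] [NoMaxOrder D]
    {β : List Comparison} (hβ : Satisfiable ι β) {G : List Comparison}
    (hG : ∀ a ∈ G, a.IsEqOrUpperBound ∧ ¬ Implied ι β a) :
    ∃ v, AllHold ι v β ∧ ∀ a ∈ G, ¬ a.Holds ι v := by
  induction G with
  | nil => exact hβ.imp fun v hv => ⟨hv, fun _ ha => absurd ha List.not_mem_nil⟩
  | cons g G ih =>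
    obtain ⟨⟨_, hg⟩, hG'⟩ := List.forall_mem_cons.1 hG
    obtain ⟨v, hv, hvG⟩ := ih hG'
    obtain ⟨m, hm, hmg⟩ : ∃ m, AllHold ι m β ∧ ¬ g.Holds ι m := by
      simpa only [Implied, not_forall, exists_prop] using hg
    obtain ⟨w, hw, hwG⟩ := exists_model_violating_either hv hm fun a ha => (hG a ha).1
    refine ⟨w, hw, fun a ha => hwG a ha ?_⟩
    rcases List.mem_cons.1 ha with rfl | ha
    exacts [.inr hmg, .inl (hvG a ha)]

/-- Terms in `S` have equal values under `w` only if `β` implies that they are equal. -/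
def Separates (ι : ℚ ↪o D) (β : List Comparison) (S : List QTerm) (w : ℕ → D) : Prop :=
  ∀ s ∈ S, ∀ t ∈ S, s.val ι w = t.val ι w → Implied ι β ⟨s, .eq, t⟩

theorem exists_separating_model [DenselyOrdered D] [NoMinOrder D] [NoMaxOrder D]
    {β : List Comparison} (hβ : Satisfiable ι β) (S : List QTerm) :
    ∃ w, AllHold ι w β ∧ Separates ι β S w ∧ ∀ s ∈ S, ∀ c, .const c ∈ S → s.val ι w ≤ ι c →
      Implied ι β ⟨s, .le, .const c⟩ := by
  classical
  obtain ⟨w, hw, hwG⟩ := exists_generic_model hβ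
    (G := ((S ×ˢ S).flatMap fun p => [⟨p.1, .eq, p.2⟩, ⟨p.1, .le, p.2⟩]).filter fun a =>
      a.IsEqOrUpperBound ∧ ¬ Implied ι β a) fun a ha => of_decide_eq_true (List.mem_filter.1 ha).2
  have himp {s t : QTerm} (hs : s ∈ S) (ht : t ∈ S) {a : Comparison}
      (ha : a ∈ [⟨s, .eq, t⟩, ⟨s, .le, t⟩]) (hub : a.IsEqOrUpperBound) (hwa : a.Holds ι w) :
      Implied ι β a := by
    by_contra hni
    refine hwG a (List.mem_filter.2 ⟨?_, decide_eq_true ⟨hub, hni⟩⟩) hwa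
    exact List.mem_flatMap.2 ⟨(s, t), List.mem_product.2 ⟨hs, ht⟩, ha⟩
  exact ⟨w, hw, fun s hs t ht => himp hs ht List.mem_cons_self (.inl rfl), fun s hs c hc =>
    himp hs hc (List.mem_cons_of_mem _ (List.mem_singleton_self _)) (.inr ⟨rfl, c, rfl⟩)⟩

/-! ### Moving values off the constants of open semi-intervals -/

/-- The conjunction `β` forces the term to be equal to some constant. -/
def Forced (ι : ℚ ↪o D) (β : List Comparison) (t : QTerm) : Prop :=
  ∃ c, Implied ι β ⟨t, .eq, .const c⟩

theorem forced_const (β : List Comparison) (c : ℚ) : Forced ι β (.const c) :=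
  ⟨c, fun _ _ => rfl⟩

open Classical in
/-- The values of an assignment, moved by `φ` where they are not forced by `β`. -/
noncomputable def shiftedVal (ι : ℚ ↪o D) (β : List Comparison) (φ : D → D) (v : ℕ → D)
    (t : QTerm) : D :=
  if Forced ι β t then t.val ι v else φ (t.val ι v)

section Shift

variable {β : List Comparison} {φ : D → D} {v : ℕ → D}

theorem shift_eq_self_of_forced (hφ : ∀ c, InClosedSI ι β c → φ (ι c) = ι c) (hv : AllHold ι v β)
    {s t : QTerm} (hs : Forced ι β s) (ht : ¬ Forced ι β t) (hst : s.val ι v = t.val ι v)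
    (h : Implied ι β ⟨s, .le, t⟩ ∨ Implied ι β ⟨t, .le, s⟩) : φ (t.val ι v) = t.val ι v := by
  obtain ⟨c, hc⟩ := hs
  have hsc : ∀ w, AllHold ι w β → s.val ι w = ι c := hc
  rcases t with x | d
  swap
  · exact absurd (forced_const β d) ht
  have htc : (QTerm.var x).val ι v = ι c := hst.symm.trans (hsc v hv)
  rw [htc]
  refine hφ c ⟨x, fun h => ht ⟨c, h⟩, ?_⟩
  rcases h with h | h
  · exact .inr ⟨fun w hw => (hsc w hw).ge.trans (h w hw), fun h' => (h' v hv).ne htc.symm⟩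
  · exact .inl ⟨fun w hw => (h w hw).trans (hsc w hw).le, fun h' => (h' v hv).ne htc⟩

theorem shiftedVal_eq (hφ : ∀ c, InClosedSI ι β c → φ (ι c) = ι c) (hv : AllHold ι v β)
    {s t : QTerm} (hst : s.val ι v = t.val ι v)
    (h : Implied ι β ⟨s, .le, t⟩ ∨ Implied ι β ⟨t, .le, s⟩) :
    shiftedVal ι β φ v s = shiftedVal ι β φ v t := by
  unfold shiftedVal
  split_ifs with hs ht ht
  · exact hst
  · rw [shift_eq_self_of_forced hφ hv hs ht hst h, hst]
  · rw [shift_eq_self_of_forced hφ hv ht hs hst.symm h.symm, hst]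
  · rw [hst]

theorem rel_shiftedVal (hφ : ∀ c, InClosedSI ι β c → φ (ι c) = ι c) (hv : AllHold ι v β)
    {a : Comparison} (ha : a ∈ β) (h : a.lhs.val ι v = a.rhs.val ι v) :
    a.op.Rel (shiftedVal ι β φ v a.lhs) (shiftedVal ι β φ v a.rhs) := by
  have hva := hv a ha
  have himp := implied_of_mem (ι := ι) ha
  obtain ⟨l, o, r⟩ := a
  cases o
  · exact absurd h hva.ne
  · exact (shiftedVal_eq hφ hv h (.inl himp)).le
  · exact absurd h hva.ne'
  · exact (shiftedVal_eq hφ hv h (.inr himp)).ge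
  · exact shiftedVal_eq hφ hv h (.inl fun w hw => (himp w hw).le)
  · exact absurd h hva

/-- On the terms in `S`, the assignment `w` keeps the strict inequalities between the values under
`v`, and separates equal values as the shift `φ` of the values that are not forced by `β` does. -/
def IsPerturbation (ι : ℚ ↪o D) (β : List Comparison) (φ : D → D) (S : List QTerm)
    (v w : ℕ → D) : Prop :=
  ∀ s ∈ S, ∀ t ∈ S, s.val ι v < t.val ι v ∨
    s.val ι v = t.val ι v ∧ shiftedVal ι β φ v s < shiftedVal ι β φ v t → s.val ι w < t.val ι w

theorem exists_separating_perturbation [DenselyOrdered D] [NoMinOrder D] [NoMaxOrder D]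
    (hφ : ∀ c, InClosedSI ι β c → φ (ι c) = ι c) (hv : AllHold ι v β) (S : List QTerm) :
    ∃ w, AllHold ι w β ∧ Separates ι β S w ∧ IsPerturbation ι β φ S v w := by
  obtain ⟨g, hg, hgS, -⟩ := exists_separating_model ⟨v, hv⟩ S
  obtain ⟨v₁, hv₁⟩ := exists_refines ι (acTerms β ++ S) v (shiftedVal ι β φ v)
  obtain ⟨v₂, hv₂⟩ := exists_refines ι (acTerms β ++ S) v₁ (QTerm.val ι g)
  have hβ : acTerms β ⊆ acTerms β ++ S := List.subset_append_left _ _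
  have hS : S ⊆ acTerms β ++ S := List.subset_append_right _ _
  refine ⟨v₂, hv₂.allHold hβ (hv₁.allHold hβ hv fun a ha => rel_shiftedVal hφ hv ha)
    fun a ha _ => hg a ha, fun s hs t ht hst => ?_, fun s hs t ht hst => ?_⟩
  · exact hgS s hs t ht ((hv₂.eq_iff (hS hs) (hS ht)).1 hst).2
  · exact (hv₂.lt_iff (hS hs) (hS ht)).2 (.inl ((hv₁.lt_iff (hS hs) (hS ht)).2 hst))

namespace IsPerturbation

variable {S : List QTerm} {w : ℕ → D}

theorem le_of_le (H : IsPerturbation ι β φ S v w) {s t : QTerm} (hs : s ∈ S) (ht : t ∈ S)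
    (h : s.val ι w ≤ t.val ι w) : s.val ι v ≤ t.val ι v :=
  le_of_not_gt fun h' => (H t ht s hs (.inl h')).not_ge h

theorem lt_const (H : IsPerturbation ι β φ S v w) (hv : AllHold ι v β) (hw : AllHold ι w β)
    {t : QTerm} {c : ℚ} (ht : t ∈ S) (hc : .const c ∈ S) (hφ : ι c < φ (ι c))
    (h : t.val ι w < ι c) : t.val ι v < ι c := by
  refine (H.le_of_le ht hc h.le).lt_of_ne fun (heq : t.val ι v = ι c) => ?_
  by_cases hf : Forced ι β t
  · obtain ⟨d, hd⟩ := hf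
    exact h.ne ((hd w hw).trans ((hd v hv).symm.trans heq))
  · refine (H (.const c) hc t ht (.inr ⟨heq.symm, ?_⟩)).not_gt h
    rwa [shiftedVal, shiftedVal, if_pos (forced_const β c), if_neg hf, heq]

theorem const_lt (H : IsPerturbation ι β φ S v w) (hv : AllHold ι v β) (hw : AllHold ι w β)
    {t : QTerm} {c : ℚ} (ht : t ∈ S) (hc : .const c ∈ S) (hφ : φ (ι c) < ι c)
    (h : ι c < t.val ι w) : ι c < t.val ι v := by
  refine (H.le_of_le hc ht h.le).lt_of_ne fun (heq : ι c = t.val ι v) => ?_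
  by_cases hf : Forced ι β t
  · obtain ⟨d, hd⟩ := hf
    exact h.ne (heq.trans ((hd v hv).trans (hd w hw).symm))
  · refine (H t ht (.const c) hc (.inr ⟨heq.symm, ?_⟩)).not_gt h
    rwa [shiftedVal, shiftedVal, if_pos (forced_const β c), if_neg hf, ← heq]

theorem rel_const (H : IsPerturbation ι β φ S v w) (hv : AllHold ι v β) (hw : AllHold ι w β)
    {t : QTerm} {c : ℚ} (ht : t ∈ S) (hc : .const c ∈ S) {o : CompOp}
    (ho : o ∈ [CompOp.lt, .le, .gt, .ge]) (hlt : o = .lt → ι c < φ (ι c))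
    (hgt : o = .gt → φ (ι c) < ι c) (h : o.Rel (t.val ι w) (ι c)) : o.Rel (t.val ι v) (ι c) := by
  cases o
  · exact H.lt_const hv hw ht hc (hlt rfl) h
  · exact H.le_of_le ht hc h
  · exact H.const_lt hv hw ht hc (hgt rfl) h
  · exact H.le_of_le hc ht h
  · exact absurd ho (by decide)
  · exact absurd ho (by decide)

end IsPerturbation

end Shift

theorem exists_shift [NoMinOrder D] [NoMaxOrder D] {β : List Comparison}
    (hne : ∀ a ∈ β, ∀ b ∈ β, ∀ c, a.IsSI .gt c → ¬ b.IsSI .lt c) :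
    ∃ φ : D → D, (∀ c, (∀ a ∈ β, ¬ a.IsOpenSI c) → φ (ι c) = ι c) ∧
      (∀ a ∈ β, ∀ c, a.IsSI .lt c → ι c < φ (ι c)) ∧
      (∀ a ∈ β, ∀ c, a.IsSI .gt c → φ (ι c) < ι c) := by
  classical
  choose up hup using exists_gt (α := D)
  choose down hdown using exists_lt (α := D)
  have hmem : ∀ o c, (∃ a ∈ β, ∃ d, a.IsSI o d ∧ ι c = ι d) ↔ ∃ a ∈ β, a.IsSI o c := fun o c => by
    simp only [ι.eq_iff_eq, exists_eq_right']
  refine ⟨fun y => if ∃ a ∈ β, ∃ d, a.IsSI .lt d ∧ y = ι d then up y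
    else if ∃ a ∈ β, ∃ d, a.IsSI .gt d ∧ y = ι d then down y else y,
    fun c hc => ?_, fun a ha c hac => ?_, fun a ha c hac => ?_⟩ <;> simp only [hmem]
  · rw [if_neg fun ⟨a, ha, hac⟩ => hc a ha (.inl hac),
      if_neg fun ⟨a, ha, hac⟩ => hc a ha (.inr hac)]
  · rw [if_pos ⟨a, ha, hac⟩]
    exact hup _
  · rw [if_neg fun ⟨b, hb, hbc⟩ => hne a ha b hb c hac hbc, if_pos ⟨a, ha, hac⟩]
    exact hdown _

/-! ### Containment mappings of collapsed queries -/

theorem map_eq_map_of_imp {α β γ δ : Type*} {f : α → γ} {g : β → γ} {f' : α → δ} {g' : β → δ}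
    {l : List α} {m : List β} (h : l.map f = m.map g)
    (himp : ∀ a ∈ l, ∀ b ∈ m, f a = g b → f' a = g' b) : l.map f' = m.map g' := by
  rw [← List.forall₂_eq_eq_eq, List.forall₂_map_left_iff, List.forall₂_map_right_iff] at h ⊢
  exact (List.forall₂_iff_zip.1 h).elim fun hlen hzip => List.forall₂_iff_zip.2
    ⟨hlen, fun hab => himp _ (List.of_mem_zip hab).1 _ (List.of_mem_zip hab).2 (hzip hab)⟩

/-- The terms in the relational subgoals of a query. -/
def CQAC.bodyTerms (Q : CQAC) : List QTerm := Q.body.flatMap QAtom.args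

/-- The terms in the relational subgoals and the head of a query. -/
def CQAC.terms (Q : CQAC) : List QTerm := Q.bodyTerms ++ Q.head

theorem CQAC.mem_bodyTerms {Q : CQAC} {t : QTerm} :
    t ∈ Q.bodyTerms ↔ ∃ a ∈ Q.body, t ∈ a.args :=
  List.mem_flatMap

theorem IsMatch.exists_bodyTerm {Q₂ Q₁ : CQAC} {u v : ℕ → D} (h : IsMatch ι Q₁ u Q₂ v) {s : QTerm}
    (hs : s ∈ Q₁.bodyTerms) : ∃ t ∈ Q₂.bodyTerms, s.val ι u = t.val ι v := by
  obtain ⟨a, ha, hsa⟩ := CQAC.mem_bodyTerms.1 hs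
  obtain ⟨b, hb, hab⟩ := h.1 a ha
  have hargs : a.args.map (QTerm.val ι u) = b.args.map (QTerm.val ι v) := congrArg Prod.snd hab
  obtain ⟨t, ht, hts⟩ := List.mem_map.1 (hargs ▸ List.mem_map_of_mem hsa)
  exact ⟨t, CQAC.mem_bodyTerms.2 ⟨b, hb, ht⟩, hts.symm⟩

theorem contained_of_containmentEntailment {Q₂ Q₁ : CQAC}
    (h : ContainmentEntailment ι (Q₂.collapse ι) (Q₁.collapse ι)) : Contained ι Q₂ Q₁ := by
  refine contained_iff.2 fun v hv => ?_
  have hval := val_eqRepr hv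
  obtain ⟨μ, ⟨hbody, hhead⟩, hacs⟩ := h v (allHold_map_subst.2 (by rwa [hval]))
  refine ⟨fun x => (eqRepr ι Q₁.acs x).val ι fun y => (μ y).val ι v, ⟨fun a ha => ?_, ?_⟩,
    allHold_map_subst.1 (allHold_map_subst.1 hacs)⟩
  · obtain ⟨b, hb, hab⟩ := List.mem_map.1 (hbody _ (List.mem_map_of_mem ha))
    refine ⟨b, hb, ?_⟩
    simpa only [QAtom.toFact_subst, hval] using congrArg (QAtom.toFact ι v) hab.symm
  · simpa only [CQAC.collapse, CQAC.subst, map_val_map_subst, hval] using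
      congrArg (List.map (QTerm.val ι v)) hhead

/-- The representative of each term of `Q₁` is mapped by `μ` to the representative of a term in `S`
whose value under `w` is the value of the term of `Q₁` under `u`. -/
def MapsRepr (ι : ℚ ↪o D) (Q₁ : CQAC) (u : ℕ → D) (Q₂ : CQAC) (w : ℕ → D) (S : List QTerm)
    (μ : ℕ → QTerm) : Prop :=
  ∀ s ∈ Q₁.terms, ∃ t ∈ S, s.val ι u = t.val ι w ∧
    (s.subst (eqRepr ι Q₁.acs)).subst μ = t.subst (eqRepr ι Q₂.acs)

section MapsRepr

variable {Q₂ Q₁ : CQAC} {u w : ℕ → D} {S : List QTerm} {μ : ℕ → QTerm}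

theorem IsMatch.exists_mapsRepr (h : IsMatch ι Q₁ u Q₂ w) (hu : AllHold ι u Q₁.acs)
    (hsafe : ∀ x, .var x ∈ Q₁.head → Q₁.InBody x) (hbody : Q₂.bodyTerms ⊆ S)
    (hrepr : Q₁.terms.map (QTerm.subst (eqRepr ι Q₁.acs)) ⊆ S) :
    ∃ μ, MapsRepr ι Q₁ u Q₂ w S μ := by
  classical
  refine ⟨fun y => if hy : ∃ t ∈ Q₂.bodyTerms, u y = t.val ι w then
    hy.choose.subst (eqRepr ι Q₂.acs) else .const 0, fun s hs => ?_⟩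
  have hval := val_subst_eqRepr hu s
  have hmem := hrepr (List.mem_map_of_mem hs)
  rcases hr : s.subst (eqRepr ι Q₁.acs) with y | c <;> rw [hr] at hval hmem
  · have hsbody : s ∈ Q₁.bodyTerms := by
      rcases List.mem_append.1 hs with hs | hs
      · exact hs
      · rcases s with x | d
        · exact CQAC.mem_bodyTerms.2 (hsafe x hs)
        · exact QTerm.noConfusion hr
    have hy : ∃ t ∈ Q₂.bodyTerms, u y = t.val ι w :=
      (h.exists_bodyTerm hsbody).imp fun t ht => ⟨ht.1, hval.trans ht.2⟩
    exact ⟨hy.choose, hbody hy.choose_spec.1, hval.symm.trans hy.choose_spec.2, dif_pos hy⟩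
  · exact ⟨.const c, hmem, hval.symm, rfl⟩

theorem MapsRepr.subst_eq (hμ : MapsRepr ι Q₁ u Q₂ w S μ) (hw : AllHold ι w Q₂.acs)
    (hS : Separates ι Q₂.acs S w) {s t : QTerm} (hs : s ∈ Q₁.terms) (ht : t ∈ S)
    (hst : s.val ι u = t.val ι w) :
    (s.subst (eqRepr ι Q₁.acs)).subst μ = t.subst (eqRepr ι Q₂.acs) := by
  obtain ⟨t', ht', hst', hμs⟩ := hμ s hs
  exact hμs.trans (subst_eqRepr_eq ⟨w, hw⟩ (hS t' ht' t ht (hst'.symm.trans hst)))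

theorem MapsRepr.isContainmentMapping (hμ : MapsRepr ι Q₁ u Q₂ w S μ)
    (hw : AllHold ι w Q₂.acs) (hS : Separates ι Q₂.acs S w) (h : IsMatch ι Q₁ u Q₂ w)
    (hmem : Q₂.terms ⊆ S) :
    IsContainmentMapping μ (Q₁.collapse ι) (Q₂.collapse ι) := by
  refine ⟨fun a' ha' => ?_, ?_⟩
  · obtain ⟨a, ha, rfl⟩ := List.mem_map.1 ha'
    obtain ⟨b, hb, hab⟩ := h.1 a ha
    have hargs : (a.args.map fun s => (s.subst (eqRepr ι Q₁.acs)).subst μ) =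
        b.args.map (QTerm.subst (eqRepr ι Q₂.acs)) :=
      map_eq_map_of_imp (congrArg Prod.snd hab) fun s hs t ht => hμ.subst_eq hw hS
        (List.mem_append_left _ (CQAC.mem_bodyTerms.2 ⟨a, ha, hs⟩))
        (hmem (List.mem_append_left _ (CQAC.mem_bodyTerms.2 ⟨b, hb, ht⟩)))
    have hatom : (a.subst (eqRepr ι Q₁.acs)).subst μ = b.subst (eqRepr ι Q₂.acs) := by
      simpa only [QAtom.subst, List.map_map, Function.comp_def, QAtom.mk.injEq] using
        ⟨congrArg Prod.fst hab, hargs⟩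
    exact hatom ▸ List.mem_map_of_mem hb
  · simp only [CQAC.collapse, CQAC.subst, List.map_map]
    exact map_eq_map_of_imp h.2 fun s hs t ht => hμ.subst_eq hw hS
      (List.mem_append_right _ hs) (hmem (List.mem_append_right _ ht))

end MapsRepr

/-- The comparison is a semi-interval comparison. -/
def Comparison.IsSemiInterval (a : Comparison) : Prop :=
  ∃ o ∈ [CompOp.lt, .le, .gt, .ge], ∃ c, a.IsSI o c

theorem containmentEntailment_of_contained [DenselyOrdered D] [NoMinOrder D] [NoMaxOrder D]
    {Q₂ Q₁ : CQAC} (hhead : ∀ x, .var x ∈ Q₁.head → Q₁.InBody x)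
    (hacs : ∀ a ∈ Q₁.acs, ∀ x, a.lhs = .var x ∨ a.rhs = .var x → Q₁.InBody x)
    (hclass : ∀ a ∈ Q₁.acs, a.IsSemiInterval ∨ a.op = .eq)
    (hne : ∀ a ∈ Q₁.acs, ∀ b ∈ Q₁.acs, ∀ c, a.IsSI .gt c → ¬ b.IsSI .lt c)
    (hopen : ∀ a ∈ Q₁.acs, ∀ c, a.IsOpenSI c → ¬ InClosedSI ι Q₂.acs c)
    (hcon : Contained ι Q₂ Q₁) :
    ContainmentEntailment ι (Q₂.collapse ι) (Q₁.collapse ι) := by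
  intro v₀ hv₀
  set v := fun x => (eqRepr ι Q₂.acs x).val ι v₀
  have hv : AllHold ι v Q₂.acs := allHold_map_subst.1 hv₀
  obtain ⟨φ, hφ, hφlt, hφgt⟩ := exists_shift (D := D) (ι := ι) hne
  set S := Q₂.terms ++ (Q₁.terms.map
    (QTerm.subst (eqRepr ι Q₁.acs)) ++ acTerms Q₁.acs)
  obtain ⟨w, hw, hsep, hpert⟩ := exists_separating_perturbation
    (fun c hc => hφ c fun a ha hac => hopen a ha c hac hc) hv S
  obtain ⟨u, hmatch, hu⟩ := contained_iff.1 hcon w hw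
  have hS : Q₂.terms ⊆ S := List.subset_append_left _ _
  obtain ⟨μ, hμ⟩ := hmatch.exists_mapsRepr (S := S) hu hhead
    (List.Subset.trans (List.subset_append_left _ _) hS)
    (List.Subset.trans (List.subset_append_left _ _) (List.subset_append_right _ _))
  refine ⟨μ, hμ.isContainmentMapping hw hsep hmatch hS, fun a'' ha'' => ?_⟩
  obtain ⟨a', ha', rfl⟩ := List.mem_map.1 ha''
  obtain ⟨a, ha, rfl⟩ := List.mem_map.1 ha'
  rcases hclass a ha with ⟨o, ho, c, x, rfl⟩ | heq
  · have hx : .var x ∈ Q₁.bodyTerms := CQAC.mem_bodyTerms.2 (hacs _ ha x (.inl rfl))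
    obtain ⟨t, ht, hxt, hμt⟩ := hμ _ (List.mem_append_left _ hx)
    have hxc : o.Rel (u x) (ι c) := hu _ ha
    have hc : QTerm.const c ∈ S :=
      List.mem_append_right _ (List.mem_append_right _ (rhs_mem_acTerms ha))
    have hgoal : o.Rel (t.val ι v) (ι c) := hpert.rel_const hv hw ht hc ho
      (fun h => hφlt _ ha c ⟨x, h ▸ rfl⟩) (fun h => hφgt _ ha c ⟨x, h ▸ rfl⟩) (hxt ▸ hxc)
    rwa [← QTerm.val_subst, ← hμt] at hgoal
  · have hterm : a.lhs.subst (eqRepr ι Q₁.acs) = a.rhs.subst (eqRepr ι Q₁.acs) :=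
      subst_eqRepr_eq ⟨u, hu⟩ (heq ▸ implied_of_mem ha)
    simp only [Comparison.Holds, Comparison.subst, hterm, heq, CompOp.Rel]

theorem IsInstance.not_isSI_lt {lsi rsi : CompOp} {Q₂ Q₁ : CQAC}
    (h : IsInstance ι lsi rsi Q₂ Q₁) : ∀ a ∈ Q₁.acs, ∀ b ∈ Q₁.acs, ∀ c,
      a.IsSI .gt c → ¬ b.IsSI .lt c :=
  fun a ha b hb c hac hbc => h.rsi_ne_lsi a ha b hb c c (.inl hac) (.inl hbc) rfl

theorem IsInstance.containmentEntailment_of_contained [DenselyOrdered D] [NoMinOrder D]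
    [NoMaxOrder D] {lsi rsi : CompOp} (hlsi : lsi = .le ∨ lsi = .lt) (hrsi : rsi = .ge ∨ rsi = .gt)
    {Q₂ Q₁ : CQAC} (h : IsInstance ι lsi rsi Q₂ Q₁) (hcon : Contained ι Q₂ Q₁) :
    ContainmentEntailment ι (Q₂.collapse ι) (Q₁.collapse ι) := by
  refine _root_.containmentEntailment_of_contained h.wf₁.head_safe h.wf₁.acs_safe (fun a ha => ?_)
    h.not_isSI_lt h.open_closed hcon
  have hlsi' : lsi ∈ [CompOp.lt, .le, .gt, .ge] := by rcases hlsi with rfl | rfl <;> decide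
  have hrsi' : rsi ∈ [CompOp.lt, .le, .gt, .ge] := by rcases hrsi with rfl | rfl <;> decide
  rcases h.inClass.1 a ha with hc | hc | heq
  exacts [.inl ⟨lsi, hlsi', hc⟩, .inl ⟨rsi, hrsi', hc⟩, .inr heq]

end Semantics

/-! ### The verifier -/

/-- The members of the list that a tree encodes. -/
def BTree.toList : BTree → List BTree
  | .nil => []
  | .cons l r => l :: r.toList

theorem BTree.code_toList (x : BTree) : code x.toList = x := by
  induction x with
  | nil => rfl
  | cons l r _ ih => rw [toList, code_cons, ih]; rfl

theorem BTree.toList_code {α : Type*} [TreeCode α] (l : List α) :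
    (code l).toList = l.map code := by
  induction l with
  | nil => rfl
  | cons a l ih => rw [code_cons, toList, ih, List.map_cons]

/-- The term among the candidates in `S` that the certificate `m`, a list of pairs of terms, assigns
to `t`, and `0` if there is none. -/
def lookupTerm (m : BTree) (S : List QTerm) (t : QTerm) : QTerm :=
  (S.filter fun s => decide (code (t, s) ∈ m.toList)).headD (.const 0)

/-- The map of variables to terms of the subgoals of `Q₂` that a certificate describes. -/
def certMapping (Q₂ : CQAC) (m : BTree) (x : ℕ) : QTerm := lookupTerm m Q₂.bodyTerms (.var x)

/-- The decision procedure for `Comparison.IsSI`. -/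
def Comparison.siTest (o : CompOp) (a : Comparison) : Bool :=
  !a.lhs.isConst && decide (a.op = o) && a.rhs.isConst

/-- The decision procedure for `Comparison.IsLSI`. -/
def Comparison.lsiTest (a : Comparison) : Bool := a.siTest .lt || a.siTest .le

/-- The decision procedure for `Comparison.IsRSI`. -/
def Comparison.rsiTest (a : Comparison) : Bool := a.siTest .gt || a.siTest .ge

/-- The decision procedure for `Comparison.IsOpenSI`. -/
def Comparison.openTest (a : Comparison) : Bool := a.siTest .lt || a.siTest .gt

/-- The first right semi-interval comparison of `Q`, and a comparison that is always true if there
is none. -/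
def CQAC.rsi (Q : CQAC) : Comparison :=
  (Q.acs.filter Comparison.rsiTest).headD ⟨.const 0, .eq, .const 0⟩

/-- The negation of the image of the right semi-interval comparison of `Q` under `σ`. -/
def CQAC.negatedRSI (Q : CQAC) (σ : ℕ → QTerm) : Comparison := (Q.rsi.subst σ).neg

/-- The terms in `S` that `β` forces to be equal to `t`. -/
def eqClass (β : List Comparison) (S : List QTerm) (t : QTerm) : List QTerm :=
  S.filter fun s => impTest β ⟨t, .eq, s⟩

/-- The test whether `σ` is a containment mapping from `Q₁` to `Q₂` modulo the equations that `β`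
implies, and `β` implies the images of all comparisons of `Q₁` except right semi-intervals. -/
def mappingTest (Q₂ Q₁ : CQAC) (β : List Comparison) (σ : ℕ → QTerm) : Bool :=
  (Q₁.body.all fun a => decide ((a.rel, a.args.map fun s => eqClass β Q₂.terms (s.subst σ)) ∈
      Q₂.body.map fun b => (b.rel, b.args.map (eqClass β Q₂.terms)))) &&
    decide ((Q₁.head.map fun s => eqClass β Q₂.terms (s.subst σ)) =
      Q₂.head.map (eqClass β Q₂.terms)) &&
    Q₁.acs.all fun a => a.rsiTest || impTest β (a.subst σ)

/-- The comparisons that describe the models of the comparisons of `Q₂` in which all the mappings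
in the list violate the right semi-interval comparison of `Q₁`. -/
def uncovered (Q₂ Q₁ : CQAC) (ms : List BTree) : List Comparison :=
  (ms.map fun m => Q₁.negatedRSI (certMapping Q₂ m)) ++ Q₂.acs

/-- The test whether each mapping in the list satisfies all comparisons of `Q₁`, except possibly the
right semi-interval, in the models that the mappings after it leave uncovered. -/
def mappingChainTest (Q₂ Q₁ : CQAC) : List BTree → Bool
  | [] => true
  | m :: ms => mappingTest Q₂ Q₁ (uncovered Q₂ Q₁ ms) (certMapping Q₂ m) &&
      mappingChainTest Q₂ Q₁ ms

/-- The test whether a list of mappings proves that `Q₂` is contained in `Q₁`. -/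
def containmentTest (Q₂ Q₁ : CQAC) (ms : List BTree) : Bool :=
  mappingChainTest Q₂ Q₁ ms && !satTest (uncovered Q₂ Q₁ ms)

/-- The decision procedure for `CQAC.WellFormed`. -/
def wellFormedTest (Q : CQAC) : Bool :=
  (Q.head.all fun t => t.isConst || decide (t ∈ Q.bodyTerms)) &&
    (Q.acs.all fun a => !a.lhs.isConst) &&
    ((acTerms Q.acs).all fun t => t.isConst || decide (t ∈ Q.bodyTerms)) && satTest Q.acs

instance : DecidableEq Comparison := code_injective.decidableEq

/-- The decision procedure for `InClassRSI1`. -/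
def classTest (lsi rsi : CompOp) (Q : CQAC) : Bool :=
  (Q.acs.all fun a => a.siTest lsi || a.siTest rsi || decide (a.op = .eq)) &&
    decide ((Q.acs.filter Comparison.rsiTest).tail = [])

/-- The test whether `β` implies a closed semi-interval comparison of `t` and `c`, and nothing
stronger. -/
def closedTest (β : List Comparison) (t c : QTerm) : Bool :=
  !impTest β ⟨t, .eq, c⟩ && ((impTest β ⟨t, .le, c⟩ && !impTest β ⟨t, .lt, c⟩) ||
    (impTest β ⟨t, .ge, c⟩ && !impTest β ⟨t, .gt, c⟩))

/-- The decision procedure for `IsInstance`. -/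
def instanceTest (lsi rsi : CompOp) (Q₂ Q₁ : CQAC) : Bool :=
  wellFormedTest Q₂ && wellFormedTest Q₁ && classTest lsi rsi Q₁ &&
    (Q₁.acs.all fun a => Q₁.acs.all fun b => !(a.rsiTest && b.lsiTest && decide (a.rhs = b.rhs))) &&
    Q₁.acs.all fun a => !a.openTest ||
      (acTerms Q₂.acs).all fun t => t.isConst || !closedTest Q₂.acs t a.rhs

/-- The verifier; a certificate is a list of mappings. -/
def verify (lsi rsi : CompOp) (x : (CQAC × CQAC) × BTree) : Bool :=
  instanceTest lsi rsi x.1.1 x.1.2 && containmentTest x.1.1 x.1.2 x.2.toList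

namespace PolyTime

variable {α β : Type*} [TreeCode α] [TreeCode β]

theorem headD {l : α → List β} {d : α → β} (hl : PolyTime l) (hd : PolyTime d) :
    PolyTime fun a => (l a).headD (d a) := by
  refine (foldr_of_additive (f := fun _ e _ => e) hl hd (snd (snd .id)) .codeSize
    fun a acc e => ?_).of_eq fun a => by cases l a <;> rfl
  rw [codeSize_pair]
  omega

theorem treeToList {f : α → BTree} (hf : PolyTime f) : PolyTime fun a => (f a).toList :=
  hf.recode fun a => BTree.code_toList (f a)

theorem bodyTerms {f : α → CQAC} (hf : PolyTime f) : PolyTime fun a => (f a).bodyTerms :=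
  hf.body.flatMap (f := fun _ => QAtom.args) (.args (.snd .id))

theorem terms {f : α → CQAC} (hf : PolyTime f) : PolyTime fun a => (f a).terms :=
  hf.bodyTerms.append hf.head

theorem lookupTerm {m : α → BTree} {S : α → List QTerm} {t : α → QTerm} (hm : PolyTime m)
    (hS : PolyTime S) (ht : PolyTime t) : PolyTime fun a => lookupTerm (m a) (S a) (t a) :=
  (hS.filter (p := fun a s => decide (code (t a, s) ∈ (m a).toList))
    (.decide_mem (hm.comp (fst .id)).treeToList
      (((ht.comp (fst .id)).pair (snd .id)).encode))).headD (.const _)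

theorem subst_certMapping {Q : α → CQAC} {m : α → BTree} {t : α → QTerm} (hQ : PolyTime Q)
    (hm : PolyTime m) (ht : PolyTime t) :
    PolyTime fun a => (t a).subst (certMapping (Q a) (m a)) :=
  (ht.isConst.cond ht (lookupTerm hm hQ.bodyTerms ht)).of_eq fun a => by cases t a <;> rfl

theorem siTest (o : CompOp) {f : α → Comparison} (hf : PolyTime f) :
    PolyTime fun a => (f a).siTest o :=
  .and (.and (.not hf.lhs.isConst) (hf.op.decide_eq (.const o))) hf.rhs.isConst

theorem lsiTest {f : α → Comparison} (hf : PolyTime f) : PolyTime fun a => (f a).lsiTest :=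
  .or (hf.siTest .lt) (hf.siTest .le)

theorem rsiTest {f : α → Comparison} (hf : PolyTime f) : PolyTime fun a => (f a).rsiTest :=
  .or (hf.siTest .gt) (hf.siTest .ge)

theorem openTest {f : α → Comparison} (hf : PolyTime f) : PolyTime fun a => (f a).openTest :=
  .or (hf.siTest .lt) (hf.siTest .gt)

theorem rsi {Q : α → CQAC} (hQ : PolyTime Q) : PolyTime fun a => (Q a).rsi :=
  (hQ.acs.filter (p := fun _ => Comparison.rsiTest) (rsiTest (snd .id))).headD (.const _)

protected theorem eqClass {f : α → List Comparison} {S : α → List QTerm} {t : α → QTerm}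
    (hf : PolyTime f) (hS : PolyTime S) (ht : PolyTime t) :
    PolyTime fun a => eqClass (f a) (S a) (t a) :=
  hS.filter (p := fun a s => impTest (f a) ⟨t a, .eq, s⟩)
    (.impTest (hf.comp (fst .id)) (.comparison (ht.comp (fst .id)) (.const _) (snd .id)))

section Substitution

variable {σ : α → ℕ → QTerm} {Q₂ Q₁ : α → CQAC} {f : α → List Comparison}

theorem subst_comparison (hσ : PolyTime fun x : α × QTerm => x.2.subst (σ x.1))
    {c : α → Comparison} (hc : PolyTime c) : PolyTime fun a => (c a).subst (σ a) :=
  comparison (hσ.comp (.pair .id hc.lhs)) hc.op (hσ.comp (.pair .id hc.rhs))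

theorem negatedRSI (hσ : PolyTime fun x : α × QTerm => x.2.subst (σ x.1)) (h₁ : PolyTime Q₁) :
    PolyTime fun a => (Q₁ a).negatedRSI (σ a) :=
  neg (subst_comparison hσ h₁.rsi)

protected theorem mappingTest (hσ : PolyTime fun x : α × QTerm => x.2.subst (σ x.1))
    (h₂ : PolyTime Q₂) (h₁ : PolyTime Q₁) (hf : PolyTime f) :
    PolyTime fun a => mappingTest (Q₂ a) (Q₁ a) (f a) (σ a) := by
  have hclass {t : α × QTerm → QTerm} (ht : PolyTime t) :
      PolyTime fun x => eqClass (f x.1) (Q₂ x.1).terms (t x) :=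
    .eqClass (hf.comp (fst .id)) (h₂.comp (fst .id)).terms ht
  have hatom (g : α → QTerm → List QTerm) (hg : PolyTime fun x : α × QTerm => g x.1 x.2) :
      PolyTime fun x : α × QAtom => (x.2.rel, x.2.args.map (g x.1)) :=
    .pair (.rel (snd .id)) ((args (snd .id)).map (f := fun x => g x.1)
      (hg.comp (.pair (fst (fst .id)) (snd .id))))
  have hbody₂ : PolyTime fun a => (Q₂ a).body.map fun b =>
      (b.rel, b.args.map (eqClass (f a) (Q₂ a).terms)) := h₂.body.map <|
    hatom (fun a => eqClass (f a) (Q₂ a).terms) (hclass (snd .id))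
  have hbody₁ : PolyTime fun x : α × QAtom =>
      (x.2.rel, x.2.args.map fun s => eqClass (f x.1) (Q₂ x.1).terms (s.subst (σ x.1))) :=
    hatom (fun a s => eqClass (f a) (Q₂ a).terms (s.subst (σ a))) (hclass hσ)
  have hacs : PolyTime fun x : α × Comparison =>
      x.2.rsiTest || impTest (f x.1) (x.2.subst (σ x.1)) :=
    .or (.rsiTest (snd .id)) (.impTest (hf.comp (fst .id))
      (subst_comparison (σ := fun x : α × Comparison => σ x.1)
        (hσ.comp (.pair (fst (fst .id)) (snd .id))) (snd .id)))
  exact .and (.and (h₁.body.all (.decide_mem (hbody₂.comp (fst .id)) hbody₁))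
    (.decide_eq (h₁.head.map (hclass hσ)) (h₂.head.map (hclass (snd .id))))) (h₁.acs.all hacs)

end Substitution

theorem negatedRSI_certMapping {Q₂ Q₁ : α → CQAC} {m : α → BTree} (h₂ : PolyTime Q₂)
    (h₁ : PolyTime Q₁) (hm : PolyTime m) :
    PolyTime fun a => (Q₁ a).negatedRSI (certMapping (Q₂ a) (m a)) :=
  negatedRSI (subst_certMapping (h₂.comp (fst .id)) (hm.comp (fst .id)) (snd .id)) h₁

protected theorem uncovered {Q₂ Q₁ : α → CQAC} {ms : α → List BTree} (h₂ : PolyTime Q₂)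
    (h₁ : PolyTime Q₁) (hms : PolyTime ms) : PolyTime fun a => uncovered (Q₂ a) (Q₁ a) (ms a) :=
  .append (hms.map (f := fun a m => (Q₁ a).negatedRSI (certMapping (Q₂ a) m))
    (negatedRSI_certMapping (h₂.comp (fst .id)) (h₁.comp (fst .id)) (snd .id))) h₂.acs

theorem mappingChainTest_eq_foldr (Q₂ Q₁ : CQAC) (ms : List BTree) :
    (mappingChainTest Q₂ Q₁ ms, uncovered Q₂ Q₁ ms) =
      ms.foldr (fun m x => (mappingTest Q₂ Q₁ x.2 (certMapping Q₂ m) && x.1,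
        Q₁.negatedRSI (certMapping Q₂ m) :: x.2)) (true, Q₂.acs) := by
  induction ms with
  | nil => rfl
  | cons m ms ih => rw [List.foldr_cons, ← ih]; rfl

protected theorem mappingChainTest {Q₂ Q₁ : α → CQAC} {ms : α → List BTree} (h₂ : PolyTime Q₂)
    (h₁ : PolyTime Q₁) (hms : PolyTime ms) :
    PolyTime fun a => mappingChainTest (Q₂ a) (Q₁ a) (ms a) := by
  have htest : PolyTime fun x : α × (Bool × List Comparison) × BTree =>
      mappingTest (Q₂ x.1) (Q₁ x.1) x.2.1.2 (certMapping (Q₂ x.1) x.2.2) :=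
    .mappingTest (subst_certMapping (h₂.comp (fst (fst .id))) (snd (snd (fst .id))) (snd .id))
      (h₂.comp (fst .id)) (h₁.comp (fst .id)) (snd (fst (snd .id)))
  have hneg : PolyTime fun x : α × BTree => (Q₁ x.1).negatedRSI (certMapping (Q₂ x.1) x.2) :=
    negatedRSI_certMapping (h₂.comp (fst .id)) (h₁.comp (fst .id)) (snd .id)
  have hneg' : PolyTime fun x : α × (Bool × List Comparison) × BTree =>
      (Q₁ x.1).negatedRSI (certMapping (Q₂ x.1) x.2.2) :=
    negatedRSI_certMapping (h₂.comp (fst .id)) (h₁.comp (fst .id)) (snd (snd .id))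
  refine fst (.of_eq (foldr_of_additive
    (f := fun a m x => (mappingTest (Q₂ a) (Q₁ a) x.2 (certMapping (Q₂ a) m) && x.1,
      (Q₁ a).negatedRSI (certMapping (Q₂ a) m) :: x.2)) hms (.pair (.const true) h₂.acs)
    (.pair (.and htest (fst (fst (snd .id)))) (.cons hneg' (snd (fst (snd .id)))))
    (hneg.polyBounded.add (.const 4)) fun a x m => ?_)
    fun a => mappingChainTest_eq_foldr (Q₂ a) (Q₁ a) (ms a))
  have hbool := codeSize_bool_le (mappingTest (Q₂ a) (Q₁ a) x.2 (certMapping (Q₂ a) m) && x.1)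
  have hx : codeSize x = codeSize x.1 + codeSize x.2 + 1 := rfl
  rw [codeSize_pair, codeSize_cons, hx]
  dsimp only
  omega

protected theorem containmentTest {Q₂ Q₁ : α → CQAC} {ms : α → List BTree} (h₂ : PolyTime Q₂)
    (h₁ : PolyTime Q₁) (hms : PolyTime ms) :
    PolyTime fun a => containmentTest (Q₂ a) (Q₁ a) (ms a) :=
  .and (.mappingChainTest h₂ h₁ hms) (.not (.satTest (.uncovered h₂ h₁ hms)))

protected theorem wellFormedTest {Q : α → CQAC} (hQ : PolyTime Q) :
    PolyTime fun a => wellFormedTest (Q a) :=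
  have hsafe : PolyTime fun x : α × QTerm =>
      x.2.isConst || decide (x.2 ∈ (Q x.1).bodyTerms) :=
    .or (.isConst (snd .id)) (.decide_mem (hQ.comp (fst .id)).bodyTerms (snd .id))
  .and (.and (.and (hQ.head.all hsafe) (hQ.acs.all (p := fun _ c => !c.lhs.isConst)
    (.not (.isConst (.lhs (snd .id)))))) (hQ.acs.acTerms.all hsafe)) hQ.acs.satTest

protected theorem classTest (lsi rsi : CompOp) {Q : α → CQAC} (hQ : PolyTime Q) :
    PolyTime fun a => classTest lsi rsi (Q a) :=
  .and (hQ.acs.all (p := fun _ c => c.siTest lsi || c.siTest rsi || decide (c.op = .eq))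
      (.or (.or (siTest lsi (snd .id)) (siTest rsi (snd .id)))
        (.decide_eq (.op (snd .id)) (.const _))))
    (.decide_eq (.tail (hQ.acs.filter (p := fun _ => Comparison.rsiTest) (rsiTest (snd .id))))
      (.const []))

protected theorem closedTest {f : α → List Comparison} {t c : α → QTerm} (hf : PolyTime f)
    (ht : PolyTime t) (hc : PolyTime c) : PolyTime fun a => closedTest (f a) (t a) (c a) :=
  have h (o : CompOp) : PolyTime fun a => impTest (f a) ⟨t a, o, c a⟩ :=
    .impTest hf (comparison ht (.const o) hc)
  .and (h .eq).not (.or (.and (h .le) (h .lt).not) (.and (h .ge) (h .gt).not))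

protected theorem instanceTest (lsi rsi : CompOp) {Q₂ Q₁ : α → CQAC} (h₂ : PolyTime Q₂)
    (h₁ : PolyTime Q₁) : PolyTime fun a => instanceTest lsi rsi (Q₂ a) (Q₁ a) := by
  have hrsi : PolyTime fun x : α × Comparison => (Q₁ x.1).acs.all fun b =>
      !(x.2.rsiTest && b.lsiTest && decide (x.2.rhs = b.rhs)) :=
    (h₁.comp (fst .id)).acs.all (p := fun (x : α × Comparison) b =>
      !(x.2.rsiTest && b.lsiTest && decide (x.2.rhs = b.rhs)))
      (.not (.and (.and (rsiTest (snd (fst .id))) (lsiTest (snd .id)))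
        (.decide_eq (.rhs (snd (fst .id))) (.rhs (snd .id)))))
  have hopen : PolyTime fun x : α × Comparison => !x.2.openTest ||
      (acTerms (Q₂ x.1).acs).all fun t => t.isConst || !closedTest (Q₂ x.1).acs t x.2.rhs :=
    .or (.not (openTest (snd .id))) ((h₂.comp (fst .id)).acs.acTerms.all
      (p := fun (x : α × Comparison) t => t.isConst || !closedTest (Q₂ x.1).acs t x.2.rhs)
      (.or (.isConst (snd .id)) (.not (.closedTest (h₂.comp (fst (fst .id))).acs (snd .id)
        (.rhs (snd (fst .id)))))))
  exact .and (.and (.and (.and h₂.wellFormedTest h₁.wellFormedTest) (h₁.classTest lsi rsi))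
    (h₁.acs.all hrsi)) (h₁.acs.all hopen)

protected theorem verify (lsi rsi : CompOp) : PolyTime (verify lsi rsi) :=
  .and (.instanceTest lsi rsi (fst (fst .id)) (snd (fst .id)))
    (.containmentTest (fst (fst .id)) (snd (fst .id)) (.treeToList (snd .id)))

end PolyTime

/-! ### Correctness of the test for instances -/

theorem Comparison.siTest_iff {o : CompOp} {a : Comparison} :
    a.siTest o = true ↔ ∃ c, a.IsSI o c := by
  obtain ⟨l, o', r⟩ := a
  cases l <;> cases r <;> simp [siTest, IsSI, QTerm.isConst]

theorem Comparison.rsiTest_iff {a : Comparison} : a.rsiTest = true ↔ ∃ c, a.IsRSI c := by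
  simp only [rsiTest, Bool.or_eq_true, siTest_iff, IsRSI, exists_or]

theorem Comparison.lsiTest_iff {a : Comparison} : a.lsiTest = true ↔ ∃ c, a.IsLSI c := by
  simp only [lsiTest, Bool.or_eq_true, siTest_iff, IsLSI, exists_or]

theorem Comparison.openTest_iff {a : Comparison} : a.openTest = true ↔ ∃ c, a.IsOpenSI c := by
  simp only [openTest, Bool.or_eq_true, siTest_iff, IsOpenSI, exists_or]

theorem Comparison.IsSI.rhs_eq {a : Comparison} {o : CompOp} {c : ℚ} (h : a.IsSI o c) :
    a.rhs = .const c := by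
  obtain ⟨x, rfl⟩ := h
  rfl

theorem Comparison.IsRSI.rhs_eq {a : Comparison} {c : ℚ} (h : a.IsRSI c) : a.rhs = .const c :=
  h.elim IsSI.rhs_eq IsSI.rhs_eq

theorem Comparison.IsLSI.rhs_eq {a : Comparison} {c : ℚ} (h : a.IsLSI c) : a.rhs = .const c :=
  h.elim IsSI.rhs_eq IsSI.rhs_eq

theorem Comparison.IsOpenSI.rhs_eq {a : Comparison} {c : ℚ} (h : a.IsOpenSI c) :
    a.rhs = .const c :=
  h.elim IsSI.rhs_eq IsSI.rhs_eq

theorem isConst_or_mem_bodyTerms_iff {Q : CQAC} {t : QTerm} :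
    (t.isConst || decide (t ∈ Q.bodyTerms)) = true ↔ ∀ x, t = .var x → Q.InBody x := by
  cases t <;> simp [QTerm.isConst, CQAC.mem_bodyTerms, CQAC.InBody]

theorem classTest_iff {lsi rsi : CompOp} {Q : CQAC} :
    classTest lsi rsi Q = true ↔ InClassRSI1 lsi rsi Q := by
  classical
  have hcount : (Q.acs.filter Comparison.rsiTest).tail = [] ↔
      Q.acs.countP (fun a => decide (∃ c, a.IsRSI c)) ≤ 1 := by
    have hrsi : Comparison.rsiTest = fun a => decide (∃ c, a.IsRSI c) :=
      funext fun a => Bool.eq_iff_iff.2 (a.rsiTest_iff.trans decide_eq_true_iff.symm)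
    rw [← hrsi, List.countP_eq_length_filter, ← List.length_eq_zero_iff, List.length_tail]
    omega
  rw [classTest, Bool.and_eq_true, decide_eq_true_iff, hcount, InClassRSI1]
  simp only [List.all_eq_true, Bool.or_eq_true, Comparison.siTest_iff, decide_eq_true_iff,
    or_assoc]

theorem allHold_of_forall_var {D : Type*} [LinearOrder D] {ι : ℚ ↪o D} {β : List Comparison}
    {u v : ℕ → D} (hu : AllHold ι u β) (h : ∀ x, .var x ∈ acTerms β → v x = u x) :
    AllHold ι v β := by
  have hval : ∀ t ∈ acTerms β, t.val ι v = t.val ι u := by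
    rintro (x | c) ht
    exacts [h x ht, rfl]
  intro a ha
  rw [Comparison.Holds, hval _ (lhs_mem_acTerms ha), hval _ (rhs_mem_acTerms ha)]
  exact hu a ha

section InstanceTest

variable {D : Type*} [LinearOrder D] [NoMinOrder D] [NoMaxOrder D] {ι : ℚ ↪o D}

theorem var_mem_acTerms_of_implied {β : List Comparison} (hβ : Satisfiable ι β) {x : ℕ} {c : ℚ}
    (h : Implied ι β ⟨.var x, .le, .const c⟩ ∨ Implied ι β ⟨.var x, .ge, .const c⟩) :
    QTerm.var x ∈ acTerms β := by
  by_contra hx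
  obtain ⟨v, hv⟩ := hβ
  have hupdate (d : D) : AllHold ι (Function.update v x d) β :=
    allHold_of_forall_var hv fun y hy => Function.update_of_ne (fun h : y = x => hx (h ▸ hy)) _ _
  obtain ⟨d, hd⟩ := exists_gt (ι c)
  obtain ⟨e, he⟩ := exists_lt (ι c)
  rcases h with h | h
  · have hle : Function.update v x d x ≤ ι c := h _ (hupdate d)
    exact (Function.update_self x d v ▸ hle).not_gt hd
  · have hge : ι c ≤ Function.update v x e x := h _ (hupdate e)
    exact (Function.update_self x e v ▸ hge).not_gt he

variable [DenselyOrdered D]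

theorem wellFormedTest_iff (ι : ℚ ↪o D) {Q : CQAC} :
    wellFormedTest Q = true ↔ Q.WellFormed ι := by
  have hlhs (a : Comparison) : (!a.lhs.isConst) = true ↔ ∃ x, a.lhs = .var x := by
    cases a.lhs <;> simp [QTerm.isConst]
  simp only [wellFormedTest, Bool.and_eq_true, List.all_eq_true, isConst_or_mem_bodyTerms_iff,
    satTest_iff ι, hlhs]
  constructor
  · rintro ⟨⟨⟨hhead, hvar⟩, hacs⟩, hsat⟩
    exact ⟨fun x hx => hhead _ hx x rfl, hvar, fun a ha x hx => hx.elim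
      (hacs _ (lhs_mem_acTerms ha) x) (hacs _ (rhs_mem_acTerms ha) x), hsat⟩
  · rintro ⟨hhead, hvar, hacs, hsat⟩
    refine ⟨⟨⟨fun t ht x hx => hhead x (hx ▸ ht), hvar⟩, fun t ht x hx => ?_⟩, hsat⟩
    obtain ⟨a, ha, hat⟩ := mem_acTerms.1 ht
    exact hacs a ha x (hx ▸ hat.imp Eq.symm Eq.symm)

theorem closedTest_iff (ι : ℚ ↪o D) {β : List Comparison} {t c : QTerm} :
    closedTest β t c = true ↔ ¬ Implied ι β ⟨t, .eq, c⟩ ∧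
      ((Implied ι β ⟨t, .le, c⟩ ∧ ¬ Implied ι β ⟨t, .lt, c⟩) ∨
        (Implied ι β ⟨t, .ge, c⟩ ∧ ¬ Implied ι β ⟨t, .gt, c⟩)) := by
  simp only [closedTest, Bool.and_eq_true, Bool.or_eq_true, Bool.not_eq_true',
    ← Bool.not_eq_true (impTest _ _), impTest_iff ι]

theorem all_not_closedTest_iff {β : List Comparison} (hβ : Satisfiable ι β) {c : ℚ} :
    ((acTerms β).all fun t => t.isConst || !closedTest β t (.const c)) = true ↔
      ¬ InClosedSI ι β c := by
  simp only [List.all_eq_true, InClosedSI, not_exists, ← closedTest_iff]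
  constructor
  · intro h x hx
    have himp := ((closedTest_iff ι).1 hx).2.imp And.left And.left
    have hopen := h (.var x) (var_mem_acTerms_of_implied hβ himp)
    rw [hx] at hopen
    exact Bool.false_ne_true hopen
  · rintro h (x | d) -
    · simpa only [QTerm.isConst, Bool.false_or, Bool.not_eq_true'] using eq_false_of_ne_true (h x)
    · rfl

theorem instanceTest_iff (ι : ℚ ↪o D) {lsi rsi : CompOp} {Q₂ Q₁ : CQAC} :
    instanceTest lsi rsi Q₂ Q₁ = true ↔ IsInstance ι lsi rsi Q₂ Q₁ := by
  have hdisj (a b : Comparison) : (!(a.rsiTest && b.lsiTest && decide (a.rhs = b.rhs))) = true ↔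
      ∀ c d, a.IsRSI c → b.IsLSI d → c ≠ d := by
    rw [Bool.not_eq_true', ← Bool.not_eq_true, Bool.and_eq_true, Bool.and_eq_true,
      Comparison.rsiTest_iff, Comparison.lsiTest_iff, decide_eq_true_iff]
    constructor
    · rintro h c d hc hd rfl
      exact h ⟨⟨⟨c, hc⟩, c, hd⟩, hc.rhs_eq.trans hd.rhs_eq.symm⟩
    · rintro h ⟨⟨⟨c, hc⟩, d, hd⟩, heq⟩
      exact h c d hc hd (QTerm.const.inj (hc.rhs_eq.symm.trans (heq.trans hd.rhs_eq)))
  have hopen (hβ : Satisfiable ι Q₂.acs) (a : Comparison) : (!a.openTest || (acTerms Q₂.acs).all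
      fun t => t.isConst || !closedTest Q₂.acs t a.rhs) = true ↔
        ∀ c, a.IsOpenSI c → ¬ InClosedSI ι Q₂.acs c := by
    rw [Bool.or_eq_true, Bool.not_eq_true', ← Bool.not_eq_true, Comparison.openTest_iff,
      ← imp_iff_not_or, forall_exists_index]
    refine forall₂_congr fun c hc => ?_
    rw [hc.rhs_eq, all_not_closedTest_iff hβ]
  simp only [instanceTest, Bool.and_eq_true, List.all_eq_true, wellFormedTest_iff ι,
    classTest_iff, hdisj]
  constructor
  · rintro ⟨⟨⟨⟨h₂, h₁⟩, hclass⟩, hne⟩, hoc⟩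
    exact ⟨h₂, h₁, hclass, hne, fun a ha => (hopen h₂.consistent a).1 (hoc a ha)⟩
  · rintro ⟨h₂, h₁, hclass, hne, hoc⟩
    exact ⟨⟨⟨⟨h₂, h₁⟩, hclass⟩, hne⟩, fun a ha => (hopen h₂.consistent a).2 (hoc a ha)⟩

end InstanceTest

/-! ### Correctness of the containment test -/

section ContainmentTest

variable {D : Type*} [LinearOrder D] {ι : ℚ ↪o D} {Q₂ Q₁ : CQAC} {lsi rsi : CompOp}

theorem CQAC.rsi_eq_or_mem (Q : CQAC) :
    Q.rsi = ⟨.const 0, .eq, .const 0⟩ ∨ Q.rsi ∈ Q.acs ∧ Q.rsi.rsiTest = true := by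
  rw [rsi]
  rcases h : Q.acs.filter Comparison.rsiTest with _ | ⟨a, l⟩
  · exact .inl rfl
  · have ha : a ∈ Q.acs.filter Comparison.rsiTest := h ▸ List.mem_cons_self
    exact .inr (List.mem_filter.1 ha)

theorem InClassRSI1.eq_rsi {Q : CQAC} (hQ : InClassRSI1 lsi rsi Q) {a : Comparison}
    (ha : a ∈ Q.acs) (hra : a.rsiTest = true) : a = Q.rsi := by
  have hclass := classTest_iff.2 hQ
  rw [classTest, Bool.and_eq_true, decide_eq_true_iff] at hclass
  have htail := hclass.2
  have hmem : a ∈ Q.acs.filter Comparison.rsiTest := List.mem_filter.2 ⟨ha, hra⟩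
  rw [CQAC.rsi]
  generalize Q.acs.filter Comparison.rsiTest = l at hmem htail
  rcases l with _ | ⟨b, l⟩
  · exact absurd hmem List.not_mem_nil
  · obtain rfl : l = [] := htail
    exact List.mem_singleton.1 hmem

theorem CQAC.holds_rsi {Q : CQAC} {u : ℕ → D} (hu : AllHold ι u Q.acs) : Q.rsi.Holds ι u := by
  rcases Q.rsi_eq_or_mem with h | h
  · rw [h]
    exact (rfl : ι 0 = ι 0)
  · exact hu _ h.1

theorem CQAC.negatedRSI_holds {Q : CQAC} {σ : ℕ → QTerm} {v : ℕ → D} :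
    (Q.negatedRSI σ).Holds ι v ↔ ¬ Q.rsi.Holds ι fun x => (σ x).val ι v := by
  rw [negatedRSI, Comparison.neg_holds, Comparison.holds_subst]

theorem allHold_uncovered_cons {m : BTree} {ms : List BTree} {v : ℕ → D} :
    AllHold ι v (uncovered Q₂ Q₁ (m :: ms)) ↔
      (¬ Q₁.rsi.Holds ι fun x => (certMapping Q₂ m x).val ι v) ∧
        AllHold ι v (uncovered Q₂ Q₁ ms) :=
  allHold_cons.trans (and_congr_left' CQAC.negatedRSI_holds)

theorem rel_shiftedVal_negatedRSI {β : List Comparison} {φ : D → D}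
    (hφ : ∀ a ∈ Q₁.acs, ∀ c, a.IsSI .gt c → φ (ι c) < ι c) {σ : ℕ → QTerm} {v : ℕ → D}
    (hv : (Q₁.negatedRSI σ).Holds ι v)
    (htie : (Q₁.negatedRSI σ).lhs.val ι v = (Q₁.negatedRSI σ).rhs.val ι v) :
    (Q₁.negatedRSI σ).op.Rel (shiftedVal ι β φ v (Q₁.negatedRSI σ).lhs)
      (shiftedVal ι β φ v (Q₁.negatedRSI σ).rhs) := by
  rw [CQAC.negatedRSI] at hv htie ⊢
  rcases Q₁.rsi_eq_or_mem with h | ⟨hmem, hrsi⟩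
  · rw [h] at hv
    exact absurd rfl hv
  · obtain ⟨c, hc⟩ := Comparison.rsiTest_iff.1 hrsi
    rcases hc with ⟨x, hx⟩ | ⟨x, hx⟩
    · rw [hx] at htie ⊢
      change (σ x).val ι v = ι c at htie
      change shiftedVal ι β φ v (σ x) ≤ shiftedVal ι β φ v (.const c)
      rw [shiftedVal, shiftedVal, if_pos (forced_const β c)]
      split_ifs
      · exact htie.le
      · rw [htie]
        exact (hφ _ hmem c ⟨x, hx⟩).le
    · rw [hx] at hv htie
      exact absurd htie (show (σ x).val ι v < ι c from hv).ne

theorem CQAC.WellFormed.inBody_of_mem {Q : CQAC} (hQ : Q.WellFormed ι) {x : ℕ}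
    (hx : .var x ∈ Q.terms ++ acTerms Q.acs) : Q.InBody x := by
  rcases List.mem_append.1 hx with hx | hx
  · exact (List.mem_append.1 hx).elim CQAC.mem_bodyTerms.1 (hQ.head_safe x)
  · obtain ⟨a, ha, hxa⟩ := mem_acTerms.1 hx
    exact hQ.acs_safe a ha x (hxa.imp Eq.symm Eq.symm)

theorem IsMatch.of_forall_var {u u' v : ℕ → D} (h : IsMatch ι Q₁ u Q₂ v)
    (hu : ∀ x, .var x ∈ Q₁.terms → u' x = u x) : IsMatch ι Q₁ u' Q₂ v := by
  have hval : ∀ t ∈ Q₁.terms, t.val ι u' = t.val ι u := by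
    rintro (x | c) ht
    exacts [hu x ht, rfl]
  refine ⟨fun a ha => ?_, (List.map_congr_left fun t ht =>
    hval t (List.mem_append_right _ ht)).trans h.2⟩
  have hargs : a.args.map (QTerm.val ι u') = a.args.map (QTerm.val ι u) :=
    List.map_congr_left fun t ht =>
      hval t (List.mem_append_left _ (CQAC.mem_bodyTerms.2 ⟨a, ha, ht⟩))
  rw [QAtom.toFact, hargs]
  exact h.1 a ha

/-- The certificate for the mapping of the terms in `l` by `τ`. -/
def mappingCode (l : List QTerm) (τ : QTerm → QTerm) : BTree := code (l.map fun s => (s, τ s))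

/-- The tree encodes a mapping of the terms in the subgoals of `Q₁` to those in the subgoals of
`Q₂`. -/
def IsMappingCode (Q₂ Q₁ : CQAC) (m : BTree) : Prop :=
  ∃ τ : QTerm → QTerm, (∀ s ∈ Q₁.bodyTerms, τ s ∈ Q₂.bodyTerms) ∧ m = mappingCode Q₁.bodyTerms τ

theorem lookupTerm_mappingCode {l S : List QTerm} {τ : QTerm → QTerm} {s : QTerm} (hs : s ∈ l)
    (hτ : τ s ∈ S) : lookupTerm (mappingCode l τ) S s = τ s := by
  have hmem (t : QTerm) : code (s, t) ∈ (mappingCode l τ).toList ↔ t = τ s := by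
    rw [mappingCode, BTree.toList_code, List.mem_map_of_injective code_injective]
    exact List.mem_map.trans ⟨fun ⟨r, _, hr⟩ => by cases hr; rfl, fun ht => ⟨s, hs, by rw [ht]⟩⟩
  obtain ⟨n, hn⟩ := Nat.exists_eq_succ_of_ne_zero (List.count_pos_iff.2 hτ).ne'
  simp only [lookupTerm, hmem, List.filter_eq, hn, List.replicate_succ, List.headD_cons]

theorem IsMappingCode.certMapping_mem {m : BTree} (hm : IsMappingCode Q₂ Q₁ m) {x : ℕ}
    (hx : Q₁.InBody x) : certMapping Q₂ m x ∈ Q₂.bodyTerms := by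
  obtain ⟨τ, hτ, rfl⟩ := hm
  have hx := CQAC.mem_bodyTerms.2 hx
  rw [certMapping, lookupTerm_mappingCode hx (hτ _ hx)]
  exact hτ _ hx

theorem IsMatch.exists_isMappingCode {u v : ℕ → D} (h : IsMatch ι Q₁ u Q₂ v) :
    ∃ m, IsMappingCode Q₂ Q₁ m ∧ ∀ x, Q₁.InBody x → (certMapping Q₂ m x).val ι v = u x := by
  choose! τ hτ hval using fun s (hs : s ∈ Q₁.bodyTerms) => h.exists_bodyTerm hs
  refine ⟨mappingCode Q₁.bodyTerms τ, ⟨τ, hτ, rfl⟩, fun x hx => ?_⟩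
  have hx := CQAC.mem_bodyTerms.2 hx
  rw [certMapping, lookupTerm_mappingCode hx (hτ _ hx)]
  exact (hval _ hx).symm

/-- The possible negated images of the right semi-interval comparison of `Q₁` under mappings to the
terms in the subgoals of `Q₂`. -/
def negatedRSICandidates (Q₂ Q₁ : CQAC) : List Comparison :=
  (.const 0 :: Q₂.bodyTerms).map fun t => ⟨t, Q₁.rsi.op.neg, Q₁.rsi.rhs⟩

theorem IsMappingCode.negatedRSI_mem {m : BTree} (hm : IsMappingCode Q₂ Q₁ m)
    (hQ : Q₁.WellFormed ι) :
    Q₁.negatedRSI (certMapping Q₂ m) ∈ negatedRSICandidates Q₂ Q₁ := by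
  rcases Q₁.rsi_eq_or_mem with h | ⟨hmem, hrsi⟩
  · rw [CQAC.negatedRSI, negatedRSICandidates, h]
    exact List.mem_cons_self
  · obtain ⟨c, hc⟩ := Comparison.rsiTest_iff.1 hrsi
    obtain ⟨x, o, hx⟩ : ∃ x o, Q₁.rsi = ⟨.var x, o, .const c⟩ :=
      hc.elim (fun ⟨x, hx⟩ => ⟨x, _, hx⟩) fun ⟨x, hx⟩ => ⟨x, _, hx⟩
    have hxbody : Q₁.InBody x := hQ.acs_safe _ hmem x (.inl (by rw [hx]))
    rw [CQAC.negatedRSI, negatedRSICandidates, hx]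
    exact List.mem_map.2 ⟨_, List.mem_cons_of_mem _ (hm.certMapping_mem hxbody), rfl⟩

variable [DenselyOrdered D] [NoMinOrder D] [NoMaxOrder D]

theorem eqClass_eq_iff (ι : ℚ ↪o D) {β : List Comparison} {S : List QTerm} {s t : QTerm}
    (ht : t ∈ S) : eqClass β S s = eqClass β S t ↔ Implied ι β ⟨s, .eq, t⟩ := by
  constructor
  · intro h
    have hmem : t ∈ eqClass β S t := List.mem_filter.2 ⟨ht, (impTest_iff ι).2 fun _ _ => rfl⟩
    rw [← h] at hmem
    exact (impTest_iff ι).1 (List.mem_filter.1 hmem).2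
  · refine fun h => List.filter_congr fun r _ => Bool.eq_iff_iff.2 ?_
    rw [impTest_iff ι, impTest_iff ι]
    exact ⟨fun h' v hv => (h v hv).symm.trans (h' v hv), fun h' v hv => (h v hv).trans (h' v hv)⟩

theorem mappingTest_iff (ι : ℚ ↪o D) {β : List Comparison} {σ : ℕ → QTerm} :
    mappingTest Q₂ Q₁ β σ = true ↔
      (∀ a ∈ Q₁.body, ∃ b ∈ Q₂.body, b.rel = a.rel ∧
        b.args.map (eqClass β Q₂.terms) =
          a.args.map fun s => eqClass β Q₂.terms (s.subst σ)) ∧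
      Q₁.head.map (fun s => eqClass β Q₂.terms (s.subst σ)) =
        Q₂.head.map (eqClass β Q₂.terms) ∧
      ∀ a ∈ Q₁.acs, a.rsiTest = true ∨ Implied ι β (a.subst σ) := by
  simp only [mappingTest, Bool.and_eq_true, List.all_eq_true, decide_eq_true_eq, List.mem_map,
    Bool.or_eq_true, impTest_iff ι, Prod.mk.injEq, and_assoc]

theorem isMatch_of_mappingTest {β : List Comparison} {σ : ℕ → QTerm}
    (h : mappingTest Q₂ Q₁ β σ = true) {v : ℕ → D} (hv : AllHold ι v β) :
    IsMatch ι Q₁ (fun x => (σ x).val ι v) Q₂ v := by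
  obtain ⟨hbody, hhead, -⟩ := (mappingTest_iff ι).1 h
  have hval {s t : QTerm} (ht : t ∈ Q₂.terms)
      (hst : eqClass β Q₂.terms (s.subst σ) = eqClass β Q₂.terms t) :
      s.val ι (fun x => (σ x).val ι v) = t.val ι v :=
    QTerm.val_subst.symm.trans ((eqClass_eq_iff ι ht).1 hst v hv)
  refine ⟨fun a ha => ?_,
    map_eq_map_of_imp hhead fun s _ t ht => hval (List.mem_append_right _ ht)⟩
  obtain ⟨b, hb, hrel, hargs⟩ := hbody a ha
  exact ⟨b, hb, Prod.ext hrel.symm (map_eq_map_of_imp hargs.symm fun s _ t ht =>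
    hval (List.mem_append_left _ (CQAC.mem_bodyTerms.2 ⟨b, hb, ht⟩)))⟩

theorem allHold_of_mappingTest (hQ : InClassRSI1 lsi rsi Q₁) {β : List Comparison}
    {σ : ℕ → QTerm} (h : mappingTest Q₂ Q₁ β σ = true) {v : ℕ → D} (hv : AllHold ι v β)
    (hrsi : Q₁.rsi.Holds ι fun x => (σ x).val ι v) :
    AllHold ι (fun x => (σ x).val ι v) Q₁.acs := by
  intro a ha
  rcases ((mappingTest_iff ι).1 h).2.2 a ha with hra | himp
  · rwa [hQ.eq_rsi ha hra]
  · exact Comparison.holds_subst.1 (himp v hv)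

theorem allHold_uncovered_or_exists_isMatch (hQ : InClassRSI1 lsi rsi Q₁) {ms : List BTree}
    (hms : mappingChainTest Q₂ Q₁ ms = true) {v : ℕ → D} (hv : AllHold ι v Q₂.acs) :
    AllHold ι v (uncovered Q₂ Q₁ ms) ∨ ∃ u, IsMatch ι Q₁ u Q₂ v ∧ AllHold ι u Q₁.acs := by
  induction ms with
  | nil => exact .inl hv
  | cons m ms ih =>
    rw [mappingChainTest, Bool.and_eq_true] at hms
    refine (ih hms.2).elim (fun hunc => ?_) .inr
    by_cases hrsi : Q₁.rsi.Holds ι fun x => (certMapping Q₂ m x).val ι v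
    · exact .inr ⟨_, isMatch_of_mappingTest hms.1 hunc,
        allHold_of_mappingTest hQ hms.1 hunc hrsi⟩
    · exact .inl (allHold_uncovered_cons.2 ⟨hrsi, hunc⟩)

theorem contained_of_containmentTest (hQ : InClassRSI1 lsi rsi Q₁) {ms : List BTree}
    (h : containmentTest Q₂ Q₁ ms = true) : Contained ι Q₂ Q₁ := by
  rw [containmentTest, Bool.and_eq_true, Bool.not_eq_true', ← Bool.not_eq_true, satTest_iff ι] at h
  exact contained_iff.2 fun v hv =>
    (allHold_uncovered_or_exists_isMatch hQ h.1 hv).resolve_left fun hunc => h.2 ⟨v, hunc⟩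

theorem implied_lt_or_eq_of_implied_le {β N : List Comparison} {φ : D → D}
    (hφ : ∀ c, InClosedSI ι β c → φ (ι c) = ι c)
    (hN : ∀ b ∈ N, ∀ v, b.Holds ι v → b.lhs.val ι v = b.rhs.val ι v →
      b.op.Rel (shiftedVal ι β φ v b.lhs) (shiftedVal ι β φ v b.rhs))
    {t : QTerm} {c : ℚ} (hc : ι c < φ (ι c)) (hle : Implied ι (N ++ β) ⟨t, .le, .const c⟩) :
    Implied ι (N ++ β) ⟨t, .lt, .const c⟩ ∨ Implied ι (N ++ β) ⟨t, .eq, .const c⟩ := by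
  by_contra hcon
  rw [not_or, Implied, Implied] at hcon
  push Not at hcon
  obtain ⟨⟨v, hv, hlt⟩, u, hu, hne⟩ := hcon
  have htc : t.val ι v = ι c := (hle v hv : t.val ι v ≤ ι c).eq_of_not_lt hlt
  have hvβ : AllHold ι v β := fun b hb => hv b (List.mem_append_right _ hb)
  have hforced : ¬ Forced ι β t := by
    rintro ⟨d, hd⟩
    have hud : t.val ι u = ι d := hd u fun b hb => hu b (List.mem_append_right _ hb)
    exact hne (hud.trans ((hd v hvβ).symm.trans htc))
  obtain ⟨w, hw⟩ := exists_refines ι (acTerms (N ++ β) ++ [t, .const c]) v (shiftedVal ι β φ v)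
  have hwNβ : AllHold ι w (N ++ β) := hw.allHold (List.subset_append_left _ _) hv fun b hb =>
    (List.mem_append.1 hb).elim (fun hbN => hN b hbN v (hv b hb)) fun hbβ =>
      rel_shiftedVal hφ hvβ hbβ
  have hgt : (QTerm.const c).val ι w < t.val ι w := by
    refine (hw.lt_iff (List.mem_append_right _ (by simp)) (List.mem_append_right _ (by simp))).2
      (.inr ⟨htc.symm, ?_⟩)
    rwa [shiftedVal, shiftedVal, if_pos (forced_const β c), if_neg hforced, htc]
  exact (hle w hwNβ : t.val ι w ≤ ι c).not_gt hgt

theorem mappingTest_of_isMatch {β : List Comparison} {S : List QTerm} {v : ℕ → D}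
    (hsep : Separates ι β S v) (hS : Q₂.terms ⊆ S) {σ : ℕ → QTerm}
    (hσ : ∀ s ∈ Q₁.terms, s.subst σ ∈ S) (h : IsMatch ι Q₁ (fun x => (σ x).val ι v) Q₂ v)
    (hacs : ∀ a ∈ Q₁.acs, a.rsiTest = true ∨ Implied ι β (a.subst σ)) :
    mappingTest Q₂ Q₁ β σ = true := by
  have hclass {s t : QTerm} (hs : s ∈ Q₁.terms) (ht : t ∈ Q₂.terms)
      (hst : s.val ι (fun x => (σ x).val ι v) = t.val ι v) :
      eqClass β Q₂.terms (s.subst σ) = eqClass β Q₂.terms t :=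
    (eqClass_eq_iff ι ht).2 (hsep _ (hσ s hs) t (hS ht) (QTerm.val_subst.trans hst))
  refine (mappingTest_iff ι).2 ⟨fun a ha => ?_, map_eq_map_of_imp h.2 fun s hs t ht =>
    hclass (List.mem_append_right _ hs) (List.mem_append_right _ ht), hacs⟩
  obtain ⟨b, hb, hab⟩ := h.1 a ha
  have hargs := map_eq_map_of_imp (congrArg Prod.snd hab) fun s hs t ht =>
    hclass (List.mem_append_left _ (CQAC.mem_bodyTerms.2 ⟨a, ha, hs⟩))
      (List.mem_append_left _ (CQAC.mem_bodyTerms.2 ⟨b, hb, ht⟩))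
  exact ⟨b, hb, (congrArg Prod.fst hab).symm, hargs.symm⟩

theorem IsInstance.rsiTest_or_implied_subst (hlsi : lsi = .le ∨ lsi = .lt)
    (hrsi : rsi = .ge ∨ rsi = .gt) (h : IsInstance ι lsi rsi Q₂ Q₁) {ms : List BTree}
    {σ : ℕ → QTerm} {S : List QTerm} {v : ℕ → D} (hv : AllHold ι v (uncovered Q₂ Q₁ ms))
    (hsep : Separates ι (uncovered Q₂ Q₁ ms) S v)
    (hle : ∀ s ∈ S, ∀ c, .const c ∈ S → s.val ι v ≤ ι c →
      Implied ι (uncovered Q₂ Q₁ ms) ⟨s, .le, .const c⟩)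
    (hσ : ∀ s ∈ acTerms Q₁.acs, s.subst σ ∈ S)
    (hu : AllHold ι (fun x => (σ x).val ι v) Q₁.acs) {a : Comparison} (ha : a ∈ Q₁.acs) :
    a.rsiTest = true ∨ Implied ι (uncovered Q₂ Q₁ ms) (a.subst σ) := by
  have hlS := hσ _ (lhs_mem_acTerms ha)
  have hrS := hσ _ (rhs_mem_acTerms ha)
  have hua := hu a ha
  rcases h.inClass.1 a ha with ⟨c, x, rfl⟩ | ⟨c, hac⟩ | heq
  · right
    change lsi.Rel ((σ x).val ι v) (ι c) at hua
    have himp := hle (σ x) hlS c hrS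
    rcases hlsi with rfl | rfl
    · exact himp hua
    obtain ⟨φ, hφ, hφlt, hφgt⟩ := exists_shift (D := D) (ι := ι) h.not_isSI_lt
    refine (implied_lt_or_eq_of_implied_le (β := Q₂.acs) (φ := φ)
      (fun d hd => hφ d fun b hb hbd => h.open_closed b hb d hbd hd) (fun b hb w hw htie => ?_)
      (hφlt _ ha c ⟨x, rfl⟩) (himp (le_of_lt hua))).resolve_right fun h' => hua.ne (h' v hv)
    obtain ⟨m, -, rfl⟩ := List.mem_map.1 hb
    exact rel_shiftedVal_negatedRSI hφgt hw htie
  · refine .inl (Comparison.rsiTest_iff.2 ⟨c, ?_⟩)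
    rcases hrsi with rfl | rfl
    exacts [.inr hac, .inl hac]
  · right
    have hval := Comparison.holds_subst.2 hua
    obtain ⟨l, o, r⟩ := a
    obtain rfl : o = .eq := heq
    exact hsep _ hlS _ hrS hval

theorem IsInstance.exists_mappingTest (hlsi : lsi = .le ∨ lsi = .lt)
    (hrsi : rsi = .ge ∨ rsi = .gt) (h : IsInstance ι lsi rsi Q₂ Q₁) (hcon : Contained ι Q₂ Q₁)
    {ms : List BTree} (hsat : Satisfiable ι (uncovered Q₂ Q₁ ms)) :
    ∃ m, IsMappingCode Q₂ Q₁ m ∧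
      mappingTest Q₂ Q₁ (uncovered Q₂ Q₁ ms) (certMapping Q₂ m) = true ∧
      Q₁.negatedRSI (certMapping Q₂ m) ∉ ms.map fun m => Q₁.negatedRSI (certMapping Q₂ m) := by
  obtain ⟨v, hv, hsep, hle⟩ := exists_separating_model hsat
    (Q₂.terms ++ (Q₁.terms ++ acTerms Q₁.acs))
  obtain ⟨u, hmatch, hu⟩ := contained_iff.1 hcon v fun a ha => hv a (List.mem_append_right _ ha)
  obtain ⟨m, hm, hval⟩ := hmatch.exists_isMappingCode
  have hbody {x : ℕ} (hx : .var x ∈ Q₁.terms ++ acTerms Q₁.acs) := h.wf₁.inBody_of_mem hx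
  have hσ : ∀ s ∈ Q₁.terms ++ acTerms Q₁.acs, s.subst (certMapping Q₂ m) ∈
      Q₂.terms ++ (Q₁.terms ++ acTerms Q₁.acs) := by
    rintro (x | c) hs
    · exact List.mem_append_left _ (List.mem_append_left _ (hm.certMapping_mem (hbody hs)))
    · exact List.mem_append_right _ hs
  have hmatch' : IsMatch ι Q₁ (fun x => (certMapping Q₂ m x).val ι v) Q₂ v :=
    hmatch.of_forall_var fun x hx => hval x (hbody (List.mem_append_left _ hx))
  have hu' : AllHold ι (fun x => (certMapping Q₂ m x).val ι v) Q₁.acs :=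
    allHold_of_forall_var hu fun x hx => hval x (hbody (List.mem_append_right _ hx))
  refine ⟨m, hm, mappingTest_of_isMatch hsep (List.subset_append_left _ _)
    (fun s hs => hσ s (List.mem_append_left _ hs)) hmatch' fun a ha =>
      h.rsiTest_or_implied_subst hlsi hrsi hv hsep hle
        (fun s hs => hσ s (List.mem_append_right _ hs)) hu' ha, fun hmem => ?_⟩
  exact CQAC.negatedRSI_holds.1 (hv _ (List.mem_append_left _ hmem)) (CQAC.holds_rsi hu')

theorem IsInstance.exists_mappingChain (hlsi : lsi = .le ∨ lsi = .lt)
    (hrsi : rsi = .ge ∨ rsi = .gt) (h : IsInstance ι lsi rsi Q₂ Q₁) (hcon : Contained ι Q₂ Q₁)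
    (n : ℕ) : ∃ ms : List BTree, (∀ m ∈ ms, IsMappingCode Q₂ Q₁ m) ∧
      mappingChainTest Q₂ Q₁ ms = true ∧
      (ms.map fun m => Q₁.negatedRSI (certMapping Q₂ m)).Nodup ∧
      (ms.length = n ∨ ¬ Satisfiable ι (uncovered Q₂ Q₁ ms)) := by
  induction n with
  | zero => exact ⟨[], by simp, rfl, List.nodup_nil, .inl rfl⟩
  | succ n ih =>
    obtain ⟨ms, hms, hchain, hnodup, hn⟩ := ih
    by_cases hsat : Satisfiable ι (uncovered Q₂ Q₁ ms)
    · obtain ⟨m, hm, htest, hnew⟩ := h.exists_mappingTest hlsi hrsi hcon hsat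
      exact ⟨m :: ms, List.forall_mem_cons.2 ⟨hm, hms⟩, by simp [mappingChainTest, htest, hchain],
        List.nodup_cons.2 ⟨hnew, hnodup⟩, .inl (by simp [hn.resolve_right (not_not_intro hsat)])⟩
    · exact ⟨ms, hms, hchain, hnodup, .inr hsat⟩

theorem IsInstance.exists_containmentTest (hlsi : lsi = .le ∨ lsi = .lt)
    (hrsi : rsi = .ge ∨ rsi = .gt) (h : IsInstance ι lsi rsi Q₂ Q₁) (hcon : Contained ι Q₂ Q₁) :
    ∃ ms : List BTree, ms.length ≤ Q₂.bodyTerms.length + 1 ∧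
      (∀ m ∈ ms, IsMappingCode Q₂ Q₁ m) ∧ containmentTest Q₂ Q₁ ms = true := by
  obtain ⟨ms, hms, hchain, hnodup, hn⟩ :=
    h.exists_mappingChain hlsi hrsi hcon (Q₂.bodyTerms.length + 2)
  have hsub : (ms.map fun m => Q₁.negatedRSI (certMapping Q₂ m)) ⊆ negatedRSICandidates Q₂ Q₁ :=
    List.forall_mem_map.2 fun m hm => (hms m hm).negatedRSI_mem h.wf₁
  have hlen : ms.length ≤ Q₂.bodyTerms.length + 1 := by
    simpa [negatedRSICandidates] using (hnodup.subperm hsub).length_le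
  refine ⟨ms, hlen, hms, ?_⟩
  rw [containmentTest, hchain, Bool.true_and, Bool.not_eq_true', ← Bool.not_eq_true, satTest_iff ι]
  exact hn.resolve_left (by omega)

end ContainmentTest

/-! ### Membership in NP -/

theorem codeSize_le_of_forall_mem {α : Type*} [TreeCode α] {l : List α} {B : ℕ}
    (h : ∀ a ∈ l, codeSize a ≤ B) : codeSize l ≤ l.length * (B + 1) + 1 := by
  induction l with
  | nil => rw [codeSize_nil, List.length_nil, Nat.zero_mul]
  | cons a l ih =>
    obtain ⟨ha, hl⟩ := List.forall_mem_cons.1 h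
    rw [codeSize_cons, List.length_cons, Nat.succ_mul]
    have := ih hl
    omega

theorem inNP_of_polyTime {α : Type*} [TreeCode α] {f : α × BTree → Bool} (hf : PolyTime f)
    {B : α → ℕ} (hB : PolyBounded B) {L : Set α}
    (hsound : ∀ a w, f (a, w) = true → a ∈ L)
    (hcomplete : ∀ a ∈ L, ∃ w : BTree, w.size ≤ B a ∧ f (a, w) = true) :
    InNP (code (α := α)) L := by
  obtain ⟨V, k, T, ⟨p, hp⟩, hV⟩ := hf
  obtain ⟨q, hq⟩ := hB
  have haccepts (a : α) (w : BTree) : V.Accepts (.cons (code a) w) ↔ f (a, w) = true := by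
    obtain ⟨s, t, hrun, -, hs, -⟩ := hV (a, w) (inputStore (.cons (code a) w)) rfl
    have hs0 : s 0 ≠ .nil ↔ f (a, w) = true := by
      rw [hs]
      cases f (a, w) <;> simp [code, BTree.ofBool]
    exact ⟨fun ⟨s', t', hrun', hs'⟩ => hs0.1 (hrun'.store_unique hrun ▸ hs'),
      fun h => ⟨s, t, hrun, hs0.2 h⟩⟩
  refine ⟨V, p + q, fun a w => ?_, fun a => ⟨fun ha => ?_, fun ⟨w, _, hw⟩ =>
    hsound a w ((haccepts a w).1 hw)⟩⟩
  · obtain ⟨s, t, hrun, ht, -⟩ := hV (a, w) (inputStore (.cons (code a) w)) rfl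
    refine ⟨s, t, hrun, (ht.trans (hp (a, w))).trans ?_⟩
    rw [Polynomial.eval_add]
    exact Nat.le_add_right _ _
  · obtain ⟨w, hw, h⟩ := hcomplete a ha
    refine ⟨w, (hw.trans (hq a)).trans ?_, (haccepts a w).2 h⟩
    rw [Polynomial.eval_add]
    exact Nat.le_add_left _ _

theorem IsMappingCode.size_le {Q₂ Q₁ : CQAC} {m : BTree} (hm : IsMappingCode Q₂ Q₁ m) :
    m.size ≤ codeSize Q₁.bodyTerms * (codeSize Q₁.bodyTerms + codeSize Q₂.bodyTerms + 2) + 1 := by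
  obtain ⟨τ, hτ, rfl⟩ := hm
  have hpair : ∀ a ∈ Q₁.bodyTerms.map (fun s => (s, τ s)),
      codeSize a ≤ codeSize Q₁.bodyTerms + codeSize Q₂.bodyTerms + 1 :=
    List.forall_mem_map.2 fun s hs => by
      rw [codeSize_pair]
      have := codeSize_le_of_mem hs
      have := codeSize_le_of_mem (hτ s hs)
      omega
  refine (codeSize_le_of_forall_mem hpair).trans ?_
  rw [List.length_map]
  gcongr
  exact (length_lt_codeSize _).le

section Verify

variable {D : Type*} [LinearOrder D] [DenselyOrdered D] [NoMinOrder D] [NoMaxOrder D]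
  (ι : ℚ ↪o D) {lsi rsi : CompOp}

theorem isInstance_and_contained_of_verify {P : CQAC × CQAC} {w : BTree}
    (h : verify lsi rsi (P, w) = true) : IsInstance ι lsi rsi P.1 P.2 ∧ Contained ι P.1 P.2 := by
  rw [verify, Bool.and_eq_true, instanceTest_iff ι] at h
  exact ⟨h.1, contained_of_containmentTest h.1.inClass h.2⟩

theorem inNP_isInstance_and_contained (hlsi : lsi = .le ∨ lsi = .lt)
    (hrsi : rsi = .ge ∨ rsi = .gt) :
    InNP encQueryPair
      {P : CQAC × CQAC | IsInstance ι lsi rsi P.1 P.2 ∧ Contained ι P.1 P.2} := by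
  have h₂ : PolyBounded fun P : CQAC × CQAC => codeSize P.1.bodyTerms :=
    (PolyTime.bodyTerms (.fst .id)).polyBounded
  have h₁ : PolyBounded fun P : CQAC × CQAC => codeSize P.2.bodyTerms :=
    (PolyTime.bodyTerms (.snd .id)).polyBounded
  refine inNP_of_polyTime (PolyTime.verify lsi rsi)
    ((h₂.mul (((h₁.mul ((h₁.add h₂).add (.const 2))).add (.const 1)).add (.const 1))).add
      (.const 1)) (fun P w => isInstance_and_contained_of_verify ι)
    fun P ⟨hinst, hcon⟩ => ?_
  obtain ⟨ms, hlen, hms, htest⟩ := hinst.exists_containmentTest hlsi hrsi hcon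
  refine ⟨code ms, (codeSize_le_of_forall_mem fun m hm => (hms m hm).size_le).trans ?_, ?_⟩
  · gcongr
    exact hlen.trans (length_lt_codeSize _)
  · rw [verify, Bool.and_eq_true, instanceTest_iff ι, BTree.toList_code]
    exact ⟨hinst, (List.map_id ms).symm ▸ htest⟩

end Verify

theorem mainTheorem6 {D : Type*} [LinearOrder D] [DenselyOrdered D] [NoMinOrder D] [NoMaxOrder D]
    (ι : ℚ ↪o D) (lsi rsi : CompOp)
    (hlsi : lsi = CompOp.le ∨ lsi = CompOp.lt) (hrsi : rsi = CompOp.ge ∨ rsi = CompOp.gt) :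
    InNP encQueryPair
      {P : CQAC × CQAC | IsInstance ι lsi rsi P.1 P.2 ∧ Contained ι P.1 P.2} ∧
    ∀ Q₂ Q₁ : CQAC, IsInstance ι lsi rsi Q₂ Q₁ →
      (Contained ι Q₂ Q₁ ↔ ContainmentEntailment ι (Q₂.collapse ι) (Q₁.collapse ι)) :=
  ⟨inNP_isInstance_and_contained ι hlsi hrsi, fun _ _ h =>
    ⟨h.containmentEntailment_of_contained hlsi hrsi, contained_of_containmentEntailment⟩⟩
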